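/- **Setting.** Let $1\le k$, $d_2<d_1$, and let $W^*\in\mathbb R^{d_1\times d_2}$ have rank $k$ and columns of unit Euclidean norm, with singular values $\sigma_1^*\ge\dots\ge\sigma_k^*>0$. Write $\|\cdot\|_2$ for the spectral norm and $\operatorname{sign}(a)=1$ if $a\ge 0$, $\operatorname{sign}(a)=-1$ if $a<0$. For each batch $t=0,1,2,\dots$ one draws $m$ instances $(\mathbf x_i^{(t)},\bar{\mathbf e}_i^{(t)})$, $1\le i\le m$; all pairs (over all $t,i$) are i.i.d., where $\mathbf x$ is standard Gaussian in $\mathbb R^{d_1}$ and, independently of it, $\bar{\mathbf e}=\sqrt{d_2}\,\mathbf e_j$ with $j$ uniform on $\{1,\dots,d_2\}$. Put $\mathcal A_t(W)=(\mathbf x_i^{(t)\top}W\bar{\mathbf e}_i^{(t)})_{i\le m}$, $\mathcal A_t'(z)=\sum_i z_i\,\mathbf x_i^{(t)}\bar{\mathbf e}_i^{(t)\top}$; the observed labels are $\mathbf y^{(t)}=\operatorname{sign}(\mathcal A_t(W^*))$. For $W\in\mathbb R^{d_1\times d_2}$ let $\mathcal D(W)=\begin{bmatrix}0&W\\W^\top&0\end{bmatrix}$.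 **Algorithm ($T$ iterations).** Given a current estimate $W^{(t)}$ let $$H^{(t)}=\frac{\sqrt{d_2}}{m\sqrt{2/\pi}}\;\mathcal A_t'\big(\mathbf y^{(t)}-\operatorname{sign}(\mathcal A_t(W^{(t)}))\big).$$ Start with $\mathcal V^{(0)}=0$, $W^{(0)}=0$, and $\mathcal U^{(0)}\in\mathbb R^{(d_1+d_2)\times 2k}$ the top-$2k$ left singular vectors of $\mathcal D(H^{(0)})$. For $t=0,\dots,T-1$ let $\mathcal M^{(t)}=\mathcal D(H^{(t)})+\mathcal D(W^{(t)})$, let $\mathcal U^{(t+1)}$ be the orthonormal factor in a QR decomposition of $\mathcal M^{(t)}\mathcal U^{(t)}$, let $\mathcal V^{(t+1)}=\mathcal M^{(t)}\mathcal U^{(t+1)}$, and let $W^{(t+1)}$ be the upper right $d_1\times d_2$ block of $\mathcal U^{(t+1)}\mathcal V^{(t+1)\top}$ with each column divided by its Euclidean norm (zero columns stay zero). Any valid choice of singular vectors and of QR factors is allowed. In total $mT$ one-bit labels are used. **Theorem.** There is an absolute exponent $p\in\mathbb N$, and for every $\eta\in(0,1)$ a constant $C>0$ depending only on $\eta$,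 such that for all $d_1,d_2,k,T,m$ and $W^*$ as above the following hold, with $C_T=C\,T^p$. 1. Let $0<\delta_1\le 1$ and $$m\ \ge\ C_T\Big(12\sqrt5\,\frac{\sigma_1^*}{\sigma_k^*}+4\Big)^2\frac{d_1d_2k^{1.5}}{\delta_1^2}.$$ Then with probability at least $1-\eta$, for every run of the algorithm, if $t_0$ denotes the smallest integer $t_0>0$ with $\|W^*-W^{(t_0)}\|_2\le 1$ (with $t_0>T$ if there is none among $1,\dots,T$), then for all $0\le t<T$ $$\|W^*-W^{(t+1)}\|_2\le\delta_1^{\,t}\,\|W^*\|_2\quad\text{if }t<t_0,$$ $$\|W^*-W^{(t+1)}\|_2\le\delta_1^{\,2-2^{t_0-t}}\,\|W^{(t_0)}-W^*\|_2^{\,2^{t_0-1-t}}\quad\text{if }t\ge t_0 .$$ 2. Let $0<\varepsilon\le1$, $T\ge\log_2 d_2+\log_2\!\big(1+\log_2(1/\varepsilon)\big)+3$ and $$m\ \ge\ C_T\Big(12\sqrt5\,\frac{\sigma_1^*}{\sigma_k^*}+4\Big)^2\frac{d_1d_2k^{1.5}}{\varepsilon}.$$ Then with probability at least $1-\eta$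 every run of the algorithm ends with $\|W^*-W^{(T)}\|_2\le\varepsilon$. Thus the final error is $O(d_1d_2k^{1.5}/m)$, and error $\varepsilon$ is reached from a total of $mT=O(d_1d_2k^{1.5}/\varepsilon)$ labels, where $O$ hides $\eta$, the condition number $\sigma_1^*/\sigma_k^*$ and powers of $T$ (that is, of logarithms). -/

import Mathlib

open MeasureTheory ProbabilityTheory

namespace OneBit

noncomputable section

/-- The signum function with the convention `sgn 0 = 1`. -/
def sgn (a : ℝ) : ℝ := if 0 ≤ a then 1 else -1

/-- The spectral norm `‖M‖₂`: the operator norm between Euclidean spaces. -/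
def specNorm {d₁ d₂ : ℕ} (M : Matrix (Fin d₁) (Fin d₂) ℝ) : ℝ :=
  ‖(Matrix.toEuclideanLin M).toContinuousLinearMap‖

/-- The `i`-th largest singular value of `M`, counted from `i = 1`. -/
def singVal {d₁ d₂ : ℕ} (M : Matrix (Fin d₁) (Fin d₂) ℝ) (i : ℕ) : ℝ :=
  (Matrix.toEuclideanLin M).singularValues (i - 1)

/-- A mini-batch of `m` instances: feature vectors `xᵢ` and indices of the selected labels. -/
abbrev Batch (m d₁ d₂ : ℕ) : Type := Fin m → (Fin d₁ → ℝ) × Fin d₂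

/-- The scaled one-hot vector `√d₂ · e_j`. -/
def oneHot {d₂ : ℕ} (j : Fin d₂) : Fin d₂ → ℝ := Pi.single j (Real.sqrt d₂)

/-- The sensing operator `𝒜(W) = (xᵢᵀ W ēᵢ)ᵢ`. -/
def sensing {m d₁ d₂ : ℕ} (b : Batch m d₁ d₂) (W : Matrix (Fin d₁) (Fin d₂) ℝ) : Fin m → ℝ :=
  fun i => (b i).1 ⬝ᵥ Matrix.mulVec W (oneHot (b i).2)

/-- The adjoint `𝒜'(z) = ∑ᵢ zᵢ xᵢ ēᵢᵀ` of the sensing operator. -/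
def sensingAdj {m d₁ d₂ : ℕ} (b : Batch m d₁ d₂) (z : Fin m → ℝ) :
    Matrix (Fin d₁) (Fin d₂) ℝ :=
  ∑ i, z i • Matrix.vecMulVec (b i).1 (oneHot (b i).2)

/-- The one-bit labels `sign(𝒜(W))`. -/
def labels {m d₁ d₂ : ℕ} (b : Batch m d₁ d₂) (W : Matrix (Fin d₁) (Fin d₂) ℝ) : Fin m → ℝ :=
  fun i => sgn (sensing b W i)

/-- `H = √d₂ / (m λ) · 𝒜'(y - sign(𝒜(W)))` with `λ = √(2/π)`. -/
def correction {m d₁ d₂ : ℕ} (b : Batch m d₁ d₂) (y : Fin m → ℝ)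
    (W : Matrix (Fin d₁) (Fin d₂) ℝ) : Matrix (Fin d₁) (Fin d₂) ℝ :=
  (Real.sqrt d₂ / (m * Real.sqrt (2 / Real.pi))) • sensingAdj b (y - labels b W)

/-- The Hermitian dilation `[[0, W], [Wᵀ, 0]]`. -/
def dilation {d₁ d₂ : ℕ} (W : Matrix (Fin d₁) (Fin d₂) ℝ) :
    Matrix (Fin d₁ ⊕ Fin d₂) (Fin d₁ ⊕ Fin d₂) ℝ :=
  Matrix.fromBlocks 0 W W.transpose 0

/-- Column normalization; a zero column is left equal to zero. -/
def colNormalize {d₁ d₂ : ℕ} (A : Matrix (Fin d₁) (Fin d₂) ℝ) : Matrix (Fin d₁) (Fin d₂) ℝ :=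
  Matrix.of fun i j => A i j / Real.sqrt (∑ l, A l j ^ 2)

/-- The estimate read off from the factors `U, V`: the off-diagonal `d₁ × d₂` block of `U Vᵀ`,
with normalized columns. -/
def estimate {d₁ d₂ r : ℕ} (U V : Matrix (Fin d₁ ⊕ Fin d₂) (Fin r) ℝ) :
    Matrix (Fin d₁) (Fin d₂) ℝ :=
  colNormalize (U * V.transpose).toBlocks₁₂

/-- The columns of `U` are top-`r` left singular vectors of the square matrix `A`: they are the
first `r` columns of the left factor of some singular value decomposition of `A` with singular
values in decreasing order. -/
def IsTopLeftSingular {n : Type} [Fintype n] {r : ℕ} (A : Matrix n n ℝ)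
    (U : Matrix n (Fin r) ℝ) : Prop :=
  ∃ (h : r ≤ Fintype.card n) (P Q : Matrix n (Fin (Fintype.card n)) ℝ)
    (s : Fin (Fintype.card n) → ℝ),
    P.transpose * P = 1 ∧ Q.transpose * Q = 1 ∧ Antitone s ∧ (∀ i, 0 ≤ s i) ∧
    A = P * Matrix.diagonal s * Q.transpose ∧
    ∀ a i, U a i = P a (Fin.castLE h i)

/-- `Q` is the orthonormal factor of a (thin) QR decomposition of `A`. -/
def IsQRFactor {n : Type} [Fintype n] {r : ℕ} (A Q : Matrix n (Fin r) ℝ) : Prop :=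
  Q.transpose * Q = 1 ∧
    ∃ R : Matrix (Fin r) (Fin r) ℝ, (∀ i j, j < i → R i j = 0) ∧ A = Q * R

/-- `U, V` are the factors produced by the alternating power iteration in `T` steps with target
rank `k`, on the mini-batches `b 0, …, b (T - 1)` with label vectors `y 0, …, y (T - 1)`; any
valid choice in the singular value decomposition and in the QR decompositions is allowed. -/
structure IsRun {m d₁ d₂ : ℕ} (k T : ℕ) (b : ℕ → Batch m d₁ d₂) (y : ℕ → Fin m → ℝ)
    (U V : ℕ → Matrix (Fin d₁ ⊕ Fin d₂) (Fin (2 * k)) ℝ) : Prop where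
  init_V : V 0 = 0
  init_U : IsTopLeftSingular (dilation (correction (b 0) (y 0) 0)) (U 0)
  step_U : ∀ t < T, IsQRFactor
    ((dilation (correction (b t) (y t) (estimate (U t) (V t))) +
      dilation (estimate (U t) (V t))) * U t) (U (t + 1))
  step_V : ∀ t < T, V (t + 1) =
    (dilation (correction (b t) (y t) (estimate (U t) (V t))) +
      dilation (estimate (U t) (V t))) * U (t + 1)

/-- The stream of mini-batches: batch `t` consists of the instances `Z (t, i)`. -/
def stream {Ω : Type*} {m d₁ d₂ : ℕ} (Z : ℕ × Fin m → Ω → (Fin d₁ → ℝ) × Fin d₂) (ω : Ω) :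
    ℕ → Batch m d₁ d₂ :=
  fun t i => Z (t, i) ω

/-- The law of one instance: a standard Gaussian feature vector and, independently of it, a
uniformly distributed label index. -/
def instanceLaw (d₁ d₂ : ℕ) : Measure ((Fin d₁ → ℝ) × Fin d₂) :=
  (Measure.pi fun _ : Fin d₁ => gaussianReal 0 1).prod (uniformOn (Set.univ : Set (Fin d₂)))

/-- The scale `(12√5 σ₁/σ_k + 4)² d₁ d₂ k^{3/2}` of the batch size. -/
def sampleScale {d₁ d₂ : ℕ} (k : ℕ) (W : Matrix (Fin d₁) (Fin d₂) ℝ) : ℝ :=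
  (12 * Real.sqrt 5 * (singVal W 1 / singVal W k) + 4) ^ 2 * d₁ * d₂ * (k : ℝ) ^ (3 / 2 : ℝ)

/-- The two-phase error bound for the errors `err t = ‖W* - W⁽ᵗ⁾‖₂`, `t ≤ T`, with `nrm = ‖W*‖₂`.
Here `t₀` is the smallest positive integer with `err t₀ ≤ 1` (or exceeds `T` if no such integer
is reached within the `T` iterations). -/
def TwoPhase (T : ℕ) (δ nrm : ℝ) (err : ℕ → ℝ) : Prop :=
  ∃ t₀ : ℕ, 0 < t₀ ∧ (∀ s, 0 < s → s < t₀ → s ≤ T → 1 < err s) ∧ (t₀ ≤ T → err t₀ ≤ 1) ∧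
    (∀ t < T, t < t₀ → err (t + 1) ≤ δ ^ t * nrm) ∧
    (∀ t < T, t₀ ≤ t → err (t + 1) ≤
      δ ^ (2 - (2 : ℝ) ^ ((t₀ : ℝ) - t)) * err t₀ ^ ((2 : ℝ) ^ ((t₀ : ℝ) - 1 - t)))

end

end OneBit

/-! Write `W` for the current estimate and `Ws` for the truth. For a unit vector w and a standard
Gaussian x one has E[sgn⟨w,x⟩ x] = √(2/π) w, and for w = 0 the sign is constant and the mean is 0.
Columns of estimates are unit or zero, so the correction is an unbiased estimator of `Ws - W`, and
the iteration matrix is the dilation of `Ws` plus the dilation E of a centred `noise`.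

The two signs in a label difference disagree only when ⟨u,x⟩ is small compared with a linear form of
size ‖w - u‖ (`integral_sgn_sub_sgn_sq_mul_le`). The variance of the noise is therefore proportional
to the current error e itself: for a fixed matrix X the mean of ‖EX‖² in Frobenius norm is at most a
constant times (d₁d₂/m) · e · ‖X‖² (`NoiseSetup.frob_dilation_mul`). For X of squared norm 2k this
makes the next error at most δ√e.

Let P and P' be the projections onto the old and the new subspace, and Q the one onto the range of
the dilation of `Ws`. P' depends on the current noise, but `IsRangeData.step` bounds the new error
by 2‖EP‖ + ‖EQ‖. Here P comes from earlier batches and Q is fixed, so the second moment bound and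
Markov's inequality apply. The exception is step 0, where the initial subspace and the noise share a
batch; there the crude bound ‖E‖ ≤ σ/8 gives a first error of at most ‖Ws‖.

Conditioning on the past needs a measurable state although singular vectors and QR factors may be
chosen arbitrarily. The estimate depends on U only through U Uᵀ, and on the good event this
projection is given by choice-free measurable formulas (`nextProj_eq`, `IsRangeData.initProj_eq`).
Hence one good event, of probability at least 1 - η by a union bound over T steps with three
conditions each, serves all runs at once, and p = 1 suffices.

On it, err(t+1) ≤ δ√(err t). Above 1 the square root is at most its argument and the decay is
geometric; afterwards the exponents are iterated exactly (`twoPhase_of_recursion`). With δ = √ε/2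
the recursion has fixed point ε/4, which yields the final error (`final_error_le`). -/

namespace OneBit

set_option linter.unusedSectionVars false

/-! ### The Frobenius norm -/

section Frobenius

variable {l m n : Type*} [Fintype l] [Fintype m] [Fintype n]

/-- The Frobenius norm of a real matrix. -/
noncomputable def frob (A : Matrix m n ℝ) : ℝ := Real.sqrt (∑ i, ∑ j, A i j ^ 2)

open scoped Matrix.Norms.Frobenius in
theorem frob_eq_norm (A : Matrix m n ℝ) : frob A = ‖A‖ := by
  rw [frob, Matrix.frobenius_norm_def, Real.sqrt_eq_rpow]
  simp

theorem frob_nonneg (A : Matrix m n ℝ) : 0 ≤ frob A := Real.sqrt_nonneg _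

theorem frob_sq (A : Matrix m n ℝ) : frob A ^ 2 = ∑ i, ∑ j, A i j ^ 2 :=
  Real.sq_sqrt (Finset.sum_nonneg fun _ _ => Finset.sum_nonneg fun _ _ => sq_nonneg _)

theorem frob_sq_eq_trace (A : Matrix m n ℝ) : frob A ^ 2 = (A * A.transpose).trace := by
  rw [frob_sq]
  simp [Matrix.trace, Matrix.mul_apply, sq]

theorem frob_sq_eq_trace' (A : Matrix m n ℝ) : frob A ^ 2 = (A.transpose * A).trace := by
  rw [frob_sq_eq_trace, Matrix.trace_mul_comm]

open scoped Matrix.Norms.Frobenius in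
theorem frob_add_le (A B : Matrix m n ℝ) : frob (A + B) ≤ frob A + frob B := by
  simpa only [frob_eq_norm] using norm_add_le A B

open scoped Matrix.Norms.Frobenius in
theorem frob_sub_le (A B : Matrix m n ℝ) : frob (A - B) ≤ frob A + frob B := by
  simpa only [frob_eq_norm] using norm_sub_le A B

open scoped Matrix.Norms.Frobenius in
theorem frob_mul_le (A : Matrix l m ℝ) (B : Matrix m n ℝ) : frob (A * B) ≤ frob A * frob B := by
  simpa only [frob_eq_norm] using Matrix.frobenius_norm_mul A B

theorem frob_neg (A : Matrix m n ℝ) : frob (-A) = frob A := by simp [frob]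

theorem frob_transpose (A : Matrix m n ℝ) : frob A.transpose = frob A := by
  rw [frob, frob, Finset.sum_comm]; rfl

/-- Orthogonal projection matrices. -/
structure IsProj (P : Matrix n n ℝ) : Prop where
  symm : P.transpose = P
  idem : P * P = P

variable [DecidableEq n] {P Q : Matrix n n ℝ}

theorem IsProj.compl (hP : IsProj P) : IsProj (1 - P) where
  symm := by simp [hP.symm]
  idem := by simp [sub_mul, mul_sub, hP.idem]

theorem isProj_mul_transpose [DecidableEq m] {U : Matrix n m ℝ} (hU : U.transpose * U = 1) :
    IsProj (U * U.transpose) where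
  symm := by simp
  idem := by rw [Matrix.mul_assoc, ← Matrix.mul_assoc U.transpose, hU, Matrix.one_mul]

theorem IsProj.frob_mul_sq (hP : IsProj P) (A : Matrix n m ℝ) :
    frob (P * A) ^ 2 = (P * (A * A.transpose)).trace := by
  rw [frob_sq_eq_trace, Matrix.transpose_mul, hP.symm, ← Matrix.mul_assoc, Matrix.trace_mul_comm,
    ← Matrix.mul_assoc, ← Matrix.mul_assoc, hP.idem, Matrix.mul_assoc]

theorem IsProj.frob_mul_sq_add (hP : IsProj P) (A : Matrix n m ℝ) :
    frob (P * A) ^ 2 + frob ((1 - P) * A) ^ 2 = frob A ^ 2 := by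
  rw [hP.frob_mul_sq, hP.compl.frob_mul_sq, frob_sq_eq_trace, ← Matrix.trace_add, ← add_mul,
    add_sub_cancel, Matrix.one_mul]

theorem IsProj.frob_mul_le (hP : IsProj P) (A : Matrix n m ℝ) : frob (P * A) ≤ frob A :=
  (sq_le_sq₀ (frob_nonneg _) (frob_nonneg _)).1
    (by nlinarith [hP.frob_mul_sq_add A, sq_nonneg (frob ((1 - P) * A))])

theorem IsProj.frob_mul_le' (hP : IsProj P) (A : Matrix m n ℝ) : frob (A * P) ≤ frob A := by
  rw [← frob_transpose, Matrix.transpose_mul, hP.symm, ← frob_transpose A]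
  exact hP.frob_mul_le _

theorem IsProj.frob_sq (hP : IsProj P) : frob P ^ 2 = P.trace := by
  rw [frob_sq_eq_trace, hP.symm, hP.idem]

/-- Both squares are a trace minus tr(PQ), so equal ranks make the gap between two subspaces
symmetric. -/
theorem IsProj.frob_compl_mul_comm (hP : IsProj P) (hQ : IsProj Q) (h : P.trace = Q.trace) :
    frob ((1 - Q) * P) = frob ((1 - P) * Q) := by
  have key : frob ((1 - Q) * P) ^ 2 = frob ((1 - P) * Q) ^ 2 := by
    rw [hQ.compl.frob_mul_sq, hP.compl.frob_mul_sq, hP.symm, hQ.symm, hP.idem, hQ.idem,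
      sub_mul, sub_mul, Matrix.one_mul, Matrix.one_mul, Matrix.trace_sub, Matrix.trace_sub,
      Matrix.trace_mul_comm Q P, h]
  exact (sq_eq_sq₀ (frob_nonneg _) (frob_nonneg _)).1 key

end Frobenius

/-! ### Perturbation of one step of subspace iteration -/

section Perturbation

variable {n : Type*} [Fintype n] [DecidableEq n]

/-- `D` is a symmetric matrix with range projection `Q` whose nonzero eigenvalues have absolute
value at least `σ`; `Dp` is its pseudo-inverse. -/
structure IsRangeData (D Q Dp : Matrix n n ℝ) (σ : ℝ) : Prop where
  pos : 0 < σ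
  symm : D.transpose = D
  proj : IsProj Q
  mul_proj : D * Q = D
  mul_pinv : D * Dp = Q
  pinv_mul : Dp * D = Q
  frob_mul_pinv : ∀ X : Matrix n n ℝ, σ * frob (X * Dp) ≤ frob X
  frob_pinv_mul : ∀ {l : Type} [Fintype l] (X : Matrix n l ℝ), σ * frob (Dp * X) ≤ frob X

variable {D Q Dp : Matrix n n ℝ} {σ : ℝ}

theorem IsRangeData.proj_mul (h : IsRangeData D Q Dp σ) : Q * D = D := by
  have := congrArg Matrix.transpose h.mul_proj
  rwa [Matrix.transpose_mul, h.symm, h.proj.symm] at this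

/-- Since P' absorbs the range of (D + E)P, the part of D missed by P' acts on the range of P like
-(1 - P')E. As P is already close to Q, this determines (1 - P')D up to a quarter of itself, which
is absorbed: 1/(1 - 1/4) = 4/3. -/
theorem IsRangeData.compl_mul_range (h : IsRangeData D Q Dp σ) {P P' E : Matrix n n ℝ}
    (hP : IsProj P) (hP' : IsProj P') (hzero : (1 - P') * ((D + E) * P) = 0)
    (hPQ : frob ((1 - P) * Q) ≤ 1 / 2) :
    frob ((1 - P') * D) ≤ 4 / 3 * frob (E * P) := by
  set X := (1 - P') * D with hX
  have hXP : X * P = -((1 - P') * (E * P)) := by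
    rw [add_mul, mul_add] at hzero
    rw [hX, Matrix.mul_assoc]
    exact eq_neg_of_add_eq_zero_left hzero
  have hXQ : X * Q = X := by rw [hX, Matrix.mul_assoc, h.mul_proj]
  -- Split X = XQ by 1 = P + (1 - P). The second term is quadratic in (1 - P)Q because X = XQ; this
  -- produces the coefficient 1/4.
  have hdec : X = X * P * Q + X * (((1 - P) * Q).transpose * ((1 - P) * Q)) := by
    have : ((1 - P) * Q).transpose * ((1 - P) * Q) = Q * ((1 - P) * Q) := by
      rw [Matrix.transpose_mul, hP.compl.symm, h.proj.symm, Matrix.mul_assoc,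
        ← Matrix.mul_assoc (1 - P), hP.compl.idem]
    rw [this, ← Matrix.mul_assoc X, hXQ, ← Matrix.mul_assoc, ← add_mul, ← mul_add,
      add_sub_cancel, Matrix.mul_one, hXQ]
  have h1 : frob (X * P * Q) ≤ frob (E * P) := by
    refine (h.proj.frob_mul_le' _).trans ?_
    rw [hXP, frob_neg]
    exact hP'.compl.frob_mul_le _
  have h2 : frob (X * (((1 - P) * Q).transpose * ((1 - P) * Q))) ≤ frob X * (1 / 4) := by
    refine (frob_mul_le _ _).trans (mul_le_mul_of_nonneg_left ?_ (frob_nonneg _))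
    refine (frob_mul_le _ _).trans ?_
    rw [frob_transpose]
    nlinarith [frob_nonneg ((1 - P) * Q)]
  have h3 : frob X ≤ frob (X * P * Q) + frob (X * (((1 - P) * Q).transpose * ((1 - P) * Q))) := by
    conv_lhs => rw [hdec]
    exact frob_add_le _ _
  linarith

theorem IsRangeData.frob_compl_mul_proj (h : IsRangeData D Q Dp σ) (P : Matrix n n ℝ) :
    σ * frob ((1 - P) * Q) ≤ frob ((1 - P) * D) := by
  rw [← h.mul_pinv, ← Matrix.mul_assoc]
  exact h.frob_mul_pinv _

/-- The first conclusion keeps the hypothesis on P alive for the next step. The second is the error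
bound, in which E meets only P and Q and never P', the projection that depends on the same batch as
E. -/
theorem IsRangeData.step (h : IsRangeData D Q Dp σ) {P P' E : Matrix n n ℝ}
    (hP : IsProj P) (hP' : IsProj P') (htr : P'.trace = Q.trace) (hE : E.transpose = E)
    (hzero : (1 - P') * ((D + E) * P) = 0) (hPQ : frob ((1 - P) * Q) ≤ 1 / 2)
    (hEσ : frob E ≤ σ / 8) :
    frob ((1 - P') * Q) ≤ 1 / 2 ∧
      frob (D - P' * (D + E)) ≤ 2 * frob (E * P) + frob (E * Q) := by
  have hσ := h.pos
  have h1 := h.compl_mul_range hP hP' hzero hPQ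
  have h2 := h.frob_compl_mul_proj P'
  have h3 : frob (E * P) ≤ frob E := hP.frob_mul_le' _
  have hEP := frob_nonneg (E * P)
  have h4 : frob (P' * E) ≤ frob (E * Q) + 1 / 2 * frob (E * P) := by
    have e1 : frob (P' * E) = frob (E * P') := by
      rw [← frob_transpose, Matrix.transpose_mul, hE, hP'.symm]
    -- Trading P' for Q costs ‖E‖ · ‖(1 - Q)P'‖, which is at most (σ/8) · (4/3)‖EP‖/σ ≤ ‖EP‖/2.
    have e2 : E * P' = E * Q * P' + E * ((1 - Q) * P') := by
      rw [← Matrix.mul_assoc, ← add_mul, mul_sub, Matrix.mul_one, add_sub_cancel]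
    rw [e1, e2]
    refine (frob_add_le _ _).trans (add_le_add (hP'.frob_mul_le' _) ?_)
    refine (frob_mul_le _ _).trans ?_
    rw [hP'.frob_compl_mul_comm h.proj htr]
    have := frob_nonneg ((1 - P') * Q)
    nlinarith
  refine ⟨?_, ?_⟩
  · by_contra! hc
    nlinarith
  · have e : D - P' * (D + E) = (1 - P') * D - P' * E := by
      rw [sub_mul, mul_add, Matrix.one_mul]; abel
    rw [e]
    refine (frob_sub_le _ _).trans ?_
    linarith

end Perturbation

/-! ### Initialization by singular vectors -/

section Init

variable {n : Type} [Fintype n]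

theorem mul_transpose_eq_indicator {r N : ℕ} (h : r ≤ N) {P : Matrix n (Fin N) ℝ}
    {U : Matrix n (Fin r) ℝ} (hU : ∀ a i, U a i = P a (Fin.castLE h i)) :
    U * U.transpose =
      P * Matrix.diagonal (fun i : Fin N => if (i : ℕ) < r then (1 : ℝ) else 0) * P.transpose := by
  ext a b
  rw [Matrix.mul_apply, Matrix.mul_apply]
  simp only [Matrix.transpose_apply, hU, Matrix.mul_diagonal, mul_ite, mul_one, mul_zero, ite_mul,
    zero_mul]
  rw [← Finset.sum_filter]
  refine Finset.sum_bij (fun i _ => Fin.castLE h i) (by simp) (by simp) ?_ (by simp)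
  intro i hi
  exact ⟨⟨i, by simpa using hi⟩, Finset.mem_univ _, by ext; simp⟩

theorem transpose_mul_of_cols {r N : ℕ} (h : r ≤ N) {P : Matrix n (Fin N) ℝ}
    (hP : P.transpose * P = 1) {U : Matrix n (Fin r) ℝ}
    (hU : ∀ a i, U a i = P a (Fin.castLE h i)) : U.transpose * U = 1 := by
  ext i j
  have := congrFun (congrFun hP (Fin.castLE h i)) (Fin.castLE h j)
  simp only [Matrix.mul_apply, Matrix.transpose_apply, hU] at this ⊢
  rw [this, Matrix.one_apply, Matrix.one_apply]
  simp [Fin.ext_iff]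

/-- The bathtub principle: among weights in [0,1] of total mass r, the sum is largest when they sit
on the r largest values. -/
theorem sum_mul_le_sum_top {N r : ℕ} (hr : r ≤ N) (hr0 : 0 < r) {a c : Fin N → ℝ} (ha : Antitone a)
    (hc0 : ∀ i, 0 ≤ c i) (hc1 : ∀ i, c i ≤ 1) (hsum : ∑ i, c i = r) :
    ∑ i, a i * c i ≤ ∑ i : Fin N, a i * (if (i : ℕ) < r then 1 else 0) := by
  -- The r-th largest value, at index r - 1. Subtracting it changes nothing since both weights have
  -- mass r, and then every term has a sign.
  set τ := a ⟨r - 1, by omega⟩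
  have hcard : ∑ i : Fin N, (if (i : ℕ) < r then (1 : ℝ) else 0) = r := by
    rw [Finset.sum_boole]
    have : (Finset.univ.filter fun i : Fin N => (i : ℕ) < r).card = r := by
      rw [Fin.card_filter_val_lt]
      exact min_eq_right hr
    rw [this]
  have : 0 ≤ ∑ i : Fin N, (a i - τ) * ((if (i : ℕ) < r then 1 else 0) - c i) := by
    refine Finset.sum_nonneg fun i _ => ?_
    split_ifs with h
    · exact mul_nonneg (sub_nonneg.2 (ha (by simp only [Fin.le_def]; omega)))
        (sub_nonneg.2 (hc1 i))
    · refine mul_nonneg_of_nonpos_of_nonpos (sub_nonpos.2 (ha (by simp only [Fin.le_def]; omega)))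
        (by linarith [hc0 i])
  simp only [sub_mul, mul_sub, Finset.sum_sub_distrib, ← Finset.mul_sum] at this
  rw [hcard, hsum] at this
  linarith

theorem IsTopLeftSingular.isProj {r : ℕ} {A : Matrix n n ℝ} {U : Matrix n (Fin r) ℝ}
    (h : IsTopLeftSingular A U) : U.transpose * U = 1 := by
  obtain ⟨hr, P, Q, s, hP, hQ, hs, hs0, hA, hU⟩ := h
  exact transpose_mul_of_cols hr hP hU

theorem mul_transpose_of_svd {N : ℕ} {A : Matrix n n ℝ} {P Q : Matrix n (Fin N) ℝ} {s : Fin N → ℝ}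
    (hQ : Q.transpose * Q = 1) (hA : A = P * Matrix.diagonal s * Q.transpose) :
    A * A.transpose = P * Matrix.diagonal (fun i => s i ^ 2) * P.transpose := by
  rw [hA]
  simp only [Matrix.transpose_mul, Matrix.transpose_transpose, Matrix.diagonal_transpose]
  rw [show P * Matrix.diagonal s * Q.transpose * (Q * (Matrix.diagonal s * P.transpose)) =
    P * (Matrix.diagonal s * (Q.transpose * Q) * Matrix.diagonal s) * P.transpose by
      simp only [Matrix.mul_assoc], hQ, Matrix.mul_one, Matrix.diagonal_mul_diagonal]
  simp only [sq]

variable [DecidableEq n]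

/-- The top left singular vectors capture at least as much of `A` as any other projection of the
same rank. -/
theorem IsTopLeftSingular.frob_compl_le {r : ℕ} {A : Matrix n n ℝ} {U : Matrix n (Fin r) ℝ}
    (h : IsTopLeftSingular A U) (hr0 : 0 < r) {R : Matrix n n ℝ} (hR : IsProj R)
    (htr : R.trace = r) :
    frob ((1 - U * U.transpose) * A) ≤ frob ((1 - R) * A) := by
  have hUp := isProj_mul_transpose h.isProj
  obtain ⟨hr, P, Q, s, hP, hQ, hs, hs0, hA, hU⟩ := h
  have hP' : P * P.transpose = 1 := by
    exact (Matrix.mul_eq_one_comm_of_card_eq _ _ _ (by simp)).1 hP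
  have hAA := mul_transpose_of_svd hQ hA
  have htrace : ∀ c : Matrix n n ℝ, (c * (A * A.transpose)).trace =
      ∑ i, s i ^ 2 * (P.transpose * c * P) i i := by
    intro c
    rw [hAA, ← Matrix.mul_assoc, Matrix.trace_mul_comm, ← Matrix.mul_assoc, ← Matrix.mul_assoc]
    simp only [Matrix.trace, Matrix.diag, Matrix.mul_diagonal]
    exact Finset.sum_congr rfl fun i _ => mul_comm _ _
  -- In the singular basis a projection R of rank r has diagonal weights in [0,1] with sum r, and
  -- ‖RA‖² is the weighted sum of the squared singular values.
  have hc0 : ∀ i, 0 ≤ (P.transpose * R * P) i i := by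
    intro i
    have : P.transpose * R * P = (R * P).transpose * (R * P) := by
      rw [Matrix.transpose_mul, hR.symm, Matrix.mul_assoc, Matrix.mul_assoc, ← Matrix.mul_assoc R,
        hR.idem]
    rw [this, Matrix.mul_apply]
    exact Finset.sum_nonneg fun j _ => by
      rw [Matrix.transpose_apply]; exact mul_self_nonneg _
  have hc1 : ∀ i, (P.transpose * R * P) i i ≤ 1 := by
    intro i
    have : P.transpose * R * P = 1 - ((1 - R) * P).transpose * ((1 - R) * P) := by
      rw [Matrix.transpose_mul, hR.compl.symm, Matrix.mul_assoc, Matrix.mul_assoc,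
        ← Matrix.mul_assoc (1 - R), hR.compl.idem, Matrix.sub_mul, Matrix.mul_sub, Matrix.one_mul,
        hP, sub_sub_cancel]
    rw [this, Matrix.sub_apply, Matrix.one_apply_eq, Matrix.mul_apply]
    have : 0 ≤ ∑ j, ((1 - R) * P).transpose i j * ((1 - R) * P : Matrix n _ ℝ) j i :=
      Finset.sum_nonneg fun j _ => by rw [Matrix.transpose_apply]; exact mul_self_nonneg _
    linarith
  have hsum : ∑ i, (P.transpose * R * P) i i = r := by
    change (P.transpose * R * P).trace = r
    rw [Matrix.mul_assoc, Matrix.trace_mul_comm, Matrix.mul_assoc, hP', Matrix.mul_one, htr]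
  have key := sum_mul_le_sum_top hr hr0 (a := fun i => s i ^ 2)
    (fun i j hij => pow_le_pow_left₀ (hs0 j) (hs hij) 2) hc0 hc1 hsum
  have hPU : P.transpose * (U * U.transpose) * P =
      Matrix.diagonal (fun i : Fin (Fintype.card n) => if (i : ℕ) < r then (1 : ℝ) else 0) := by
    rw [mul_transpose_eq_indicator hr hU]
    simp only [← Matrix.mul_assoc, hP, Matrix.one_mul]
    rw [Matrix.mul_assoc, hP, Matrix.mul_one]
  have h1 := hR.frob_mul_sq_add A
  have h2 := hUp.frob_mul_sq_add A
  rw [hR.frob_mul_sq, htrace] at h1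
  rw [hUp.frob_mul_sq, htrace, hPU] at h2
  simp only [Matrix.diagonal_apply_eq] at h2
  refine (sq_le_sq₀ (frob_nonneg _) (frob_nonneg _)).1 ?_
  linarith

variable {D Q Dp : Matrix n n ℝ} {σ : ℝ}

/-- Optimality of the singular vectors against the competitor Q, for which (1 - Q)(D + E) = (1 -
Q)E. Passing from D + E to D costs another ‖E‖, so the gap is at most 2(σ/8)/σ = 1/4. -/
theorem IsRangeData.init (h : IsRangeData D Q Dp σ) {r : ℕ} (hr0 : 0 < r) (htr : Q.trace = r)
    {E : Matrix n n ℝ} {U : Matrix n (Fin r) ℝ} (hU : IsTopLeftSingular (D + E) U)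
    (hEσ : frob E ≤ σ / 8) :
    frob ((1 - U * U.transpose) * (D + E)) ≤ frob E ∧
      frob ((1 - U * U.transpose) * Q) ≤ 1 / 4 := by
  have hσ := h.pos
  have h1 : frob ((1 - U * U.transpose) * (D + E)) ≤ frob E := by
    refine (hU.frob_compl_le hr0 h.proj htr).trans ?_
    have : (1 - Q) * (D + E) = (1 - Q) * E := by
      rw [mul_add, sub_mul, h.proj_mul, Matrix.one_mul, sub_self, zero_add]
    rw [this]
    exact h.proj.compl.frob_mul_le _
  refine ⟨h1, ?_⟩
  have h2 := h.frob_compl_mul_proj (U * U.transpose)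
  have h3 : frob ((1 - U * U.transpose) * D) ≤ frob E + frob E := by
    have : (1 - U * U.transpose) * D =
        (1 - U * U.transpose) * (D + E) - (1 - U * U.transpose) * E := by
      rw [mul_add, add_sub_cancel_right]
    rw [this]
    exact (frob_sub_le _ _).trans
      (add_le_add h1 ((isProj_mul_transpose hU.isProj).compl.frob_mul_le _))
  nlinarith [frob_nonneg ((1 - U * U.transpose) * Q)]

end Init

/-! ### Thin singular value decomposition -/

section SVD

variable {d₁ d₂ k : ℕ}

theorem rank_eq_finrank_range_toEuclideanLin (W : Matrix (Fin d₁) (Fin d₂) ℝ) :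
    Module.finrank ℝ (Matrix.toEuclideanLin W).range = W.rank := by
  rw [Matrix.rank_eq_finrank_range_toLin W (EuclideanSpace.basisFun (Fin d₁) ℝ).toBasis
    (EuclideanSpace.basisFun (Fin d₂) ℝ).toBasis, ← Matrix.toEuclideanLin_eq_toLin_orthonormal]

theorem singVal_pos {W : Matrix (Fin d₁) (Fin d₂) ℝ} (hW : W.rank = k) {i : ℕ} (hi0 : 1 ≤ i)
    (hi : i ≤ k) : 0 < singVal W i := by
  rw [singVal, LinearMap.singularValues_pos_iff_lt_finrank_range,
    rank_eq_finrank_range_toEuclideanLin, hW]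
  omega

theorem singVal_anti (W : Matrix (Fin d₁) (Fin d₂) ℝ) {i j : ℕ} (h : i ≤ j) :
    singVal W j ≤ singVal W i :=
  LinearMap.singularValues_antitone _ (Nat.sub_le_sub_right h 1)

/-- An eigenbasis of the composite of the adjoint of T with T. -/
theorem exists_orthonormalBasis_inner_map (T : EuclideanSpace ℝ (Fin d₂) →ₗ[ℝ]
    EuclideanSpace ℝ (Fin d₁)) : ∃ b : OrthonormalBasis (Fin d₂) ℝ (EuclideanSpace ℝ (Fin d₂)),
      ∀ i j, inner ℝ (T (b i)) (T (b j)) = if i = j then T.singularValues i ^ 2 else 0 := by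
  have hn : Module.finrank ℝ (EuclideanSpace ℝ (Fin d₂)) = d₂ := by simp
  refine ⟨T.isSymmetric_adjoint_comp_self.eigenvectorBasis hn, fun i j => ?_⟩
  rw [← LinearMap.adjoint_inner_left, ← LinearMap.comp_apply,
    T.isSymmetric_adjoint_comp_self.apply_eigenvectorBasis hn i, inner_smul_left,
    ← T.sq_singularValues_fin hn i, OrthonormalBasis.inner_eq_ite]
  simp

/-- The right vectors are an eigenbasis of WᵀW and the left ones their normalized images. The index
is `i + 1` because `singVal` counts from 1; indices from k on have zero image. -/
theorem exists_thin_svd (W : Matrix (Fin d₁) (Fin d₂) ℝ) (hW : W.rank = k) :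
    ∃ (L : Matrix (Fin d₁) (Fin k) ℝ) (V : Matrix (Fin d₂) (Fin k) ℝ),
      L.transpose * L = 1 ∧ V.transpose * V = 1 ∧
      W = L * Matrix.diagonal (fun i : Fin k => singVal W (i + 1)) * V.transpose := by
  set T := Matrix.toEuclideanLin W with hT
  have hk : k ≤ d₂ := by rw [← hW]; simpa using W.rank_le_width
  obtain ⟨b, hinner⟩ := exists_orthonormalBasis_inner_map T
  set s : Fin d₂ → ℝ := fun i => T.singularValues i with hs
  replace hinner : ∀ i j, inner ℝ (T (b i)) (T (b j)) = if i = j then s i ^ 2 else 0 := hinner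
  have hpos : ∀ i : Fin k, 0 < s (Fin.castLE hk i) := by
    intro i
    have := singVal_pos hW (i := i + 1) (by omega) (by omega)
    rwa [singVal, Nat.add_sub_cancel] at this
  have hzero : ∀ i : Fin d₂, k ≤ i → T (b i) = 0 := by
    intro i hi
    have h0 : s i = 0 := by
      simp only [hs]
      rw [LinearMap.singularValues_eq_zero_iff_le_finrank_range,
        rank_eq_finrank_range_toEuclideanLin, hW]
      exact hi
    have := hinner i i
    rw [if_pos rfl, h0, real_inner_self_eq_norm_sq] at this
    simpa using this
  have hentry : ∀ a j, W a j = ∑ i, (T (b i)).ofLp a * (b i).ofLp j := by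
    intro a j
    have h1 : T (EuclideanSpace.single j 1) =
        ∑ i, inner ℝ (b i) (EuclideanSpace.single j (1 : ℝ)) • T (b i) := by
      conv_lhs => rw [← b.sum_repr' (EuclideanSpace.single j (1 : ℝ))]
      simp
    have h2 : (T (EuclideanSpace.single j 1)).ofLp a = W a j := by
      simp [hT, Matrix.toLpLin_apply]
    have h3 : ∀ i, inner ℝ (b i) (EuclideanSpace.single j (1 : ℝ)) = (b i).ofLp j := fun i => by
      rw [EuclideanSpace.inner_single_right]; simp
    rw [← h2, h1]
    simp only [h3, WithLp.ofLp_sum, WithLp.ofLp_smul, Finset.sum_apply, Pi.smul_apply, smul_eq_mul]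
    exact Finset.sum_congr rfl fun i _ => mul_comm _ _
  refine ⟨Matrix.of fun a i => (T (b (Fin.castLE hk i))).ofLp a / s (Fin.castLE hk i),
    Matrix.of fun j i => (b (Fin.castLE hk i)).ofLp j, ?_, ?_, ?_⟩
  · ext i j
    have := hinner (Fin.castLE hk i) (Fin.castLE hk j)
    rw [PiLp.inner_apply] at this
    simp only [Matrix.mul_apply, Matrix.transpose_apply, Matrix.of_apply, Matrix.one_apply]
    have h1 : ∀ x, (T (b (Fin.castLE hk i))).ofLp x / s (Fin.castLE hk i) *
        ((T (b (Fin.castLE hk j))).ofLp x / s (Fin.castLE hk j)) =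
        ((T (b (Fin.castLE hk j))).ofLp x * (T (b (Fin.castLE hk i))).ofLp x) /
          (s (Fin.castLE hk i) * s (Fin.castLE hk j)) := by intro x; field_simp
    simp only [h1, ← Finset.sum_div]
    have h2 : ∑ x, (T (b (Fin.castLE hk j))).ofLp x * (T (b (Fin.castLE hk i))).ofLp x =
      if Fin.castLE hk i = Fin.castLE hk j then s (Fin.castLE hk i) ^ 2 else 0 := by
        simpa using this
    rw [h2]
    have hne := (hpos i).ne'
    by_cases hij : i = j
    · subst hij
      simp only [if_true, sq]
      exact div_self (mul_ne_zero hne hne)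
    · rw [if_neg (by simpa using hij), if_neg hij, zero_div]
  · ext i j
    have := b.inner_eq_ite (Fin.castLE hk j) (Fin.castLE hk i)
    rw [PiLp.inner_apply] at this
    simp only [Matrix.mul_apply, Matrix.transpose_apply, Matrix.of_apply, Matrix.one_apply]
    simpa [eq_comm] using this
  · ext a j
    rw [hentry, Matrix.mul_apply]
    simp only [Matrix.mul_diagonal, Matrix.of_apply, Matrix.transpose_apply]
    have h1 : ∀ i : Fin k, (T (b (Fin.castLE hk i))).ofLp a / s (Fin.castLE hk i) *
        singVal W (i + 1) * (b (Fin.castLE hk i)).ofLp j =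
        (T (b (Fin.castLE hk i))).ofLp a * (b (Fin.castLE hk i)).ofLp j := by
      intro i
      have h : singVal W (i + 1) = s (Fin.castLE hk i) := by simp [singVal, hs, hT]
      rw [h, div_mul_cancel₀ _ (hpos i).ne']
    rw [Finset.sum_congr rfl fun i _ => h1 i,
      ← Finset.sum_filter_add_sum_filter_not Finset.univ (fun i : Fin d₂ => (i : ℕ) < k)]
    rw [Finset.sum_eq_zero (s := Finset.univ.filter fun i : Fin d₂ => ¬ (i : ℕ) < k), add_zero]
    · symm
      refine Finset.sum_bij (fun i _ => Fin.castLE hk i) (by simp) (by simp) ?_ (by simp)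
      intro i hi
      exact ⟨⟨i, by simpa using hi⟩, Finset.mem_univ _, by ext; simp⟩
    · intro i hi
      rw [hzero i (by simpa using hi)]
      simp

end SVD

/-! ### Frobenius norm and matrices with orthonormal columns -/

section Isometry

variable {l m n : Type*} [Fintype l] [Fintype m] [Fintype n] [DecidableEq m]

theorem frob_isometry_mul {Z : Matrix n m ℝ} (hZ : Z.transpose * Z = 1) (Y : Matrix m l ℝ) :
    frob (Z * Y) = frob Y := by
  refine (sq_eq_sq₀ (frob_nonneg _) (frob_nonneg _)).1 ?_
  rw [frob_sq_eq_trace', frob_sq_eq_trace', Matrix.transpose_mul, Matrix.mul_assoc,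
    ← Matrix.mul_assoc _ Z, hZ, Matrix.one_mul]

theorem frob_mul_transpose_isometry {Z : Matrix n m ℝ} (hZ : Z.transpose * Z = 1)
    (Y : Matrix l m ℝ) : frob (Y * Z.transpose) = frob Y := by
  rw [← frob_transpose, Matrix.transpose_mul, Matrix.transpose_transpose, frob_isometry_mul hZ,
    frob_transpose]

theorem frob_transpose_isometry_mul_le [DecidableEq n] {Z : Matrix n m ℝ}
    (hZ : Z.transpose * Z = 1) (X : Matrix n l ℝ) : frob (Z.transpose * X) ≤ frob X := by
  rw [← frob_isometry_mul hZ, ← Matrix.mul_assoc]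
  exact (isProj_mul_transpose hZ).frob_mul_le X

end Isometry

/-! ### The Hermitian dilation -/

section Dilation

variable {d₁ d₂ k : ℕ}

theorem dilation_transpose (W : Matrix (Fin d₁) (Fin d₂) ℝ) :
    (dilation W).transpose = dilation W := by
  simp [dilation, Matrix.fromBlocks_transpose]

theorem dilation_add (A B : Matrix (Fin d₁) (Fin d₂) ℝ) :
    dilation (A + B) = dilation A + dilation B := by
  simp [dilation, Matrix.fromBlocks_add]

theorem frob_dilation_sq (A : Matrix (Fin d₁) (Fin d₂) ℝ) :
    frob (dilation A) ^ 2 = 2 * frob A ^ 2 := by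
  have h : ∑ i, ∑ j, A i j ^ 2 = ∑ j, ∑ i, A i j ^ 2 := Finset.sum_comm
  rw [frob_sq, frob_sq]
  simp only [dilation, Fintype.sum_sum_type, Matrix.fromBlocks_apply₁₁, Matrix.fromBlocks_apply₁₂,
    Matrix.fromBlocks_apply₂₁, Matrix.fromBlocks_apply₂₂, Matrix.transpose_apply, Matrix.zero_apply]
  simp [two_mul, h]

theorem frob_toBlocks₁₂_le (A : Matrix (Fin d₁ ⊕ Fin d₂) (Fin d₁ ⊕ Fin d₂) ℝ) :
    frob A.toBlocks₁₂ ≤ frob A := by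
  refine Real.sqrt_le_sqrt ?_
  rw [Fintype.sum_sum_type]
  refine le_add_of_le_of_nonneg (Finset.sum_le_sum fun i _ => ?_)
    (Finset.sum_nonneg fun _ _ => Finset.sum_nonneg fun _ _ => sq_nonneg _)
  rw [Fintype.sum_sum_type]
  exact le_add_of_nonneg_of_le (Finset.sum_nonneg fun _ _ => sq_nonneg _) le_rfl

theorem frob_swap_diagonal_mul_le {l : Type*} [Fintype l] {s : Fin k → ℝ} {σ : ℝ} (hσ : 0 < σ)
    (hs : ∀ i, σ ≤ s i) (Y : Matrix (Fin k ⊕ Fin k) l ℝ) :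
    σ * frob (dilation (Matrix.diagonal fun i => (s i)⁻¹) * Y) ≤ frob Y := by
  refine (sq_le_sq₀ (mul_nonneg hσ.le (frob_nonneg _)) (frob_nonneg _)).1 ?_
  rw [mul_pow, frob_sq, frob_sq]
  have h1 : ∀ i c, (dilation (Matrix.diagonal fun i => (s i)⁻¹) * Y) (Sum.inl i) c =
      (s i)⁻¹ * Y (Sum.inr i) c := by
    intro i c
    simp [dilation, Matrix.mul_apply, Matrix.diagonal_apply]
  have h2 : ∀ i c, (dilation (Matrix.diagonal fun i => (s i)⁻¹) * Y) (Sum.inr i) c =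
      (s i)⁻¹ * Y (Sum.inl i) c := by
    intro i c
    simp [dilation, Matrix.mul_apply, Matrix.diagonal_apply]
  have h3 : ∀ i (y : ℝ), σ ^ 2 * ((s i)⁻¹ * y) ^ 2 ≤ y ^ 2 := by
    intro i y
    have hpos : 0 < s i := hσ.trans_le (hs i)
    have : σ * (s i)⁻¹ ≤ 1 := by rw [← div_eq_mul_inv]; exact (div_le_one hpos).2 (hs i)
    calc σ ^ 2 * ((s i)⁻¹ * y) ^ 2 = (σ * (s i)⁻¹) ^ 2 * y ^ 2 := by ring
      _ ≤ 1 * y ^ 2 := mul_le_mul_of_nonneg_right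
          (pow_le_one₀ (by positivity) this) (sq_nonneg _)
      _ = y ^ 2 := one_mul _
  simp only [Fintype.sum_sum_type, h1, h2, mul_add, Finset.mul_sum]
  rw [add_comm]
  exact add_le_add (Finset.sum_le_sum fun i _ => Finset.sum_le_sum fun c _ => h3 i _)
    (Finset.sum_le_sum fun i _ => Finset.sum_le_sum fun c _ => h3 i _)

/-- The range projection of the dilation of a rank `k` matrix, together with the pseudo-inverse. -/
theorem exists_isRangeData (W : Matrix (Fin d₁) (Fin d₂) ℝ) (hk : 1 ≤ k) (hW : W.rank = k) :
    ∃ Q Dp : Matrix (Fin d₁ ⊕ Fin d₂) (Fin d₁ ⊕ Fin d₂) ℝ,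
      IsRangeData (dilation W) Q Dp (singVal W k) ∧ Q.trace = (2 * k : ℕ) := by
  obtain ⟨L, V, hL, hV, hWe⟩ := exists_thin_svd W hW
  set s : Fin k → ℝ := fun i => singVal W (i + 1) with hs
  have hσ : 0 < singVal W k := singVal_pos hW hk le_rfl
  have hsσ : ∀ i, singVal W k ≤ s i := fun i => singVal_anti W (by omega)
  have hs0 : ∀ i, s i ≠ 0 := fun i => (hσ.trans_le (hsσ i)).ne'
  -- The block diagonal isometry of the left and right singular vectors conjugates the dilation of
  -- the diagonal of singular values to that of W; inverting the diagonal gives the pseudo-inverse.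
  set Z : Matrix (Fin d₁ ⊕ Fin d₂) (Fin k ⊕ Fin k) ℝ := Matrix.fromBlocks L 0 0 V with hZdef
  have hZ : Z.transpose * Z = 1 := by
    simp [hZdef, Matrix.fromBlocks_transpose, Matrix.fromBlocks_multiply, hL, hV]
  have hdil : ∀ t : Fin k → ℝ, Z * dilation (Matrix.diagonal t) * Z.transpose =
      dilation (L * Matrix.diagonal t * V.transpose) := by
    intro t
    simp [hZdef, dilation, Matrix.fromBlocks_transpose, Matrix.fromBlocks_multiply,
      Matrix.mul_assoc]
  have hmul : ∀ A B : Matrix (Fin k ⊕ Fin k) (Fin k ⊕ Fin k) ℝ,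
      Z * A * Z.transpose * (Z * B * Z.transpose) = Z * (A * B) * Z.transpose := by
    intro A B
    calc Z * A * Z.transpose * (Z * B * Z.transpose)
        = Z * A * (Z.transpose * Z) * B * Z.transpose := by simp only [Matrix.mul_assoc]
      _ = _ := by rw [hZ, Matrix.mul_one]; simp only [Matrix.mul_assoc]
  have hdd : ∀ t u : Fin k → ℝ, (∀ i, t i * u i = 1) →
      dilation (Matrix.diagonal t) * dilation (Matrix.diagonal u) = 1 := by
    intro t u htu
    simp [dilation, Matrix.fromBlocks_multiply, htu]
  have hpinv : ∀ {l : Type} [Fintype l] (X : Matrix (Fin d₁ ⊕ Fin d₂) l ℝ), singVal W k *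
      frob (Z * dilation (Matrix.diagonal fun i => (s i)⁻¹) * Z.transpose * X) ≤ frob X := by
    intro l _ X
    rw [Matrix.mul_assoc, Matrix.mul_assoc, frob_isometry_mul hZ]
    exact (frob_swap_diagonal_mul_le hσ hsσ _).trans (frob_transpose_isometry_mul_le hZ X)
  have hQ1 : Z * Z.transpose = Z * (1 : Matrix (Fin k ⊕ Fin k) (Fin k ⊕ Fin k) ℝ) * Z.transpose := by
    rw [Matrix.mul_one]
  have hD : dilation W = Z * dilation (Matrix.diagonal s) * Z.transpose := by rw [hdil, ← hWe]
  refine ⟨Z * Z.transpose, Z * dilation (Matrix.diagonal fun i => (s i)⁻¹) * Z.transpose,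
    ⟨hσ, dilation_transpose W, isProj_mul_transpose hZ, ?_, ?_, ?_, ?_, hpinv⟩, ?_⟩
  · rw [hD, hQ1, hmul, Matrix.mul_one]
  · rw [hD, hmul, hdd _ _ fun i => mul_inv_cancel₀ (hs0 i), Matrix.mul_one]
  · rw [hD, hmul, hdd _ _ fun i => inv_mul_cancel₀ (hs0 i), Matrix.mul_one]
  -- The pseudo-inverse is itself a dilation, hence symmetric, so the right-hand bound is the
  -- transpose of the left-hand one.
  · intro X
    have := hpinv X.transpose
    rwa [← frob_transpose, Matrix.transpose_mul, Matrix.transpose_transpose, hdil,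
      dilation_transpose, ← hdil, frob_transpose] at this
  · rw [Matrix.trace_mul_comm, hZ, Matrix.trace_one]
    simp [two_mul]

/-- For unit columns the left side is d₂; this later trades d₂ for k and the condition number. -/
theorem frob_sq_le_rank_mul (W : Matrix (Fin d₁) (Fin d₂) ℝ) (hW : W.rank = k) :
    frob W ^ 2 ≤ k * singVal W 1 ^ 2 := by
  obtain ⟨L, V, hL, hV, hWe⟩ := exists_thin_svd W hW
  have h : frob W = frob (Matrix.diagonal fun i : Fin k => singVal W (i + 1)) := by
    conv_lhs => rw [hWe]
    rw [Matrix.mul_assoc, frob_isometry_mul hL, frob_mul_transpose_isometry hV]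
  rw [h, frob_sq]
  calc ∑ i : Fin k, ∑ j, Matrix.diagonal (fun i : Fin k => singVal W (i + 1)) i j ^ 2
      = ∑ i : Fin k, singVal W (i + 1) ^ 2 := by simp [Matrix.diagonal_apply]
    _ ≤ ∑ i : Fin k, singVal W 1 ^ 2 := Finset.sum_le_sum fun i _ =>
        pow_le_pow_left₀ (LinearMap.singularValues_nonneg _ _) (singVal_anti W (by omega)) 2
    _ = k * singVal W 1 ^ 2 := by simp

end Dilation

/-! ### Spectral norm -/

section SpecNorm

variable {d₁ d₂ k : ℕ}

theorem specNorm_nonneg (M : Matrix (Fin d₁) (Fin d₂) ℝ) : 0 ≤ specNorm M := norm_nonneg _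

theorem norm_mulVec_le_specNorm (M : Matrix (Fin d₁) (Fin d₂) ℝ) (x : EuclideanSpace ℝ (Fin d₂)) :
    ‖WithLp.toLp 2 (M.mulVec x.ofLp)‖ ≤ specNorm M * ‖x‖ :=
  (Matrix.toEuclideanLin M).toContinuousLinearMap.le_opNorm x

theorem sqrt_col_le_specNorm (M : Matrix (Fin d₁) (Fin d₂) ℝ) (j : Fin d₂) :
    Real.sqrt (∑ i, M i j ^ 2) ≤ specNorm M := by
  have := norm_mulVec_le_specNorm M (EuclideanSpace.single j 1)
  rw [EuclideanSpace.norm_eq] at this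
  simpa using this

theorem specNorm_le_frob (M : Matrix (Fin d₁) (Fin d₂) ℝ) : specNorm M ≤ frob M := by
  refine ContinuousLinearMap.opNorm_le_bound _ (frob_nonneg _) fun x => ?_
  have h := frob_mul_le M (Matrix.replicateCol (Fin 1) x.ofLp)
  have h1 : frob (M * Matrix.replicateCol (Fin 1) x.ofLp) =
      ‖WithLp.toLp 2 (M.mulVec x.ofLp)‖ := by
    rw [EuclideanSpace.norm_eq, frob]
    simp [Matrix.mul_apply, Matrix.mulVec, dotProduct]
  have h2 : frob (Matrix.replicateCol (Fin 1) x.ofLp) = ‖x‖ := by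
    rw [EuclideanSpace.norm_eq, frob]
    simp
  rw [h1, h2] at h
  exact h

theorem singVal_le_specNorm (W : Matrix (Fin d₁) (Fin d₂) ℝ) (hk : 1 ≤ k) (hW : W.rank = k) :
    singVal W k ≤ specNorm W := by
  obtain ⟨L, V, hL, hV, hWe⟩ := exists_thin_svd W hW
  set i : Fin k := ⟨k - 1, by omega⟩
  have hunit : ∀ {d : ℕ} {U : Matrix (Fin d) (Fin k) ℝ}, U.transpose * U = 1 →
      ‖WithLp.toLp 2 (U.col i)‖ = 1 := by
    intro d U hU
    have := congrFun (congrFun hU i) i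
    rw [Matrix.mul_apply] at this
    rw [EuclideanSpace.norm_eq, Real.sqrt_eq_one]
    simpa [sq] using this
  have hcol : W.mulVec (V.col i) = singVal W k • L.col i := by
    have hVi : V.transpose.mulVec (V.col i) = Pi.single i 1 := by
      rw [← Matrix.mulVec_single_one, Matrix.mulVec_mulVec, hV, Matrix.one_mulVec]
    conv_lhs => rw [hWe]
    rw [← Matrix.mulVec_mulVec, hVi, ← Matrix.mulVec_mulVec]
    ext a
    simp [Matrix.mulVec, dotProduct, Matrix.diagonal_apply, i, Pi.single_apply,
      Nat.sub_add_cancel hk, mul_comm]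
  have h := norm_mulVec_le_specNorm W (WithLp.toLp 2 (V.col i))
  rw [hunit hV, mul_one, hcol, WithLp.toLp_smul, norm_smul, hunit hL, mul_one] at h
  exact (le_abs_self _).trans h

end SpecNorm

/-! ### Column normalization -/

section ColNormalize

variable {d₁ d₂ : ℕ}

/-- Normalizing moves a by |‖a‖ - 1|, which is at most ‖w - a‖ because w is a unit vector. For a = 0
the inverse norm is 0 and the bound is trivial. -/
theorem norm_sub_normalize_le {E : Type*} [NormedAddCommGroup E] [NormedSpace ℝ E] {w : E}
    (hw : ‖w‖ = 1) (a : E) : ‖w - ‖a‖⁻¹ • a‖ ≤ 2 * ‖w - a‖ := by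
  rcases eq_or_ne a 0 with rfl | ha
  · simp [hw]
  have hpos : 0 < ‖a‖ := norm_pos_iff.2 ha
  have h1 : ‖a - ‖a‖⁻¹ • a‖ = |‖a‖ - 1| := by
    have : a - ‖a‖⁻¹ • a = (1 - ‖a‖⁻¹) • a := by rw [sub_smul, one_smul]
    rw [this, norm_smul, Real.norm_eq_abs, ← abs_norm a, ← abs_mul, abs_norm, sub_mul, one_mul,
      inv_mul_cancel₀ hpos.ne']
  have h2 : |‖a‖ - 1| ≤ ‖w - a‖ := by
    rw [← hw, ← norm_sub_rev a w]
    exact abs_norm_sub_norm_le a w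
  calc ‖w - ‖a‖⁻¹ • a‖ = ‖(w - a) + (a - ‖a‖⁻¹ • a)‖ := by abel_nf
    _ ≤ ‖w - a‖ + ‖a - ‖a‖⁻¹ • a‖ := norm_add_le _ _
    _ ≤ 2 * ‖w - a‖ := by rw [h1]; linarith

theorem frob_sub_colNormalize_le {W : Matrix (Fin d₁) (Fin d₂) ℝ} (hW : ∀ j, ∑ i, W i j ^ 2 = 1)
    (A : Matrix (Fin d₁) (Fin d₂) ℝ) : frob (W - colNormalize A) ≤ 2 * frob (W - A) := by
  refine (sq_le_sq₀ (frob_nonneg _) (mul_nonneg zero_le_two (frob_nonneg _))).1 ?_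
  rw [mul_pow, frob_sq, frob_sq, Finset.sum_comm, Finset.sum_comm (γ := Fin d₁), Finset.mul_sum]
  refine Finset.sum_le_sum fun j _ => ?_
  have hw : ‖WithLp.toLp 2 (W.col j)‖ = 1 := by
    rw [EuclideanSpace.norm_eq, Real.sqrt_eq_one]
    simpa using hW j
  have h := norm_sub_normalize_le hw (WithLp.toLp 2 (A.col j))
  have h' := pow_le_pow_left₀ (norm_nonneg _) h 2
  rw [mul_pow, EuclideanSpace.norm_sq_eq, EuclideanSpace.norm_sq_eq, EuclideanSpace.norm_eq] at h'
  simpa [colNormalize, div_eq_inv_mul] using h'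

theorem colNormalize_col (A : Matrix (Fin d₁) (Fin d₂) ℝ) (j : Fin d₂) :
    (∑ i, colNormalize A i j ^ 2 = 1) ∨ ∀ i, colNormalize A i j = 0 := by
  by_cases h : ∑ l, A l j ^ 2 = 0
  · right
    intro i
    simp [colNormalize, h]
  · left
    have hnn : 0 ≤ ∑ l, A l j ^ 2 := Finset.sum_nonneg fun _ _ => sq_nonneg _
    simp only [colNormalize, Matrix.of_apply, div_pow, ← Finset.sum_div, Real.sq_sqrt hnn]
    exact div_self h

theorem colNormalize_zero : colNormalize (0 : Matrix (Fin d₁) (Fin d₂) ℝ) = 0 := by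
  ext i j; simp [colNormalize]

theorem estimate_zero_right {r : ℕ} (U : Matrix (Fin d₁ ⊕ Fin d₂) (Fin r) ℝ) :
    estimate U 0 = 0 := by
  have : (U * (0 : Matrix (Fin d₁ ⊕ Fin d₂) (Fin r) ℝ).transpose).toBlocks₁₂ = 0 := by
    ext i j; simp [Matrix.toBlocks₁₂]
  rw [estimate, this, colNormalize_zero]

theorem frob_sub_estimate_le {W : Matrix (Fin d₁) (Fin d₂) ℝ} (hW : ∀ j, ∑ i, W i j ^ 2 = 1)
    (A : Matrix (Fin d₁ ⊕ Fin d₂) (Fin d₁ ⊕ Fin d₂) ℝ) :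
    frob (W - colNormalize A.toBlocks₁₂) ≤ 2 * frob (dilation W - A) := by
  refine (frob_sub_colNormalize_le hW _).trans (mul_le_mul_of_nonneg_left ?_ zero_le_two)
  have : W - A.toBlocks₁₂ = (dilation W - A).toBlocks₁₂ := by
    ext i j; simp [dilation, Matrix.toBlocks₁₂]
  rw [this]
  exact frob_toBlocks₁₂_le _

end ColNormalize

/-! ### One-dimensional Gaussian estimates -/

theorem measurable_sgn : Measurable sgn :=
  Measurable.ite measurableSet_Ici measurable_const measurable_const

theorem sgn_mul_self_eq_abs (a : ℝ) : sgn a * a = |a| := by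
  unfold sgn
  split_ifs with h
  · rw [abs_of_nonneg h, one_mul]
  · rw [abs_of_neg (not_le.1 h)]; ring

theorem abs_sgn (a : ℝ) : |sgn a| = 1 := by
  unfold sgn; split_ifs <;> simp

theorem sgn_mul_of_pos {c : ℝ} (hc : 0 < c) (a : ℝ) : sgn (c * a) = sgn a := by
  simp [sgn, hc]

theorem sgn_sub_sgn_sq_le (a b : ℝ) : (sgn a - sgn b) ^ 2 ≤ 4 := by
  unfold sgn; split_ifs <;> norm_num

theorem integral_abs_gaussianReal : ∫ x, |x| ∂gaussianReal 0 1 = Real.sqrt (2 / Real.pi) := by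
  rw [integral_gaussianReal_eq_integral_smul one_ne_zero]
  have h1 : ∀ x : ℝ, gaussianPDFReal 0 1 x • |x| =
      (fun y : ℝ => (Real.sqrt (2 * Real.pi))⁻¹ * (y ^ (1 : ℝ) * Real.exp (-(1 / 2) * y ^ (2 : ℝ))))
        |x| := by
    intro x
    simp only [gaussianPDFReal, sub_zero, NNReal.coe_one, mul_one, smul_eq_mul, Real.rpow_one]
    rw [show (2 : ℝ) = ((2 : ℕ) : ℝ) by norm_num, Real.rpow_natCast, sq_abs]
    push_cast
    ring_nf
  rw [integral_congr_ae (Filter.Eventually.of_forall h1)]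
  refine (integral_comp_abs (f := fun y : ℝ => (Real.sqrt (2 * Real.pi))⁻¹ *
    (y ^ (1 : ℝ) * Real.exp (-(1 / 2) * y ^ (2 : ℝ))))).trans ?_
  rw [integral_const_mul,
    integral_rpow_mul_exp_neg_mul_rpow (by norm_num) (by norm_num) (by norm_num)]
  have h2 : ((1 : ℝ) / 2) ^ (-((1 : ℝ) + 1) / 2) = 2 := by
    rw [show -((1 : ℝ) + 1) / 2 = -1 by norm_num, Real.rpow_neg_one]; norm_num
  rw [h2, show ((1 : ℝ) + 1) / 2 = 1 by norm_num, Real.Gamma_one]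
  have h3 : (0 : ℝ) < 2 * Real.pi := by positivity
  symm
  rw [Real.sqrt_eq_iff_mul_self_eq (by positivity) (by positivity)]
  have h4 := Real.mul_self_sqrt h3.le
  field_simp
  nlinarith [Real.sq_sqrt h3.le]

/-- The density is at most 1/√(2π) ≤ 1/2 and the interval has length 2s. -/
theorem gaussianReal_abs_le (s : ℝ) : gaussianReal 0 1 {x | |x| ≤ s} ≤ ENNReal.ofReal s := by
  have hset : {x : ℝ | |x| ≤ s} = Set.Icc (-s) s := by ext x; simp [abs_le]
  rw [hset, gaussianReal_apply 0 one_ne_zero]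
  have hpdf : ∀ x, gaussianPDF 0 1 x ≤ ENNReal.ofReal (1 / 2) := by
    intro x
    refine ENNReal.ofReal_le_ofReal ?_
    simp only [gaussianPDFReal, sub_zero, NNReal.coe_one, mul_one]
    have h2 : 2 ≤ Real.sqrt (2 * Real.pi) :=
      Real.le_sqrt_of_sq_le (by nlinarith [Real.pi_gt_three])
    have h3 : Real.exp (-x ^ 2 / 2) ≤ 1 := Real.exp_le_one_iff.2 (by nlinarith [sq_nonneg x])
    calc (Real.sqrt (2 * Real.pi))⁻¹ * Real.exp (-x ^ 2 / 2) ≤ 2⁻¹ * 1 :=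
          mul_le_mul (inv_anti₀ two_pos h2) h3 (Real.exp_pos _).le (by norm_num)
      _ = 1 / 2 := by norm_num
  calc ∫⁻ x in Set.Icc (-s) s, gaussianPDF 0 1 x
      ≤ ∫⁻ _ in Set.Icc (-s) s, ENNReal.ofReal (1 / 2) := lintegral_mono hpdf
    _ = ENNReal.ofReal s := by
        rw [setLIntegral_const, Real.volume_Icc, ← ENNReal.ofReal_mul (by norm_num)]
        congr 1; ring

/-- Integrate over X first, with Y frozen: the event has conditional probability at most s(Y). -/
theorem lintegral_indicator_abs_le {Ω β : Type*} [MeasurableSpace Ω] [MeasurableSpace β]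
    {μ : Measure Ω} [IsProbabilityMeasure μ] {X : Ω → ℝ} {Y : Ω → β} (hX : Measurable X)
    (hY : Measurable Y) (hXY : IndepFun X Y μ) (hlaw : μ.map X = gaussianReal 0 1)
    {s G : β → ℝ} (hs : Measurable s) (hG : Measurable G) (hs0 : ∀ y, 0 ≤ s y) :
    ∫⁻ ω, {ω | |X ω| ≤ s (Y ω)}.indicator (fun ω => ENNReal.ofReal (G (Y ω))) ω ∂μ ≤
      ∫⁻ ω, ENNReal.ofReal (s (Y ω) * G (Y ω)) ∂μ := by
  have hmeas : MeasurableSet {p : ℝ × β | |p.1| ≤ s p.2} :=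
    measurableSet_le (by fun_prop) (by fun_prop)
  set F : ℝ × β → ENNReal := {p : ℝ × β | |p.1| ≤ s p.2}.indicator
    (fun p => ENNReal.ofReal (G p.2)) with hF
  have hFm : Measurable F := Measurable.indicator (by fun_prop) hmeas
  have := Measure.isProbabilityMeasure_map (μ := μ) hY.aemeasurable
  calc ∫⁻ ω, {ω | |X ω| ≤ s (Y ω)}.indicator (fun ω => ENNReal.ofReal (G (Y ω))) ω ∂μ
      = ∫⁻ ω, F (X ω, Y ω) ∂μ := rfl
    _ = ∫⁻ p, F p ∂(gaussianReal 0 1).prod (μ.map Y) := by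
        rw [← hlaw, ← (indepFun_iff_map_prod_eq_prod_map_map hX.aemeasurable hY.aemeasurable).1 hXY,
          lintegral_map hFm (hX.prodMk hY)]
    _ = ∫⁻ y, ∫⁻ x, F (x, y) ∂gaussianReal 0 1 ∂μ.map Y := lintegral_prod_symm _ hFm.aemeasurable
    _ ≤ ∫⁻ y, ENNReal.ofReal (s y * G y) ∂μ.map Y := by
        refine lintegral_mono fun y => ?_
        have : ∀ x, F (x, y) = {x : ℝ | |x| ≤ s y}.indicator (fun _ => ENNReal.ofReal (G y)) x :=
          fun x => rfl
        simp_rw [this]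
        rw [lintegral_indicator (measurableSet_le (by fun_prop) (by fun_prop)), setLIntegral_const,
          mul_comm, ENNReal.ofReal_mul (hs0 y)]
        exact mul_le_mul_left (gaussianReal_abs_le _) _
    _ = ∫⁻ ω, ENNReal.ofReal (s (Y ω) * G (Y ω)) ∂μ := lintegral_map (by fun_prop) hY

/-! ### Signs of Gaussian linear forms -/

section StdGaussian

variable {E : Type*} [NormedAddCommGroup E] [InnerProductSpace ℝ E] [FiniteDimensional ℝ E]
  [MeasurableSpace E] [BorelSpace E]

theorem hasGaussianLaw_inner (v : E) :
    HasGaussianLaw (fun x : E => inner ℝ v x) (stdGaussian E) :=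
  IsGaussian.hasGaussianLaw_id.map_fun (innerSL ℝ v)

theorem integral_inner_stdGaussian (v : E) : ∫ x, inner ℝ v x ∂stdGaussian E = 0 :=
  integral_strongDual_stdGaussian (innerSL ℝ v)

theorem map_inner_stdGaussian (v : E) : (stdGaussian E).map (fun x => inner ℝ v x) =
    (gaussianReal 0 1).map (fun x => ‖v‖ * x) := by
  rw [(hasGaussianLaw_inner v).map_eq_gaussianReal, integral_inner_stdGaussian,
    gaussianReal_map_const_mul, mul_zero, mul_one]
  congr 1
  have h : Var[fun x : E => inner ℝ v x; stdGaussian E] = ‖v‖ ^ 2 := by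
    have := variance_dual_stdGaussian (innerSL ℝ v)
    rwa [innerSL_apply_norm] at this
  rw [h]
  ext
  simp

theorem integral_inner_comp (v : E) {f : ℝ → ℝ} (hf : Measurable f) :
    ∫ x, f (inner ℝ v x) ∂stdGaussian E = ∫ x, f (‖v‖ * x) ∂gaussianReal 0 1 := by
  have h1 : ∫ x, f (inner ℝ v x) ∂stdGaussian E =
      ∫ y, f y ∂(stdGaussian E).map (fun x => inner ℝ v x) :=
    (integral_map (by fun_prop) hf.aestronglyMeasurable).symm
  rw [h1, map_inner_stdGaussian, integral_map (by fun_prop) hf.aestronglyMeasurable]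

theorem covariance_inner_stdGaussian (a b : E) :
    cov[fun x => inner ℝ a x, fun x => inner ℝ b x; stdGaussian E] = inner ℝ a b := by
  rw [← covarianceBilin_apply_eq_cov IsGaussian.memLp_two_id, covarianceBilin_stdGaussian]
  rfl

/-- The two maps are jointly Gaussian and uncorrelated. -/
theorem indepFun_inner_sub (u : E) (hu : ‖u‖ = 1) :
    IndepFun (fun x : E => inner ℝ u x) (fun x => x - inner ℝ u x • u) (stdGaussian E) := by
  refine HasGaussianLaw.indepFun_of_covariance_inner ?_ fun r y => ?_
  · exact IsGaussian.hasGaussianLaw_id.map_fun ((innerSL ℝ u).prod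
      (ContinuousLinearMap.id ℝ E - (innerSL ℝ u).smulRight u))
  · have h1 : (fun x : E => inner ℝ r (inner ℝ u x)) = fun x => inner ℝ (r • u) x := by
      ext x; rw [inner_smul_left]; simp [mul_comm]
    have h2 : (fun x : E => inner ℝ y (x - inner ℝ u x • u)) =
        fun x => inner ℝ (y - inner ℝ u y • u) x := by
      ext x
      simp only [inner_sub_left, inner_sub_right, inner_smul_left, inner_smul_right,
        real_inner_comm u y]
      simp [mul_comm]
    rw [h1, h2, covariance_inner_stdGaussian, inner_smul_left, inner_sub_right, inner_smul_right,
      real_inner_self_eq_norm_sq, hu]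
    simp

theorem map_inner_stdGaussian_of_unit {u : E} (hu : ‖u‖ = 1) :
    (stdGaussian E).map (fun x => inner ℝ u x) = gaussianReal 0 1 := by
  rw [map_inner_stdGaussian, hu]
  simp

theorem integrable_abs_inner_pow (v : E) (n : ℕ) :
    Integrable (fun x : E => |inner ℝ v x| ^ n) (stdGaussian E) := by
  have := (hasGaussianLaw_inner v).memLp (p := n) (by simp)
  simpa using this.integrable_norm_pow'

theorem integral_inner_sq (a : E) : ∫ x, inner ℝ a x ^ 2 ∂stdGaussian E = ‖a‖ ^ 2 := by
  have h := covariance_inner_stdGaussian a a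
  rw [covariance_eq_sub (hasGaussianLaw_inner a).memLp_two (hasGaussianLaw_inner a).memLp_two,
    integral_inner_stdGaussian, real_inner_self_eq_norm_sq] at h
  simpa [sq] using h

/-- `𝔼 [sign ⟨w, x⟩ ⟨a, x⟩] = √(2/π) ⟨w, a⟩` for a unit vector `w`. -/
theorem integral_sgn_inner_mul {w : E} (hw : ‖w‖ = 1) (a : E) :
    ∫ x, sgn (inner ℝ w x) * inner ℝ a x ∂stdGaussian E =
      Real.sqrt (2 / Real.pi) * inner ℝ w a := by
  have hs : Measurable fun x : E => sgn (inner ℝ w x) := measurable_sgn.comp (by fun_prop)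
  have hind : IndepFun (fun x : E => sgn (inner ℝ w x))
      (fun x => inner ℝ a (x - inner ℝ w x • w)) (stdGaussian E) :=
    (indepFun_inner_sub w hw).comp (φ := sgn) (ψ := fun y => inner ℝ a y) measurable_sgn
      (by fun_prop)
  -- The component of a along w contributes |⟨w,x⟩|; the orthogonal one is centred and independent
  -- of the sign.
  have hdec : ∀ x : E, sgn (inner ℝ w x) * inner ℝ a x =
      inner ℝ w a * |inner ℝ w x| + sgn (inner ℝ w x) * inner ℝ a (x - inner ℝ w x • w) := by
    intro x
    rw [← sgn_mul_self_eq_abs, inner_sub_right, inner_smul_right, real_inner_comm w a]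
    ring
  have hz : ∀ x : E, inner ℝ a (x - inner ℝ w x • w) = inner ℝ (a - inner ℝ w a • w) x := by
    intro x
    simp only [inner_sub_left, inner_sub_right, inner_smul_left, inner_smul_right,
      real_inner_comm w a]
    simp [mul_comm]
  have hi1 : Integrable (fun x : E => |inner ℝ w x|) (stdGaussian E) := by
    simpa using integrable_abs_inner_pow w 1
  have hi2 : Integrable (fun x : E => sgn (inner ℝ w x) * inner ℝ a (x - inner ℝ w x • w))
      (stdGaussian E) := by
    simp_rw [hz]
    refine ((hasGaussianLaw_inner (a - inner ℝ w a • w)).integrable).bdd_mul (c := 1)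
      hs.aestronglyMeasurable (Filter.Eventually.of_forall fun x => ?_)
    rw [Real.norm_eq_abs, abs_sgn]
  simp_rw [hdec]
  rw [integral_add (hi1.const_mul _) hi2, integral_const_mul,
    hind.integral_fun_mul_eq_mul_integral hs.aestronglyMeasurable (by fun_prop)]
  simp_rw [hz]
  rw [integral_inner_stdGaussian, mul_zero, add_zero, integral_inner_comp w measurable_abs, hw]
  simp only [one_mul]
  rw [integral_abs_gaussianReal, mul_comm]

/-- The third absolute moment of the standard Gaussian distribution. -/
noncomputable def thirdMoment : ℝ := ∫ x, |x| ^ 3 ∂gaussianReal 0 1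

theorem thirdMoment_nonneg : 0 ≤ thirdMoment := integral_nonneg fun _ => by positivity

theorem integral_abs_inner_cube (v : E) :
    ∫ x, |inner ℝ v x| ^ 3 ∂stdGaussian E = ‖v‖ ^ 3 * thirdMoment := by
  rw [integral_inner_comp v (f := fun y => |y| ^ 3) (by fun_prop), thirdMoment,
    ← integral_const_mul]
  simp_rw [abs_mul, mul_pow, abs_norm]

theorem mul_sq_le_cube_add_cube {s t : ℝ} (hs : 0 ≤ s) (ht : 0 ≤ t) :
    s * t ^ 2 ≤ s ^ 3 + t ^ 3 := by
  rcases le_total s t with h | h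
  · nlinarith [mul_le_mul_of_nonneg_right h (sq_nonneg t), pow_nonneg hs 3]
  · nlinarith [mul_le_mul_of_nonneg_left (pow_le_pow_left₀ ht h 2) hs, pow_nonneg ht 3]

theorem norm_sub_inner_smul_le {u : E} (hu : ‖u‖ = 1) (v : E) : ‖v - inner ℝ u v • u‖ ≤ ‖v‖ := by
  refine (sq_le_sq₀ (norm_nonneg _) (norm_nonneg _)).1 ?_
  rw [norm_sub_sq_real, inner_smul_right, norm_smul, hu, real_inner_comm u v, Real.norm_eq_abs,
    mul_one, sq_abs]
  nlinarith [sq_nonneg (inner ℝ u v)]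

/-- The constant in the bound for the sign mismatch of two Gaussian linear forms. -/
noncomputable def mismatchConst : ℝ := 8 + 96 * thirdMoment

theorem mismatchConst_pos : 0 < mismatchConst := by
  have := thirdMoment_nonneg
  unfold mismatchConst; linarith

theorem integrable_sgn_sub_sgn_sq_mul (u w a : E) :
    Integrable (fun x : E => (sgn (inner ℝ u x) - sgn (inner ℝ w x)) ^ 2 * inner ℝ a x ^ 2)
      (stdGaussian E) := by
  have hi : Integrable (fun x : E => inner ℝ a x ^ 2) (stdGaussian E) := by
    simpa using integrable_abs_inner_pow a 2
  have hm : Measurable fun x : E => (sgn (inner ℝ u x) - sgn (inner ℝ w x)) ^ 2 :=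
    ((measurable_sgn.comp (by fun_prop)).sub (measurable_sgn.comp (by fun_prop))).pow_const 2
  refine hi.bdd_mul (c := 4) hm.aestronglyMeasurable (Filter.Eventually.of_forall fun x => ?_)
  rw [Real.norm_eq_abs, abs_of_nonneg (sq_nonneg _)]
  exact sgn_sub_sgn_sq_le _ _

/-- Split x into ⟨u,x⟩u and the independent rest Y. A sign mismatch forces |⟨u,x⟩| ≤ 2|⟨w,Y⟩|, an
event of conditional probability at most 2|⟨w,Y⟩|. As ⟨w,Y⟩ involves only the part of w orthogonal
to u, it is of size ‖w - u‖. Third moments appear as this probability times a square. -/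
theorem integral_sgn_sub_sgn_sq_mul_le_aux {u w a : E} (hu : ‖u‖ = 1) (ha : ‖a‖ ≤ 1)
    (hw : ‖w - u‖ < 1 / 2) (hwu : w ≠ u) :
    ∫ x, (sgn (inner ℝ u x) - sgn (inner ℝ w x)) ^ 2 * inner ℝ a x ^ 2 ∂stdGaussian E ≤
      96 * thirdMoment * ‖w - u‖ := by
  set ε := ‖w - u‖ with hε
  have hε0 : 0 < ε := norm_pos_iff.2 (sub_ne_zero.2 hwu)
  set Y : E → E := fun x => x - inner ℝ u x • u with hY
  have hproj : ∀ v x : E, inner ℝ v (Y x) = inner ℝ (v - inner ℝ u v • u) x := by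
    intro v x
    simp only [hY, inner_sub_left, inner_sub_right, inner_smul_left, inner_smul_right,
      real_inner_comm u v]
    simp [mul_comm]
  set z := w - inner ℝ u w • u with hz
  set a' := a - inner ℝ u a • u with ha'
  have hzε : ‖z‖ ≤ ε := by
    have : z = (w - u) - inner ℝ u (w - u) • u := by
      rw [hz, inner_sub_right, real_inner_self_eq_norm_sq, hu, sub_smul]
      simp
    rw [this]
    exact norm_sub_inner_smul_le hu _
  have ha1 : ‖a'‖ ≤ 1 := (norm_sub_inner_smul_le hu a).trans ha
  have hwu' : 1 / 2 ≤ inner ℝ u w := by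
    have h1 : inner ℝ u w = 1 + inner ℝ u (w - u) := by
      rw [inner_sub_right, real_inner_self_eq_norm_sq, hu]; ring
    have h2 := (abs_le.1 (abs_real_inner_le_norm u (w - u))).1
    rw [hu, one_mul, ← hε] at h2
    linarith
  have hau : inner ℝ u a ^ 2 ≤ 1 := by
    have h2 := abs_real_inner_le_norm u a
    rw [hu, one_mul] at h2
    rw [sq_le_one_iff_abs_le_one]
    exact h2.trans ha
  set s : E → ℝ := fun y => 2 * |inner ℝ w y| with hs
  set G : E → ℝ := fun y => 32 * inner ℝ w y ^ 2 + 8 * inner ℝ a y ^ 2 with hG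
  -- On the event, ⟨u,x⟩² ≤ 4⟨w,Y⟩² lets the integrand be bounded by a function of Y alone. Off it,
  -- ⟨u,w⟩ ≥ 1/2 makes the first term of ⟨w,x⟩ dominate, so the signs agree.
  have hpt : ∀ x : E, ENNReal.ofReal
      ((sgn (inner ℝ u x) - sgn (inner ℝ w x)) ^ 2 * inner ℝ a x ^ 2) ≤
      {x | |inner ℝ u x| ≤ s (Y x)}.indicator (fun x => ENNReal.ofReal (G (Y x))) x := by
    intro x
    have e1 : inner ℝ w x = inner ℝ u w * inner ℝ u x + inner ℝ w (Y x) := by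
      simp only [hY, inner_sub_right, inner_smul_right, real_inner_comm u w]; ring
    have e2 : inner ℝ a x = inner ℝ u a * inner ℝ u x + inner ℝ a (Y x) := by
      simp only [hY, inner_sub_right, inner_smul_right, real_inner_comm u a]; ring
    by_cases hx : |inner ℝ u x| ≤ s (Y x)
    · rw [Set.indicator_of_mem (by exact hx)]
      refine ENNReal.ofReal_le_ofReal ?_
      have h1 := sgn_sub_sgn_sq_le (inner ℝ u x) (inner ℝ w x)
      have h2 : inner ℝ u x ^ 2 ≤ 4 * inner ℝ w (Y x) ^ 2 := by
        have := pow_le_pow_left₀ (abs_nonneg _) hx 2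
        rw [sq_abs, hs, mul_pow, sq_abs] at this
        linarith
      have h3 : inner ℝ a x ^ 2 ≤ 8 * inner ℝ w (Y x) ^ 2 + 2 * inner ℝ a (Y x) ^ 2 := by
        rw [e2]
        nlinarith [sq_nonneg (inner ℝ u a * inner ℝ u x - inner ℝ a (Y x)),
          mul_le_mul_of_nonneg_right hau (sq_nonneg (inner ℝ u x))]
      calc _ ≤ 4 * inner ℝ a x ^ 2 := mul_le_mul_of_nonneg_right h1 (sq_nonneg _)
        _ ≤ G (Y x) := by simp only [hG]; linarith
    · rw [Set.indicator_of_notMem (by exact hx)]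
      have hx' : 2 * |inner ℝ w (Y x)| < |inner ℝ u x| := not_le.1 hx
      have hsame : sgn (inner ℝ u x) = sgn (inner ℝ w x) := by
        rw [e1]
        unfold sgn
        have h4 := neg_abs_le (inner ℝ w (Y x))
        have h5 := le_abs_self (inner ℝ w (Y x))
        rcases le_or_gt 0 (inner ℝ u x) with h | h
        · rw [abs_of_nonneg h] at hx'
          rw [if_pos h, if_pos (by nlinarith)]
        · rw [abs_of_neg h] at hx'
          rw [if_neg (not_le.2 h), if_neg (not_le.2 (by nlinarith))]
      simp [hsame]
  -- Rescaling z by ε⁻¹ before splitting the product into cubes keeps a factor ε in front. The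
  -- constants 64 + 16 + 16 give the 96.
  have hle : ∀ x : E, s (Y x) * G (Y x) ≤
      64 * |inner ℝ z x| ^ 3 + 16 * ε * (|inner ℝ (ε⁻¹ • z) x| ^ 3 + |inner ℝ a' x| ^ 3) := by
    intro x
    simp only [hs, hG, hproj]
    have h1 := mul_sq_le_cube_add_cube (abs_nonneg (inner ℝ (ε⁻¹ • z) x))
      (abs_nonneg (inner ℝ a' x))
    have h2 : |inner ℝ z x| = ε * |inner ℝ (ε⁻¹ • z) x| := by
      rw [inner_smul_left]
      simp only [conj_trivial, abs_mul, abs_of_pos (inv_pos.2 hε0)]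
      field_simp
    rw [← sq_abs (inner ℝ z x), ← sq_abs (inner ℝ a' x)]
    calc 2 * |inner ℝ z x| * (32 * |inner ℝ z x| ^ 2 + 8 * |inner ℝ a' x| ^ 2)
        = 64 * |inner ℝ z x| ^ 3 + 16 * (|inner ℝ z x| * |inner ℝ a' x| ^ 2) := by ring
      _ = 64 * |inner ℝ z x| ^ 3 +
          16 * ε * (|inner ℝ (ε⁻¹ • z) x| * |inner ℝ a' x| ^ 2) := by
            conv_lhs => rw [h2]
            rw [h2]; ring
      _ ≤ _ := by
        have := mul_le_mul_of_nonneg_left h1 (show 0 ≤ 16 * ε by positivity)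
        linarith
  have hint : Integrable (fun x : E => 64 * |inner ℝ z x| ^ 3 +
      16 * ε * (|inner ℝ (ε⁻¹ • z) x| ^ 3 + |inner ℝ a' x| ^ 3)) (stdGaussian E) :=
    ((integrable_abs_inner_pow z 3).const_mul 64).add
      (((integrable_abs_inner_pow _ 3).add (integrable_abs_inner_pow a' 3)).const_mul _)
  have hval : ∫ x, (64 * |inner ℝ z x| ^ 3 +
      16 * ε * (|inner ℝ (ε⁻¹ • z) x| ^ 3 + |inner ℝ a' x| ^ 3)) ∂stdGaussian E ≤
      96 * thirdMoment * ε := by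
    have hi : Integrable (fun x : E => 16 * ε * (|inner ℝ (ε⁻¹ • z) x| ^ 3 + |inner ℝ a' x| ^ 3))
        (stdGaussian E) :=
      ((integrable_abs_inner_pow _ 3).add (integrable_abs_inner_pow a' 3)).const_mul _
    rw [integral_add ((integrable_abs_inner_pow z 3).const_mul 64) hi,
      integral_const_mul, integral_const_mul,
      integral_add (integrable_abs_inner_pow _ 3) (integrable_abs_inner_pow a' 3),
      integral_abs_inner_cube, integral_abs_inner_cube, integral_abs_inner_cube]
    have hT := thirdMoment_nonneg
    have b1 : ‖z‖ ^ 3 ≤ ε := by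
      calc ‖z‖ ^ 3 ≤ ε ^ 3 := pow_le_pow_left₀ (norm_nonneg _) hzε 3
        _ ≤ ε := pow_le_of_le_one hε0.le (by linarith) (by norm_num)
    have b2 : ‖ε⁻¹ • z‖ ^ 3 ≤ 1 := by
      refine pow_le_one₀ (norm_nonneg _) ?_
      rw [norm_smul, norm_inv, Real.norm_eq_abs, abs_of_pos hε0, inv_mul_le_one₀ hε0]
      exact hzε
    have b3 : ‖a'‖ ^ 3 ≤ 1 := pow_le_one₀ (norm_nonneg _) ha1
    have c1 := mul_le_mul_of_nonneg_right b1 hT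
    have c2 := mul_le_mul_of_nonneg_right b2 hT
    have c3 := mul_le_mul_of_nonneg_right b3 hT
    have c4 := mul_le_mul_of_nonneg_left (add_le_add c2 c3) (show 0 ≤ 16 * ε by positivity)
    linarith
  have hL := (lintegral_mono hpt).trans (lintegral_indicator_abs_le (X := fun x : E => inner ℝ u x)
    (by fun_prop) (by fun_prop) (indepFun_inner_sub u hu) (map_inner_stdGaussian_of_unit hu)
    (s := s) (G := G) (by fun_prop) (by fun_prop) (fun y => by positivity))
  have hL2 := hL.trans (lintegral_mono fun x => ENNReal.ofReal_le_ofReal (hle x))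
  rw [← ofReal_integral_eq_lintegral_ofReal (integrable_sgn_sub_sgn_sq_mul u w a)
      (Filter.Eventually.of_forall fun x => by positivity),
    ← ofReal_integral_eq_lintegral_ofReal hint
      (Filter.Eventually.of_forall fun x => by positivity)] at hL2
  refine ((ENNReal.ofReal_le_ofReal_iff (integral_nonneg fun x => by positivity)).1 hL2).trans hval

/-- The second moment of a Gaussian linear form on the event that the signs of two other linear
forms disagree is controlled by the distance of the latter. -/
theorem integral_sgn_sub_sgn_sq_mul_le {u : E} (hu : ‖u‖ = 1) (w a : E) :
    ∫ x, (sgn (inner ℝ u x) - sgn (inner ℝ w x)) ^ 2 * inner ℝ a x ^ 2 ∂stdGaussian E ≤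
      mismatchConst * ‖w - u‖ * ‖a‖ ^ 2 := by
  have hT := thirdMoment_nonneg
  rcases eq_or_ne w u with rfl | hwu
  · simp
  -- Far apart, the trivial bound 4 ≤ 8‖w - u‖ on the squared sign difference is enough. This covers
  -- w = 0.
  rcases le_or_gt (1 / 2) ‖w - u‖ with hw | hw
  · have h1 : ∫ x, (sgn (inner ℝ u x) - sgn (inner ℝ w x)) ^ 2 * inner ℝ a x ^ 2 ∂stdGaussian E ≤
        ∫ x, 4 * inner ℝ a x ^ 2 ∂stdGaussian E := by
      refine integral_mono (integrable_sgn_sub_sgn_sq_mul u w a) ?_ fun x =>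
        mul_le_mul_of_nonneg_right (sgn_sub_sgn_sq_le _ _) (sq_nonneg _)
      have := (integrable_abs_inner_pow a 2).const_mul 4
      simpa using this
    rw [integral_const_mul, integral_inner_sq] at h1
    refine h1.trans (mul_le_mul_of_nonneg_right ?_ (sq_nonneg _))
    unfold mismatchConst
    nlinarith
  · have hsc : ∀ x : E, (sgn (inner ℝ u x) - sgn (inner ℝ w x)) ^ 2 * inner ℝ a x ^ 2 =
        ‖a‖ ^ 2 * ((sgn (inner ℝ u x) - sgn (inner ℝ w x)) ^ 2 * inner ℝ (‖a‖⁻¹ • a) x ^ 2) := by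
      intro x
      rw [inner_smul_left, conj_trivial]
      rcases eq_or_ne a 0 with rfl | ha
      · simp
      · have := norm_ne_zero_iff.2 ha
        field_simp
    simp_rw [hsc]
    rw [integral_const_mul, mul_comm]
    refine mul_le_mul_of_nonneg_right ?_ (sq_nonneg _)
    refine (integral_sgn_sub_sgn_sq_mul_le_aux hu ?_ hw hwu).trans
      (mul_le_mul_of_nonneg_right (by unfold mismatchConst; linarith) (norm_nonneg _))
    rw [norm_smul, norm_inv, norm_norm]
    exact inv_mul_le_one

end StdGaussian

/-! ### The law of one instance -/

section InstanceLaw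

variable {d₁ d₂ : ℕ}

/-- The standard Gaussian measure on `Fin d → ℝ`. -/
noncomputable abbrev gaussianPi (d : ℕ) : Measure (Fin d → ℝ) :=
  Measure.pi fun _ : Fin d => gaussianReal 0 1

theorem inner_toLp_eq_dotProduct {d : ℕ} (v x : Fin d → ℝ) :
    inner ℝ (WithLp.toLp 2 v) (WithLp.toLp 2 x) = x ⬝ᵥ v := by
  simp [EuclideanSpace.inner_toLp_toLp]

theorem norm_toLp_eq_sqrt {d : ℕ} (v : Fin d → ℝ) :
    ‖WithLp.toLp 2 v‖ = Real.sqrt (v ⬝ᵥ v) := by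
  rw [EuclideanSpace.norm_eq]
  simp [dotProduct, sq]

theorem integral_gaussianPi_comp {d : ℕ} {f : EuclideanSpace ℝ (Fin d) → ℝ} (hf : Measurable f) :
    ∫ x, f (WithLp.toLp 2 x) ∂gaussianPi d = ∫ x, f x ∂stdGaussian (EuclideanSpace ℝ (Fin d)) := by
  rw [← map_pi_eq_stdGaussian, integral_map (by fun_prop) hf.aestronglyMeasurable]

theorem integrable_gaussianPi_comp {d : ℕ} {f : EuclideanSpace ℝ (Fin d) → ℝ}
    (hf : Integrable f (stdGaussian (EuclideanSpace ℝ (Fin d)))) :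
    Integrable (fun x => f (WithLp.toLp 2 x)) (gaussianPi d) := by
  rw [← map_pi_eq_stdGaussian] at hf
  exact hf.comp_measurable (by fun_prop)

theorem measurable_sgn_inner {E : Type*} [NormedAddCommGroup E] [InnerProductSpace ℝ E]
    [MeasurableSpace E] [BorelSpace E] [SecondCountableTopology E] (w : E) :
    Measurable fun x : E => sgn (inner ℝ w x) :=
  measurable_sgn.comp (by fun_prop)

theorem integral_sgn_dotProduct_mul {d : ℕ} {w : Fin d → ℝ} (hw : w ⬝ᵥ w = 1 ∨ w = 0)
    (a : Fin d → ℝ) :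
    ∫ x, sgn (x ⬝ᵥ w) * (x ⬝ᵥ a) ∂gaussianPi d = Real.sqrt (2 / Real.pi) * (w ⬝ᵥ a) := by
  have h1 := integral_gaussianPi_comp (d := d)
    (f := fun x => sgn (inner ℝ (WithLp.toLp 2 w) x) * inner ℝ (WithLp.toLp 2 a) x)
    ((measurable_sgn_inner _).mul (by fun_prop))
  simp only [inner_toLp_eq_dotProduct] at h1
  rw [h1]
  rcases hw with hw | hw
  · rw [integral_sgn_inner_mul (by rw [norm_toLp_eq_sqrt, hw, Real.sqrt_one]),
      inner_toLp_eq_dotProduct, dotProduct_comm]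
  -- Here the sign is constantly 1, and a centred linear form is left.
  · subst hw
    have := integral_inner_stdGaussian (WithLp.toLp 2 a)
    simpa [sgn] using this

theorem integrable_sgn_sub_sgn_sq_mul_dotProduct {d : ℕ} (u w a : Fin d → ℝ) :
    Integrable (fun x => (sgn (x ⬝ᵥ u) - sgn (x ⬝ᵥ w)) ^ 2 * (x ⬝ᵥ a) ^ 2) (gaussianPi d) := by
  have := integrable_gaussianPi_comp
    (integrable_sgn_sub_sgn_sq_mul (WithLp.toLp 2 u) (WithLp.toLp 2 w) (WithLp.toLp 2 a))
  simpa only [inner_toLp_eq_dotProduct] using this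

theorem integrable_sgn_mul_dotProduct {d : ℕ} (w a : Fin d → ℝ) :
    Integrable (fun x => sgn (x ⬝ᵥ w) * (x ⬝ᵥ a)) (gaussianPi d) := by
  have h : Integrable (fun x => sgn (inner ℝ (WithLp.toLp 2 w) x) * inner ℝ (WithLp.toLp 2 a) x)
      (stdGaussian (EuclideanSpace ℝ (Fin d))) := by
    refine (hasGaussianLaw_inner (WithLp.toLp 2 a)).integrable.bdd_mul (c := 1)
      (measurable_sgn_inner _).aestronglyMeasurable (Filter.Eventually.of_forall fun x => ?_)
    rw [Real.norm_eq_abs, abs_sgn]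
  have := integrable_gaussianPi_comp h
  simpa only [inner_toLp_eq_dotProduct] using this

theorem integral_sgn_sub_sgn_sq_mul_dotProduct_le {d : ℕ} {u : Fin d → ℝ} (hu : u ⬝ᵥ u = 1)
    (w a : Fin d → ℝ) :
    ∫ x, (sgn (x ⬝ᵥ u) - sgn (x ⬝ᵥ w)) ^ 2 * (x ⬝ᵥ a) ^ 2 ∂gaussianPi d ≤
      mismatchConst * Real.sqrt ((w - u) ⬝ᵥ (w - u)) * (a ⬝ᵥ a) := by
  have h1 := integral_gaussianPi_comp (d := d)
    (f := fun x => (sgn (inner ℝ (WithLp.toLp 2 u) x) - sgn (inner ℝ (WithLp.toLp 2 w) x)) ^ 2 *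
      inner ℝ (WithLp.toLp 2 a) x ^ 2)
    ((((measurable_sgn_inner _).sub (measurable_sgn_inner _)).pow_const 2).mul (by fun_prop))
  simp only [inner_toLp_eq_dotProduct] at h1
  rw [h1]
  have h2 := integral_sgn_sub_sgn_sq_mul_le (u := WithLp.toLp 2 u)
    (by rw [norm_toLp_eq_sqrt, hu, Real.sqrt_one]) (WithLp.toLp 2 w) (WithLp.toLp 2 a)
  rw [← WithLp.toLp_sub, norm_toLp_eq_sqrt, norm_toLp_eq_sqrt, Real.sq_sqrt
    (by simpa [dotProduct] using Finset.sum_nonneg fun i _ => mul_self_nonneg (a i))] at h2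
  exact h2

/-- Conditioning on the label: all moments of an instance become averages over columns of Gaussian
moments. -/
theorem instanceLaw_eq_sum (d₁ d₂ : ℕ) : instanceLaw d₁ d₂ =
    ∑ j : Fin d₂, (d₂ : ENNReal)⁻¹ • (gaussianPi d₁).map (fun x => (x, j)) := by
  ext s hs
  have hu : (uniformOn (Set.univ : Set (Fin d₂))) = (d₂ : ENNReal)⁻¹ • Measure.count := by
    simp [uniformOn, ProbabilityTheory.cond, Measure.count_univ]
  have : SFinite ((d₂ : ENNReal)⁻¹ • (Measure.count : Measure (Fin d₂))) := by
    rw [← hu, uniformOn]; infer_instance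
  rw [instanceLaw, hu, Measure.prod_apply_symm hs, lintegral_smul_measure, lintegral_count,
    tsum_fintype, Measure.finsetSum_apply, smul_eq_mul, Finset.mul_sum]
  refine Finset.sum_congr rfl fun j _ => ?_
  rw [Measure.smul_apply, smul_eq_mul, Measure.map_apply (by fun_prop) hs]

theorem integrable_instanceLaw {f : (Fin d₁ → ℝ) × Fin d₂ → ℝ} (hd : 0 < d₂)
    (hf : Measurable f) (h : ∀ j, Integrable (fun x => f (x, j)) (gaussianPi d₁)) :
    Integrable f (instanceLaw d₁ d₂) := by
  rw [instanceLaw_eq_sum, integrable_finsetSum_measure]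
  intro j _
  refine Integrable.smul_measure ?_ (by simp [hd.ne'])
  rw [integrable_map_measure hf.aestronglyMeasurable (by fun_prop)]
  exact h j

theorem integral_instanceLaw {f : (Fin d₁ → ℝ) × Fin d₂ → ℝ} (hd : 0 < d₂)
    (hf : Measurable f) (h : ∀ j, Integrable (fun x => f (x, j)) (gaussianPi d₁)) :
    ∫ z, f z ∂instanceLaw d₁ d₂ = (d₂ : ℝ)⁻¹ * ∑ j, ∫ x, f (x, j) ∂gaussianPi d₁ := by
  rw [instanceLaw_eq_sum, integral_finsetSum_measure, Finset.mul_sum]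
  · refine Finset.sum_congr rfl fun j _ => ?_
    rw [integral_smul_measure, integral_map (by fun_prop) hf.aestronglyMeasurable]
    simp
  · intro j _
    refine Integrable.smul_measure ?_ (by simp [hd.ne'])
    rw [integrable_map_measure hf.aestronglyMeasurable (by fun_prop)]
    exact h j

end InstanceLaw

/-! ### The summands of the correction -/

section Summand

variable {m d₁ d₂ : ℕ}

/-- The bilinear form `(a, c) ↦ aᵀ H c` of the contribution of a single instance to the
correction. -/
noncomputable def summand (Ws W : Matrix (Fin d₁) (Fin d₂) ℝ) (a : Fin d₁ → ℝ) (c : Fin d₂ → ℝ)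
    (z : (Fin d₁ → ℝ) × Fin d₂) : ℝ :=
  d₂ / Real.sqrt (2 / Real.pi) * c z.2 *
    ((sgn (z.1 ⬝ᵥ Ws.col z.2) - sgn (z.1 ⬝ᵥ W.col z.2)) * (z.1 ⬝ᵥ a))

theorem measurable_summand (Ws W : Matrix (Fin d₁) (Fin d₂) ℝ) (a : Fin d₁ → ℝ)
    (c : Fin d₂ → ℝ) : Measurable (summand Ws W a c) := by
  refine measurable_from_prod_countable_left fun j => ?_
  have h : ∀ v : Fin d₁ → ℝ, Measurable fun x : Fin d₁ → ℝ => x ⬝ᵥ v := fun v => by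
    unfold dotProduct; fun_prop
  have h1 := (measurable_sgn.comp (h (Ws.col j))).sub (measurable_sgn.comp (h (W.col j)))
  exact (h1.mul (h a)).const_mul (d₂ / Real.sqrt (2 / Real.pi) * c j)

/-- The factor d₂ in the summand cancels the probability 1/d₂ of each label, and √(2/π) cancels the
Gaussian mean. This is the unbiasedness of the correction. -/
theorem integral_summand {Ws W : Matrix (Fin d₁) (Fin d₂) ℝ} (hd : 0 < d₂)
    (hWs : ∀ j, Ws.col j ⬝ᵥ Ws.col j = 1) (hW : ∀ j, W.col j ⬝ᵥ W.col j = 1 ∨ W.col j = 0)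
    (a : Fin d₁ → ℝ) (c : Fin d₂ → ℝ) :
    ∫ z, summand Ws W a c z ∂instanceLaw d₁ d₂ = a ⬝ᵥ (Ws - W).mulVec c := by
  have hπ : Real.sqrt (2 / Real.pi) ≠ 0 := (Real.sqrt_pos.2 (by positivity)).ne'
  have hi : ∀ j, Integrable (fun x => summand Ws W a c (x, j)) (gaussianPi d₁) := by
    intro j
    simp only [summand, sub_mul]
    exact ((integrable_sgn_mul_dotProduct _ _).sub (integrable_sgn_mul_dotProduct _ _)).const_mul _
  rw [integral_instanceLaw hd (measurable_summand Ws W a c) hi]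
  have hd' : (d₂ : ℝ) ≠ 0 := by exact_mod_cast hd.ne'
  have hj : ∀ j, ∫ x, summand Ws W a c (x, j) ∂gaussianPi d₁ =
      d₂ * (c j * (Ws.col j ⬝ᵥ a - W.col j ⬝ᵥ a)) := by
    intro j
    simp only [summand, sub_mul]
    rw [integral_const_mul, integral_sub (integrable_sgn_mul_dotProduct _ _)
      (integrable_sgn_mul_dotProduct _ _), integral_sgn_dotProduct_mul (Or.inl (hWs j)),
      integral_sgn_dotProduct_mul (hW j)]
    field_simp
  simp only [hj]
  rw [← Finset.mul_sum, inv_mul_cancel_left₀ hd']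
  simp only [dotProduct, Matrix.mulVec, Finset.mul_sum, Matrix.sub_apply, Matrix.col_apply,
    ← Finset.sum_sub_distrib]
  rw [Finset.sum_comm]
  refine Finset.sum_congr rfl fun i _ => Finset.sum_congr rfl fun j _ => ?_
  ring

theorem integrable_summand_sq {Ws W : Matrix (Fin d₁) (Fin d₂) ℝ} (hd : 0 < d₂)
    (a : Fin d₁ → ℝ) (c : Fin d₂ → ℝ) :
    Integrable (fun z => summand Ws W a c z ^ 2) (instanceLaw d₁ d₂) := by
  refine integrable_instanceLaw hd ((measurable_summand Ws W a c).pow_const 2) fun j => ?_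
  simp only [summand, mul_pow _ _ 2]
  exact (integrable_sgn_sub_sgn_sq_mul_dotProduct _ _ _).const_mul _

/-- The constant of the second moment bound of the noise. -/
noncomputable def noiseConst : ℝ := mismatchConst * (Real.pi / 2)

theorem noiseConst_pos : 0 < noiseConst := mul_pos mismatchConst_pos (by positivity)

/-- Of the factor d₂² one power is lost in averaging over labels; π/2 is the inverse square of
√(2/π). -/
theorem integral_summand_sq_le {Ws W : Matrix (Fin d₁) (Fin d₂) ℝ} (hd : 0 < d₂)
    (hWs : ∀ j, Ws.col j ⬝ᵥ Ws.col j = 1) {e : ℝ}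
    (he : ∀ j, Real.sqrt ((W.col j - Ws.col j) ⬝ᵥ (W.col j - Ws.col j)) ≤ e)
    (a : Fin d₁ → ℝ) (c : Fin d₂ → ℝ) :
    ∫ z, summand Ws W a c z ^ 2 ∂instanceLaw d₁ d₂ ≤
      noiseConst * d₂ * e * (a ⬝ᵥ a) * (c ⬝ᵥ c) := by
  have hd' : (d₂ : ℝ) ≠ 0 := by exact_mod_cast hd.ne'
  have haa : 0 ≤ a ⬝ᵥ a := by
    simpa [dotProduct] using Finset.sum_nonneg fun i _ => mul_self_nonneg (a i)
  rw [integral_instanceLaw hd ((measurable_summand Ws W a c).pow_const 2) fun j => by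
    simp only [summand, mul_pow _ _ 2]
    exact (integrable_sgn_sub_sgn_sq_mul_dotProduct _ _ _).const_mul _]
  have hj : ∀ j, ∫ x, summand Ws W a c (x, j) ^ 2 ∂gaussianPi d₁ ≤
      (d₂ ^ 2 * (Real.pi / 2) * (mismatchConst * e * (a ⬝ᵥ a))) * (c j * c j) := by
    intro j
    simp only [summand, mul_pow _ _ 2]
    rw [integral_const_mul, div_pow, Real.sq_sqrt (by positivity)]
    have h1 := integral_sgn_sub_sgn_sq_mul_dotProduct_le (hWs j) (W.col j) a
    have h2 : mismatchConst * Real.sqrt ((W.col j - Ws.col j) ⬝ᵥ (W.col j - Ws.col j)) * (a ⬝ᵥ a) ≤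
        mismatchConst * e * (a ⬝ᵥ a) :=
      mul_le_mul_of_nonneg_right (mul_le_mul_of_nonneg_left (he j) mismatchConst_pos.le) haa
    calc _ ≤ (d₂ : ℝ) ^ 2 / (2 / Real.pi) * c j ^ 2 * (mismatchConst * e * (a ⬝ᵥ a)) :=
          mul_le_mul_of_nonneg_left (h1.trans h2) (by positivity)
      _ = _ := by field_simp
  calc (d₂ : ℝ)⁻¹ * ∑ j, ∫ x, summand Ws W a c (x, j) ^ 2 ∂gaussianPi d₁
      ≤ (d₂ : ℝ)⁻¹ * ∑ j, (d₂ ^ 2 * (Real.pi / 2) * (mismatchConst * e * (a ⬝ᵥ a))) *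
          (c j * c j) :=
        mul_le_mul_of_nonneg_left (Finset.sum_le_sum fun j _ => hj j) (by positivity)
    _ = noiseConst * d₂ * e * (a ⬝ᵥ a) * (c ⬝ᵥ c) := by
        rw [← Finset.mul_sum, noiseConst]
        simp only [dotProduct]
        field_simp

/-- One √d₂ comes from the prefactor and one from the scaled one-hot vector; the scaling inside the
signs is immaterial. -/
theorem dotProduct_correction_mulVec (hd : 0 < d₂) (b : Batch m d₁ d₂)
    (Ws W : Matrix (Fin d₁) (Fin d₂) ℝ) (a : Fin d₁ → ℝ) (c : Fin d₂ → ℝ) :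
    a ⬝ᵥ (correction b (labels b Ws) W).mulVec c = (m : ℝ)⁻¹ * ∑ i, summand Ws W a c (b i) := by
  have hd' : (0 : ℝ) < d₂ := by exact_mod_cast hd
  have hs : ∀ (V : Matrix (Fin d₁) (Fin d₂) ℝ) i, labels b V i = sgn ((b i).1 ⬝ᵥ V.col (b i).2) := by
    intro V i
    have : V.mulVec (oneHot (b i).2) = Real.sqrt d₂ • V.col (b i).2 := by
      ext l
      simp [oneHot, Matrix.mulVec, dotProduct, Pi.single_apply, mul_comm]
    rw [labels, sensing, this, dotProduct_smul, smul_eq_mul, sgn_mul_of_pos (Real.sqrt_pos.2 hd')]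
  have hv : ∀ i, a ⬝ᵥ (Matrix.vecMulVec (b i).1 (oneHot (b i).2)).mulVec c =
      (((b i).1) ⬝ᵥ a) * (Real.sqrt d₂ * c (b i).2) := by
    intro i
    rw [Matrix.vecMulVec_mulVec]
    have h1 : oneHot (b i).2 ⬝ᵥ c = Real.sqrt d₂ * c (b i).2 := by
      rw [oneHot, single_dotProduct]
    rw [h1, dotProduct_smul, dotProduct_comm a]
    simp [mul_comm]
  rw [correction, sensingAdj, Matrix.smul_mulVec, dotProduct_smul, Matrix.sum_mulVec,
    dotProduct_sum, Finset.smul_sum, Finset.mul_sum]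
  refine Finset.sum_congr rfl fun i _ => ?_
  rw [Matrix.smul_mulVec, dotProduct_smul, hv, Pi.sub_apply, hs, hs, summand]
  simp only [smul_eq_mul]
  have h1 : Real.sqrt d₂ * Real.sqrt d₂ = d₂ := Real.mul_self_sqrt hd'.le
  generalize sgn ((b i).1 ⬝ᵥ Ws.col (b i).2) - sgn ((b i).1 ⬝ᵥ W.col (b i).2) = q
  calc _ = (Real.sqrt d₂ * Real.sqrt d₂) / (m * Real.sqrt (2 / Real.pi)) *
        (q * ((b i).1 ⬝ᵥ a) * c (b i).2) := by ring
    _ = _ := by rw [h1, div_mul_eq_div_div, div_right_comm, div_eq_inv_mul _ (m : ℝ)]; ring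

end Summand

/-! ### Second moments of the noise -/

section Noise

variable {m d₁ d₂ : ℕ}

/-- The deviation of the correction from `Ws - W`. -/
noncomputable def noise (Ws W : Matrix (Fin d₁) (Fin d₂) ℝ) (b : Batch m d₁ d₂) :
    Matrix (Fin d₁) (Fin d₂) ℝ :=
  correction b (labels b Ws) W - (Ws - W)

theorem dilation_correction_add (Ws W : Matrix (Fin d₁) (Fin d₂) ℝ) (b : Batch m d₁ d₂) :
    dilation (correction b (labels b Ws) W) + dilation W = dilation Ws + dilation (noise Ws W b) := by
  rw [← dilation_add, ← dilation_add, noise]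
  congr 1
  abel

variable {Ω : Type*} [MeasurableSpace Ω] {P : Measure Ω} [IsProbabilityMeasure P]
  {Y : Fin m → Ω → (Fin d₁ → ℝ) × Fin d₂}

/-- Hypotheses on a batch of independent instances and on the current estimate. -/
structure NoiseSetup (P : Measure Ω) (Y : Fin m → Ω → (Fin d₁ → ℝ) × Fin d₂)
    (Ws W : Matrix (Fin d₁) (Fin d₂) ℝ) (e : ℝ) : Prop where
  dim_pos : 0 < d₂
  size_pos : 0 < m
  meas : ∀ i, Measurable (Y i)
  indep : iIndepFun Y P
  law : ∀ i, P.map (Y i) = instanceLaw d₁ d₂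
  unit : ∀ j, Ws.col j ⬝ᵥ Ws.col j = 1
  unit_or_zero : ∀ j, W.col j ⬝ᵥ W.col j = 1 ∨ W.col j = 0
  dist_le : ∀ j, Real.sqrt ((W.col j - Ws.col j) ⬝ᵥ (W.col j - Ws.col j)) ≤ e

variable {Ws W : Matrix (Fin d₁) (Fin d₂) ℝ} {e : ℝ}

theorem NoiseSetup.nonneg (h : NoiseSetup P Y Ws W e) : 0 ≤ e :=
  (Real.sqrt_nonneg _).trans (h.dist_le ⟨0, h.dim_pos⟩)

/-- The bilinear form is a centred average of m independent terms, so its second moment is a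
variance divided by m. -/
theorem NoiseSetup.second_moment (h : NoiseSetup P Y Ws W e) (a : Fin d₁ → ℝ) (c : Fin d₂ → ℝ) :
    Integrable (fun ω => (a ⬝ᵥ (noise Ws W fun i => Y i ω).mulVec c) ^ 2) P ∧
    ∫ ω, (a ⬝ᵥ (noise Ws W fun i => Y i ω).mulVec c) ^ 2 ∂P ≤
      noiseConst * (d₂ / m) * e * (a ⬝ᵥ a) * (c ⬝ᵥ c) := by
  have hm : (0 : ℝ) < m := by exact_mod_cast h.size_pos
  have hsm := measurable_summand Ws W a c
  set X : Fin m → Ω → ℝ := fun i ω => summand Ws W a c (Y i ω) with hX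
  have hXm : ∀ i, Measurable (X i) := fun i => hsm.comp (h.meas i)
  have hXsq : ∀ i, Integrable (fun ω => X i ω ^ 2) P := by
    intro i
    have := integrable_summand_sq (Ws := Ws) (W := W) h.dim_pos a c
    rw [← h.law i] at this
    exact this.comp_measurable (h.meas i)
  have hXL : ∀ i, MemLp (X i) 2 P := fun i =>
    (memLp_two_iff_integrable_sq (hXm i).aestronglyMeasurable).2 (hXsq i)
  have hmean : ∀ i, ∫ ω, X i ω ∂P = a ⬝ᵥ (Ws - W).mulVec c := by
    intro i
    rw [← integral_summand h.dim_pos h.unit h.unit_or_zero, ← h.law i,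
      integral_map (h.meas i).aemeasurable hsm.aestronglyMeasurable]
  have hvar : ∀ i, Var[X i; P] ≤ noiseConst * d₂ * e * (a ⬝ᵥ a) * (c ⬝ᵥ c) := by
    intro i
    refine (variance_le_expectation_sq (hXm i).aestronglyMeasurable).trans ?_
    refine le_trans (le_of_eq ?_) (integral_summand_sq_le h.dim_pos h.unit h.dist_le a c)
    rw [← h.law i, integral_map (h.meas i).aemeasurable (hsm.pow_const 2).aestronglyMeasurable]
    rfl
  set S : Ω → ℝ := ∑ i, X i with hS
  have hSL : MemLp S 2 P := memLp_finsetSum' _ fun i _ => hXL i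
  have hSmean : ∫ ω, S ω ∂P = m * (a ⬝ᵥ (Ws - W).mulVec c) := by
    simp only [hS, Finset.sum_apply]
    rw [integral_finsetSum _ fun i _ => (hXL i).integrable (by norm_num)]
    simp [hmean]
  have hform : ∀ ω, a ⬝ᵥ (noise Ws W fun i => Y i ω).mulVec c =
      (m : ℝ)⁻¹ * (S ω - ∫ ω, S ω ∂P) := by
    intro ω
    rw [noise, Matrix.sub_mulVec, dotProduct_sub, dotProduct_correction_mulVec h.dim_pos, hSmean,
      mul_sub, inv_mul_cancel_left₀ hm.ne']
    simp [hS, hX]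
  have hSvar : Var[S; P] ≤ m * (noiseConst * d₂ * e * (a ⬝ᵥ a) * (c ⬝ᵥ c)) := by
    rw [hS, IndepFun.variance_sum (fun i _ => hXL i)
      fun i _ j _ hij => (h.indep.indepFun hij).comp hsm hsm]
    calc ∑ i, Var[X i; P] ≤ ∑ _i : Fin m, (noiseConst * d₂ * e * (a ⬝ᵥ a) * (c ⬝ᵥ c)) :=
          Finset.sum_le_sum fun i _ => hvar i
      _ = _ := by simp
  constructor
  · simp only [hform, mul_pow]
    exact ((hSL.sub (memLp_const _)).integrable_sq).const_mul _
  · simp only [hform, mul_pow]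
    rw [integral_const_mul, ← variance_eq_integral hSL.aemeasurable]
    calc ((m : ℝ)⁻¹) ^ 2 * Var[S; P]
        ≤ ((m : ℝ)⁻¹) ^ 2 * (m * (noiseConst * d₂ * e * (a ⬝ᵥ a) * (c ⬝ᵥ c))) :=
          mul_le_mul_of_nonneg_left hSvar (by positivity)
      _ = _ := by field_simp

theorem frob_sq_eq_sum_bilin (N : Matrix (Fin d₁) (Fin d₂) ℝ) : frob N ^ 2 =
    ∑ i, ∑ j, ((Pi.single i 1 : Fin d₁ → ℝ) ⬝ᵥ N.mulVec (Pi.single j 1)) ^ 2 := by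
  rw [frob_sq]; simp

theorem frob_dilation_mul_sq {r : Type*} [Fintype r] (N : Matrix (Fin d₁) (Fin d₂) ℝ)
    (X : Matrix (Fin d₁ ⊕ Fin d₂) r ℝ) : frob (dilation N * X) ^ 2 =
    ∑ i, ∑ q, ((Pi.single i 1 : Fin d₁ → ℝ) ⬝ᵥ N.mulVec fun j => X (Sum.inr j) q) ^ 2 +
    ∑ j, ∑ q, ((fun i => X (Sum.inl i) q) ⬝ᵥ N.mulVec (Pi.single j 1)) ^ 2 := by
  rw [frob_sq, Fintype.sum_sum_type]
  congr 1
  · refine Finset.sum_congr rfl fun i _ => Finset.sum_congr rfl fun q _ => ?_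
    rw [single_dotProduct, one_mul]
    simp [dilation, Matrix.mul_apply, Matrix.mulVec, dotProduct]
  · refine Finset.sum_congr rfl fun i _ => Finset.sum_congr rfl fun q _ => ?_
    simp [dilation, Matrix.mul_apply, dotProduct, mul_comm]

theorem NoiseSetup.frob_noise (h : NoiseSetup P Y Ws W e) :
    Integrable (fun ω => frob (noise Ws W fun i => Y i ω) ^ 2) P ∧
    ∫ ω, frob (noise Ws W fun i => Y i ω) ^ 2 ∂P ≤ noiseConst * (d₁ * d₂ / m) * e * d₂ := by
  simp only [frob_sq_eq_sum_bilin]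
  have hi : ∀ i j, Integrable (fun ω => ((Pi.single i 1 : Fin d₁ → ℝ) ⬝ᵥ
      (noise Ws W fun i => Y i ω).mulVec (Pi.single j 1)) ^ 2) P :=
    fun i j => (h.second_moment _ _).1
  refine ⟨integrable_finsetSum _ fun i _ => integrable_finsetSum _ fun j _ => hi i j, ?_⟩
  rw [integral_finsetSum _ fun i _ => integrable_finsetSum _ fun j _ => hi i j]
  simp only [integral_finsetSum _ fun j _ => hi _ j]
  calc _ ≤ ∑ _i : Fin d₁, ∑ _j : Fin d₂, noiseConst * (d₂ / m) * e := by
        refine Finset.sum_le_sum fun i _ => Finset.sum_le_sum fun j _ => ?_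
        simpa using (h.second_moment (Pi.single i 1) (Pi.single j 1)).2
    _ = _ := by simp; ring

/-- Each entry of the product is a bilinear form of the noise with one coordinate vector. The upper
block has d₁ rows and the lower one d₂ ≤ d₁, which yields the common factor d₁d₂/m. -/
theorem NoiseSetup.frob_dilation_mul (h : NoiseSetup P Y Ws W e) (hd : d₂ ≤ d₁) {r : Type*}
    [Fintype r] (X : Matrix (Fin d₁ ⊕ Fin d₂) r ℝ) :
    Integrable (fun ω => frob (dilation (noise Ws W fun i => Y i ω) * X) ^ 2) P ∧
    ∫ ω, frob (dilation (noise Ws W fun i => Y i ω) * X) ^ 2 ∂P ≤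
      noiseConst * (d₁ * d₂ / m) * e * frob X ^ 2 := by
  simp only [frob_dilation_mul_sq]
  have hi1 : ∀ i q, Integrable (fun ω => ((Pi.single i 1 : Fin d₁ → ℝ) ⬝ᵥ
      (noise Ws W fun i => Y i ω).mulVec fun j => X (Sum.inr j) q) ^ 2) P :=
    fun i q => (h.second_moment _ _).1
  have hi2 : ∀ j q, Integrable (fun ω => ((fun i => X (Sum.inl i) q) ⬝ᵥ
      (noise Ws W fun i => Y i ω).mulVec (Pi.single j 1)) ^ 2) P :=
    fun j q => (h.second_moment _ _).1
  have hI1 := integrable_finsetSum Finset.univ fun i _ =>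
    integrable_finsetSum Finset.univ fun q _ => hi1 i q
  have hI2 := integrable_finsetSum Finset.univ fun j _ =>
    integrable_finsetSum Finset.univ fun q _ => hi2 j q
  refine ⟨hI1.add hI2, ?_⟩
  rw [integral_add hI1 hI2,
    integral_finsetSum _ fun i _ => integrable_finsetSum _ fun q _ => hi1 i q,
    integral_finsetSum _ fun i _ => integrable_finsetSum _ fun q _ => hi2 i q]
  simp only [integral_finsetSum _ fun q _ => hi1 _ q, integral_finsetSum _ fun q _ => hi2 _ q]
  have hc := noiseConst_pos.le
  have he := h.nonneg
  have hdd : (d₂ : ℝ) ≤ d₁ := by exact_mod_cast hd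
  have b1 : ∑ i : Fin d₁, ∑ q, ∫ ω, ((Pi.single i 1 : Fin d₁ → ℝ) ⬝ᵥ
      (noise Ws W fun i => Y i ω).mulVec fun j => X (Sum.inr j) q) ^ 2 ∂P ≤
      noiseConst * (d₁ * d₂ / m) * e * ∑ j, ∑ q, X (Sum.inr j) q ^ 2 := by
    calc _ ≤ ∑ _i : Fin d₁, ∑ q, noiseConst * (d₂ / m) * e * ∑ j, X (Sum.inr j) q ^ 2 := by
          refine Finset.sum_le_sum fun i _ => Finset.sum_le_sum fun q _ => ?_
          have := (h.second_moment (Pi.single i 1) fun j => X (Sum.inr j) q).2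
          rw [single_dotProduct, Pi.single_eq_same, mul_one, mul_one] at this
          simpa only [dotProduct, ← sq] using this
      _ = _ := by
        rw [Finset.sum_const, ← Finset.mul_sum, Finset.sum_comm]
        simp; ring
  have b2 : ∑ j : Fin d₂, ∑ q, ∫ ω, ((fun i => X (Sum.inl i) q) ⬝ᵥ
      (noise Ws W fun i => Y i ω).mulVec (Pi.single j 1)) ^ 2 ∂P ≤
      noiseConst * (d₁ * d₂ / m) * e * ∑ i, ∑ q, X (Sum.inl i) q ^ 2 := by
    calc _ ≤ ∑ _j : Fin d₂, ∑ q, noiseConst * (d₂ / m) * e * ∑ i, X (Sum.inl i) q ^ 2 := by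
          refine Finset.sum_le_sum fun i _ => Finset.sum_le_sum fun q _ => ?_
          have := (h.second_moment (fun i => X (Sum.inl i) q) (Pi.single i 1)).2
          rw [single_dotProduct, Pi.single_eq_same, mul_one, mul_one] at this
          simpa only [dotProduct, ← sq] using this
      _ = noiseConst * (d₂ * d₂ / m) * e * ∑ i, ∑ q, X (Sum.inl i) q ^ 2 := by
        rw [Finset.sum_const, ← Finset.mul_sum, Finset.sum_comm]
        simp; ring
      _ ≤ _ := by gcongr
  calc _ ≤ _ := add_le_add b1 b2
    _ = _ := by rw [← mul_add, frob_sq, Fintype.sum_sum_type, add_comm]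

end Noise

/-! ### Explicit formulas for the projections of the iteration -/

section Formulas

variable {n : Type} [Fintype n] [DecidableEq n]

theorem frob_eq_zero {m l : Type*} [Fintype m] [Fintype l] {A : Matrix m l ℝ} (h : frob A = 0) :
    A = 0 := by
  have h1 := frob_sq A
  rw [h, zero_pow two_ne_zero] at h1
  ext i j
  have h2 := (Finset.sum_eq_zero_iff_of_nonneg fun i _ =>
    Finset.sum_nonneg fun j _ => sq_nonneg (A i j)).1 h1.symm i (Finset.mem_univ i)
  have h3 := (Finset.sum_eq_zero_iff_of_nonneg fun j _ => sq_nonneg (A i j)).1 h2 j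
    (Finset.mem_univ j)
  simpa using h3

variable {D Q Dp : Matrix n n ℝ} {σ : ℝ}

/-- Half of Y survives the projection Q, D expands that half by σ, and E costs at most σ/8: 1/2 -
1/8 = 3/8. This gives injectivity for `nextProj_eq` and the spectral gap for
`IsRangeData.initProj_eq`. -/
theorem IsRangeData.lower_bound (h : IsRangeData D Q Dp σ) {P E : Matrix n n ℝ} (hP : IsProj P)
    (htr : P.trace = Q.trace) (hPQ : frob ((1 - P) * Q) ≤ 1 / 2) (hEσ : frob E ≤ σ / 8)
    {l : Type} [Fintype l] {Y : Matrix n l ℝ} (hY : P * Y = Y) :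
    3 / 8 * σ * frob Y ≤ frob ((D + E) * Y) := by
  have hσ := h.pos
  have h1 : σ * frob (Q * Y) ≤ frob ((D + E) * Y) + frob (E * Y) := by
    rw [← h.pinv_mul, Matrix.mul_assoc]
    refine (h.frob_pinv_mul _).trans ?_
    have : D * Y = (D + E) * Y - E * Y := by rw [Matrix.add_mul, add_sub_cancel_right]
    rw [this]
    exact frob_sub_le _ _
  have h2 : frob (E * Y) ≤ σ / 8 * frob Y :=
    (frob_mul_le _ _).trans (mul_le_mul_of_nonneg_right hEσ (frob_nonneg _))
  have h3 : frob ((1 - Q) * Y) ≤ 1 / 2 * frob Y := by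
    conv_lhs => rw [← hY, ← Matrix.mul_assoc]
    refine (frob_mul_le _ _).trans (mul_le_mul_of_nonneg_right ?_ (frob_nonneg _))
    rw [hP.frob_compl_mul_comm h.proj htr]
    exact hPQ
  have h4 : frob Y ≤ frob (Q * Y) + frob ((1 - Q) * Y) := by
    have : Y = Q * Y + (1 - Q) * Y := by
      rw [← Matrix.add_mul, add_sub_cancel, Matrix.one_mul]
    conv_lhs => rw [this]
    exact frob_add_le _ _
  nlinarith [frob_nonneg Y]

/-- The projection onto the range of `M * P`, provided `M` is injective on the range of the
projection `P`. -/
noncomputable def nextProj (M P : Matrix n n ℝ) : Matrix n n ℝ :=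
  M * P * (P * M * M * P + (1 - P))⁻¹ * P * M

/-- Whatever QR decomposition is chosen, the projection onto the new subspace depends only on M and
the old projection. Injectivity makes R invertible. -/
theorem nextProj_eq {r : ℕ} {M : Matrix n n ℝ} (hM : M.transpose = M) {U U' : Matrix n (Fin r) ℝ}
    {R : Matrix (Fin r) (Fin r) ℝ} (hU : U.transpose * U = 1) (hU' : U'.transpose * U' = 1)
    (hR : M * U = U' * R) (hinj : ∀ K : Matrix (Fin r) (Fin 1) ℝ, M * (U * K) = 0 → K = 0) :
    nextProj M (U * U.transpose) = U' * U'.transpose := by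
  have hRunit : IsUnit R := by
    rw [← Matrix.mulVec_injective_iff_isUnit]
    refine (injective_iff_map_eq_zero (Matrix.mulVecLin R)).2 fun x hx => ?_
    have hx' : R.mulVec x = 0 := hx
    have := hinj (Matrix.replicateCol (Fin 1) x) (by
      rw [← Matrix.mul_assoc, hR, Matrix.mul_assoc, ← Matrix.replicateCol_mulVec, hx']
      ext; simp [Matrix.mul_apply])
    ext i
    simpa using congrFun (congrFun this i) 0
  have hRdet : IsUnit R.det := (Matrix.isUnit_iff_isUnit_det R).1 hRunit
  have hUM : U.transpose * M = R.transpose * U'.transpose := by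
    have := congrArg Matrix.transpose hR
    rwa [Matrix.transpose_mul, Matrix.transpose_mul, hM] at this
  have hGU : U * U.transpose * M * M * (U * U.transpose) * U = U * (R.transpose * R) := by
    calc U * U.transpose * M * M * (U * U.transpose) * U
        = U * (U.transpose * M) * (M * U) * (U.transpose * U) := by simp only [Matrix.mul_assoc]
      _ = U * R.transpose * (U'.transpose * U') * R := by
          rw [hU, Matrix.mul_one, hUM, hR]; simp only [Matrix.mul_assoc]
      _ = _ := by rw [hU', Matrix.mul_one, Matrix.mul_assoc]
  have hPU : U * U.transpose * U = U := by rw [Matrix.mul_assoc, hU, Matrix.mul_one]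
  have hP := isProj_mul_transpose hU
  have hRR : (R.transpose * R) * (R⁻¹ * (R⁻¹).transpose) = 1 := by
    rw [Matrix.mul_assoc, ← Matrix.mul_assoc R, Matrix.mul_nonsing_inv R hRdet, Matrix.one_mul,
      ← Matrix.transpose_mul, Matrix.nonsing_inv_mul R hRdet, Matrix.transpose_one]
  -- The summand 1 - U Uᵀ fills the kernel of the compression of M², so an honest inverse can stand
  -- for the one on the range of U.
  have hinv : (U * U.transpose * M * M * (U * U.transpose) + (1 - U * U.transpose))⁻¹ =
      U * (R⁻¹ * (R⁻¹).transpose) * U.transpose + (1 - U * U.transpose) := by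
    refine Matrix.inv_eq_right_inv ?_
    have e1 : (U * U.transpose * M * M * (U * U.transpose) + (1 - U * U.transpose)) *
        (U * (R⁻¹ * (R⁻¹).transpose) * U.transpose) = U * U.transpose := by
      rw [← Matrix.mul_assoc, ← Matrix.mul_assoc, Matrix.add_mul, hGU, Matrix.sub_mul,
        Matrix.one_mul, hPU, sub_self, add_zero, Matrix.mul_assoc U, hRR, Matrix.mul_one]
    have e2 : (U * U.transpose * M * M * (U * U.transpose) + (1 - U * U.transpose)) *
        (1 - U * U.transpose) = 1 - U * U.transpose := by
      rw [Matrix.add_mul, hP.compl.idem, Matrix.mul_assoc _ (U * U.transpose)]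
      rw [show U * U.transpose * (1 - U * U.transpose) = 0 by
        rw [Matrix.mul_sub, Matrix.mul_one, hP.idem, sub_self], Matrix.mul_zero, zero_add]
    rw [Matrix.mul_add, e1, e2, add_sub_cancel]
  have hmid : M * (U * U.transpose) * (1 - U * U.transpose) = 0 := by
    rw [Matrix.mul_assoc, Matrix.mul_sub, Matrix.mul_one, hP.idem, sub_self, Matrix.mul_zero]
  have hRiR : R * (R⁻¹ * (R⁻¹).transpose) * R.transpose = 1 := by
    rw [← Matrix.mul_assoc, Matrix.mul_nonsing_inv R hRdet, Matrix.one_mul,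
      ← Matrix.transpose_mul, Matrix.mul_nonsing_inv R hRdet, Matrix.transpose_one]
  rw [nextProj, hinv, Matrix.mul_add, hmid, add_zero]
  calc M * (U * U.transpose) * (U * (R⁻¹ * (R⁻¹).transpose) * U.transpose) * (U * U.transpose) * M
      = M * U * (U.transpose * U) * (R⁻¹ * (R⁻¹).transpose) * (U.transpose * U) *
          (U.transpose * M) := by simp only [Matrix.mul_assoc]
    _ = U' * (R * (R⁻¹ * (R⁻¹).transpose) * R.transpose) * U'.transpose := by
        rw [hU, Matrix.mul_one, Matrix.mul_one, hUM, hR]; simp only [Matrix.mul_assoc]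
    _ = U' * U'.transpose := by rw [hRiR, Matrix.mul_one]

/-- The spectral projection of `A * A` to the eigenvalues larger than `τ`. -/
noncomputable def initProj (τ : ℝ) (A : Matrix n n ℝ) : Matrix n n ℝ :=
  Matrix.of fun i j => Filter.limsup
    (fun p : ℕ => ((A * A) ^ p * (τ ^ p • (1 : Matrix n n ℝ) + (A * A) ^ p)⁻¹) i j) Filter.atTop

theorem tendsto_pow_div_add_pow {τ x : ℝ} (hτ : 0 < τ) (hx : 0 ≤ x) :
    (τ < x → Filter.Tendsto (fun p : ℕ => x ^ p * (τ ^ p + x ^ p)⁻¹) Filter.atTop (nhds 1)) ∧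
    (x < τ → Filter.Tendsto (fun p : ℕ => x ^ p * (τ ^ p + x ^ p)⁻¹) Filter.atTop (nhds 0)) := by
  constructor
  · intro h
    have hx0 : 0 < x := hτ.trans h
    have h1 : Filter.Tendsto (fun p : ℕ => (τ / x) ^ p) Filter.atTop (nhds 0) :=
      tendsto_pow_atTop_nhds_zero_of_lt_one (by positivity) ((div_lt_one hx0).2 h)
    have h2 := (h1.add_const 1).inv₀ (by norm_num)
    simp only [zero_add, inv_one] at h2
    refine h2.congr fun p => ?_
    rw [div_pow]
    have : x ^ p ≠ 0 := by positivity
    have : τ ^ p + x ^ p ≠ 0 := by positivity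
    field_simp
  · intro h
    have h1 : Filter.Tendsto (fun p : ℕ => (x / τ) ^ p) Filter.atTop (nhds 0) :=
      tendsto_pow_atTop_nhds_zero_of_lt_one (by positivity) ((div_lt_one hτ).2 h)
    refine squeeze_zero (fun p => by positivity) (fun p => ?_) h1
    rw [div_pow, ← div_eq_mul_inv]
    exact div_le_div_of_nonneg_left (by positivity) (by positivity)
      (le_add_of_nonneg_right (by positivity))

/-- In the singular basis the p-th term is diagonal with entries xᵖ/(τᵖ + xᵖ), x the squared
singular value; these tend to 1 or 0 on the two sides of τ. The limsup is then a limit. -/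
theorem initProj_eq {r : ℕ} (hr : r ≤ Fintype.card n) {τ : ℝ} (hτ : 0 < τ) {A : Matrix n n ℝ}
    {P : Matrix n (Fin (Fintype.card n)) ℝ} {s : Fin (Fintype.card n) → ℝ}
    {U : Matrix n (Fin r) ℝ} (hP : P.transpose * P = 1)
    (hA : A * A = P * Matrix.diagonal (fun i => s i ^ 2) * P.transpose)
    (hU : ∀ a i, U a i = P a (Fin.castLE hr i))
    (hbig : ∀ i : Fin (Fintype.card n), (i : ℕ) < r → τ < s i ^ 2)
    (hsmall : ∀ i : Fin (Fintype.card n), r ≤ (i : ℕ) → s i ^ 2 < τ) :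
    initProj τ A = U * U.transpose := by
  have hP' : P * P.transpose = 1 := (Matrix.mul_eq_one_comm_of_card_eq _ _ _ (by simp)).1 hP
  have hmul : ∀ f g : Fin (Fintype.card n) → ℝ,
      P * Matrix.diagonal f * P.transpose * (P * Matrix.diagonal g * P.transpose) =
      P * Matrix.diagonal (fun i => f i * g i) * P.transpose := by
    intro f g
    calc P * Matrix.diagonal f * P.transpose * (P * Matrix.diagonal g * P.transpose)
        = P * (Matrix.diagonal f * (P.transpose * P) * Matrix.diagonal g) * P.transpose := by
          simp only [Matrix.mul_assoc]
      _ = _ := by rw [hP, Matrix.mul_one, Matrix.diagonal_mul_diagonal]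
  have hone : P * Matrix.diagonal (fun _ : Fin (Fintype.card n) => (1 : ℝ)) * P.transpose = 1 := by
    rw [Matrix.diagonal_one, Matrix.mul_one, hP']
  have hpow : ∀ p : ℕ, (A * A) ^ p =
      P * Matrix.diagonal (fun i => (s i ^ 2) ^ p) * P.transpose := by
    intro p
    induction p with
    | zero => simp only [pow_zero]; exact hone.symm
    | succ p ih => rw [pow_succ, ih, hA, hmul]; simp only [pow_succ]
  have hadd : ∀ p : ℕ, τ ^ p • (1 : Matrix n n ℝ) + (A * A) ^ p =
      P * Matrix.diagonal (fun i => τ ^ p + (s i ^ 2) ^ p) * P.transpose := by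
    intro p
    rw [hpow, ← hone, ← Matrix.smul_mul, ← Matrix.mul_smul, ← Matrix.add_mul, ← Matrix.mul_add]
    congr 2
    ext i j
    by_cases hij : i = j
    · subst hij; simp
    · simp [hij]
  have hinv : ∀ p : ℕ, (τ ^ p • (1 : Matrix n n ℝ) + (A * A) ^ p)⁻¹ =
      P * Matrix.diagonal (fun i => (τ ^ p + (s i ^ 2) ^ p)⁻¹) * P.transpose := by
    intro p
    refine Matrix.inv_eq_right_inv ?_
    rw [hadd, hmul, ← hone]
    congr 3
    ext i
    exact mul_inv_cancel₀ (by positivity)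
  have hlim : ∀ i, Filter.Tendsto
      (fun p : ℕ => (s i ^ 2) ^ p * (τ ^ p + (s i ^ 2) ^ p)⁻¹) Filter.atTop
      (nhds (if (i : ℕ) < r then 1 else 0)) := by
    intro i
    have := tendsto_pow_div_add_pow hτ (sq_nonneg (s i))
    split_ifs with hi
    · exact this.1 (hbig i hi)
    · exact this.2 (hsmall i (not_lt.1 hi))
  rw [mul_transpose_eq_indicator hr hU]
  ext a b
  rw [initProj, Matrix.of_apply]
  refine Filter.Tendsto.limsup_eq ?_
  have hentry : ∀ f : Fin (Fintype.card n) → ℝ,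
      (P * Matrix.diagonal f * P.transpose) a b = ∑ i, P a i * f i * P b i := by
    intro f
    rw [Matrix.mul_apply]
    simp [Matrix.mul_diagonal]
  simp only [hinv]
  simp only [hpow, hmul, hentry]
  exact tendsto_finsetSum _ fun i _ => ((hlim i).const_mul _).mul_const _

theorem IsRangeData.initProj_eq (h : IsRangeData D Q Dp σ) {r : ℕ} (hr0 : 0 < r)
    (htr : Q.trace = r) {E : Matrix n n ℝ} (hE : E.transpose = E) {U : Matrix n (Fin r) ℝ}
    (hU : IsTopLeftSingular (D + E) U) (hEσ : frob E ≤ σ / 8) :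
    initProj ((σ / 4) ^ 2) (D + E) = U * U.transpose := by
  have hσ := h.pos
  obtain ⟨h1, h2⟩ := h.init hr0 htr hU hEσ
  have hUU := hU.isProj
  have hUp := isProj_mul_transpose hUU
  have hUtr : (U * U.transpose).trace = Q.trace := by
    rw [Matrix.trace_mul_comm, hUU, Matrix.trace_one, htr]; simp
  obtain ⟨hr, P, Q', s, hP, hQ, hs, hs0, hA, hUc⟩ := hU
  have hsymm : (D + E).transpose = D + E := by rw [Matrix.transpose_add, h.symm, hE]
  have hAA := mul_transpose_of_svd hQ hA
  rw [hsymm] at hAA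
  have hcol : ∀ i, frob ((D + E) * Matrix.replicateCol (Fin 1) (P.col i)) = s i := by
    intro i
    refine (sq_eq_sq₀ (frob_nonneg _) (hs0 i)).1 ?_
    rw [frob_sq_eq_trace', Matrix.transpose_mul, hsymm, Matrix.mul_assoc,
      ← Matrix.mul_assoc (D + E), hAA]
    have hPc : P.transpose * Matrix.replicateCol (Fin 1) (P.col i) =
        Matrix.replicateCol (Fin 1) (Pi.single i 1) := by
      rw [← Matrix.replicateCol_mulVec, ← Matrix.mulVec_single_one, Matrix.mulVec_mulVec, hP,
        Matrix.one_mulVec]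
    have hPr : (Matrix.replicateCol (Fin 1) (P.col i)).transpose * P =
        (Matrix.replicateCol (Fin 1) (Pi.single i (1 : ℝ))).transpose := by
      rw [← hPc, Matrix.transpose_mul, Matrix.transpose_transpose]
    rw [Matrix.mul_assoc, hPc, ← Matrix.mul_assoc, ← Matrix.mul_assoc, hPr]
    simp [Matrix.trace, Matrix.mul_apply, Matrix.diagonal_apply, Pi.single_apply]
  have hnorm : ∀ i, frob (Matrix.replicateCol (Fin 1) (P.col i)) = 1 := by
    intro i
    refine (sq_eq_sq₀ (frob_nonneg _) zero_le_one).1 ?_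
    have := congrFun (congrFun hP i) i
    rw [frob_sq]
    simpa [Matrix.mul_apply, sq] using this
  have hfix : ∀ i : Fin (Fintype.card n), U * U.transpose * Matrix.replicateCol (Fin 1) (P.col i) =
      if (i : ℕ) < r then Matrix.replicateCol (Fin 1) (P.col i) else 0 := by
    intro i
    have hc : Matrix.replicateCol (Fin 1) (P.col i) =
        P * Matrix.replicateCol (Fin 1) (Pi.single i (1 : ℝ)) := by
      rw [← Matrix.replicateCol_mulVec, Matrix.mulVec_single_one]
    rw [mul_transpose_eq_indicator hr hUc, hc, Matrix.mul_assoc, ← Matrix.mul_assoc P.transpose, hP,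
      Matrix.one_mul, Matrix.mul_assoc]
    have hd : Matrix.diagonal (fun i : Fin (Fintype.card n) => if (i : ℕ) < r then (1 : ℝ) else 0) *
        Matrix.replicateCol (Fin 1) (Pi.single i (1 : ℝ)) =
        if (i : ℕ) < r then Matrix.replicateCol (Fin 1) (Pi.single i (1 : ℝ)) else 0 := by
      ext a b
      rw [Matrix.diagonal_mul]
      by_cases ha : a = i
      · subst ha
        split_ifs <;> simp
      · split_ifs <;> simp [ha]
    rw [hd]
    split_ifs <;> simp
  -- The first r singular values are at least 3σ/8 and the others at most σ/8; the threshold σ/4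
  -- lies between.
  refine OneBit.initProj_eq hr (by positivity) hP hAA hUc (fun i hi => ?_) fun i hi => ?_
  · have := h.lower_bound hUp hUtr (h2.trans (by norm_num)) hEσ
      (Y := Matrix.replicateCol (Fin 1) (P.col i)) (by rw [hfix, if_pos hi])
    rw [hcol, hnorm] at this
    exact pow_lt_pow_left₀ (by linarith) (by positivity) two_ne_zero
  · have h3 : frob ((D + E) * ((1 - U * U.transpose) * Matrix.replicateCol (Fin 1) (P.col i))) ≤
        σ / 8 := by
      rw [← Matrix.mul_assoc]
      refine (frob_mul_le _ _).trans ?_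
      rw [hnorm, mul_one, ← frob_transpose, Matrix.transpose_mul, hUp.compl.symm, hsymm]
      exact h1.trans hEσ
    rw [Matrix.sub_mul, Matrix.one_mul, hfix, if_neg (not_lt.2 hi), sub_zero, hcol] at h3
    exact pow_lt_pow_left₀ (by linarith) (hs0 i) two_ne_zero

end Formulas

/-! ### The iteration as a deterministic function of the batches -/

section State

variable {m d₁ d₂ : ℕ}

/-- The current estimate together with the projection onto the current subspace. -/
abbrev State (d₁ d₂ : ℕ) : Type :=
  Matrix (Fin d₁) (Fin d₂) ℝ × Matrix (Fin d₁ ⊕ Fin d₂) (Fin d₁ ⊕ Fin d₂) ℝ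

/-- The matrix `M = 𝒟(H) + 𝒟(W)` of one iteration. -/
noncomputable def iterMatrix (Ws W : Matrix (Fin d₁) (Fin d₂) ℝ) (b : Batch m d₁ d₂) :
    Matrix (Fin d₁ ⊕ Fin d₂) (Fin d₁ ⊕ Fin d₂) ℝ :=
  dilation (correction b (labels b Ws) W) + dilation W

/-- One step of the iteration in terms of projections. -/
noncomputable def nextState (Ws : Matrix (Fin d₁) (Fin d₂) ℝ) (S : State d₁ d₂)
    (b : Batch m d₁ d₂) : State d₁ d₂ :=
  (colNormalize (nextProj (iterMatrix Ws S.1 b) S.2 * iterMatrix Ws S.1 b).toBlocks₁₂,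
    nextProj (iterMatrix Ws S.1 b) S.2)

/-- The sequence of states of the iteration. -/
noncomputable def stateSeq (Ws : Matrix (Fin d₁) (Fin d₂) ℝ) (τ : ℝ) (bs : ℕ → Batch m d₁ d₂) :
    ℕ → State d₁ d₂
  | 0 => (0, initProj τ (dilation (correction (bs 0) (labels (bs 0) Ws) 0)))
  | t + 1 => nextState Ws (stateSeq Ws τ bs t) (bs t)

theorem stateSeq_unit_or_zero (Ws : Matrix (Fin d₁) (Fin d₂) ℝ) (τ : ℝ) (bs : ℕ → Batch m d₁ d₂)
    (t : ℕ) (j : Fin d₂) : (stateSeq Ws τ bs t).1.col j ⬝ᵥ (stateSeq Ws τ bs t).1.col j = 1 ∨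
      (stateSeq Ws τ bs t).1.col j = 0 := by
  cases t with
  | zero => right; ext i; simp [stateSeq]
  | succ t =>
    rcases colNormalize_col (nextProj (iterMatrix Ws (stateSeq Ws τ bs t).1 (bs t))
      (stateSeq Ws τ bs t).2 * iterMatrix Ws (stateSeq Ws τ bs t).1 (bs t)).toBlocks₁₂ j with h | h
    · left
      simp only [dotProduct, ← sq]
      exact h
    · right
      ext i
      exact h i

variable {k T : ℕ} {Ws : Matrix (Fin d₁) (Fin d₂) ℝ}
  {Q Dp : Matrix (Fin d₁ ⊕ Fin d₂) (Fin d₁ ⊕ Fin d₂) ℝ} {σ : ℝ} {bs : ℕ → Batch m d₁ d₂}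
  {U V : ℕ → Matrix (Fin d₁ ⊕ Fin d₂) (Fin (2 * k)) ℝ}

/-- What is known about a run after `t` steps. -/
structure Tracks (Q : Matrix (Fin d₁ ⊕ Fin d₂) (Fin d₁ ⊕ Fin d₂) ℝ) (S : State d₁ d₂)
    (U V : Matrix (Fin d₁ ⊕ Fin d₂) (Fin (2 * k)) ℝ) : Prop where
  orthonormal : U.transpose * U = 1
  estimate_eq : estimate U V = S.1
  proj_eq : U * U.transpose = S.2
  close : frob ((1 - S.2) * Q) ≤ 1 / 2

/-- Turns the perturbation bound into an error of the estimate. The outer factor 2 is the price of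
column normalization. -/
theorem tracks_step (h : IsRangeData (dilation Ws) Q Dp σ) (htr : Q.trace = (2 * k : ℕ))
    (hWs : ∀ j, ∑ i, Ws i j ^ 2 = 1) {S : State d₁ d₂} {b : Batch m d₁ d₂}
    {U V U' V' : Matrix (Fin d₁ ⊕ Fin d₂) (Fin (2 * k)) ℝ} (hS : Tracks Q S U V)
    (hgood : frob (dilation (noise Ws S.1 b)) ≤ σ / 8)
    (hU' : IsQRFactor (iterMatrix Ws S.1 b * U) U') (hV' : V' = iterMatrix Ws S.1 b * U') :
    Tracks Q (nextState Ws S b) U' V' ∧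
      specNorm (Ws - (nextState Ws S b).1) ≤
        2 * (2 * frob (dilation (noise Ws S.1 b) * S.2) + frob (dilation (noise Ws S.1 b) * Q)) := by
  have hσ := h.pos
  obtain ⟨hUU, hest, hproj, hclose⟩ := hS
  obtain ⟨hUU', R, -, hR⟩ := hU'
  have hM : iterMatrix Ws S.1 b = dilation Ws + dilation (noise Ws S.1 b) :=
    dilation_correction_add Ws S.1 b
  have hMs : (iterMatrix Ws S.1 b).transpose = iterMatrix Ws S.1 b := by
    rw [hM, Matrix.transpose_add, dilation_transpose, dilation_transpose]
  have hP : IsProj S.2 := hproj ▸ isProj_mul_transpose hUU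
  have hP' := isProj_mul_transpose hUU'
  have htrace : ∀ {U : Matrix (Fin d₁ ⊕ Fin d₂) (Fin (2 * k)) ℝ}, U.transpose * U = 1 →
      (U * U.transpose).trace = Q.trace := by
    intro U hU
    rw [Matrix.trace_mul_comm, hU, Matrix.trace_one, htr]; simp
  have htrP : S.2.trace = Q.trace := hproj ▸ htrace hUU
  have hnext : nextProj (iterMatrix Ws S.1 b) S.2 = U' * U'.transpose := by
    rw [← hproj]
    refine nextProj_eq hMs hUU hUU' hR fun K hK => ?_
    have hPU : S.2 * (U * K) = U * K := by
      rw [← hproj, ← Matrix.mul_assoc, Matrix.mul_assoc U, hUU, Matrix.mul_one]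
    have h1 := h.lower_bound hP htrP hclose hgood hPU
    rw [← hM, hK, show frob (0 : Matrix (Fin d₁ ⊕ Fin d₂) (Fin 1) ℝ) = 0 by simp [frob],
      frob_isometry_mul hUU] at h1
    refine frob_eq_zero (le_antisymm ?_ (frob_nonneg K))
    by_contra! hc
    nlinarith [mul_pos hσ hc]
  have hzero : (1 - U' * U'.transpose) *
      ((dilation Ws + dilation (noise Ws S.1 b)) * S.2) = 0 := by
    rw [← hM, ← hproj, ← Matrix.mul_assoc (iterMatrix Ws S.1 b), hR, ← Matrix.mul_assoc,
      ← Matrix.mul_assoc, Matrix.sub_mul, Matrix.one_mul, Matrix.mul_assoc U', hUU', Matrix.mul_one,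
      sub_self, Matrix.zero_mul, Matrix.zero_mul]
  obtain ⟨hc, herr⟩ := h.step hP hP' (htrace hUU') (dilation_transpose _) hzero hclose hgood
  have hest' : U' * V'.transpose = U' * U'.transpose * iterMatrix Ws S.1 b := by
    rw [hV', Matrix.transpose_mul, hMs, Matrix.mul_assoc]
  refine ⟨⟨hUU', ?_, hnext.symm, ?_⟩, ?_⟩
  · rw [estimate, hest', nextState, hnext]
  · simp only [nextState, hnext]
    exact hc
  · refine (specNorm_le_frob _).trans ?_
    simp only [nextState, hnext]
    refine (frob_sub_estimate_le hWs _).trans (mul_le_mul_of_nonneg_left ?_ zero_le_two)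
    rw [hM]
    exact herr

theorem tracks_init (h : IsRangeData (dilation Ws) Q Dp σ) (htr : Q.trace = (2 * k : ℕ))
    (hk : 1 ≤ k) {b : Batch m d₁ d₂} {U : Matrix (Fin d₁ ⊕ Fin d₂) (Fin (2 * k)) ℝ}
    (hU : IsTopLeftSingular (dilation (correction b (labels b Ws) 0)) U)
    (hgood : frob (dilation (noise Ws 0 b)) ≤ σ / 8) :
    Tracks Q ((0, initProj ((σ / 4) ^ 2) (dilation (correction b (labels b Ws) 0))) : State d₁ d₂)
      U 0 := by
  have hM : dilation (correction b (labels b Ws) 0) = dilation Ws + dilation (noise Ws 0 b) := by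
    rw [← dilation_correction_add]
    simp [dilation]
  have hUU := hU.isProj
  rw [hM] at hU ⊢
  have hinit := h.initProj_eq (by omega) htr (dilation_transpose _) hU hgood
  refine ⟨hUU, estimate_zero_right _, hinit.symm, ?_⟩
  simp only [hinit]
  exact ((h.init (by omega) htr hU hgood).2).trans (by norm_num)

theorem tracks_of_isRun (h : IsRangeData (dilation Ws) Q Dp σ) (htr : Q.trace = (2 * k : ℕ))
    (hk : 1 ≤ k) (hWs : ∀ j, ∑ i, Ws i j ^ 2 = 1) (hT : 0 < T)
    (hrun : IsRun k T bs (fun t => labels (bs t) Ws) U V)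
    (hgood : ∀ t < T, frob (dilation (noise Ws (stateSeq Ws ((σ / 4) ^ 2) bs t).1 (bs t))) ≤ σ / 8) :
    ∀ t ≤ T, Tracks Q (stateSeq Ws ((σ / 4) ^ 2) bs t) (U t) (V t) := by
  intro t
  induction t with
  | zero =>
    intro _
    rw [hrun.init_V]
    exact tracks_init h htr hk hrun.init_U (hgood 0 hT)
  | succ t ih =>
    intro ht
    have hS := ih (by omega)
    have hstep := hrun.step_U t (by omega)
    have hstepV := hrun.step_V t (by omega)
    rw [hS.estimate_eq] at hstep hstepV
    exact (tracks_step h htr hWs hS (hgood t (by omega)) hstep hstepV).1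

theorem specNorm_sub_estimate_le (h : IsRangeData (dilation Ws) Q Dp σ)
    (htr : Q.trace = (2 * k : ℕ)) (hk : 1 ≤ k) (hWs : ∀ j, ∑ i, Ws i j ^ 2 = 1)
    (hrun : IsRun k T bs (fun t => labels (bs t) Ws) U V)
    (hgood : ∀ t < T, frob (dilation (noise Ws (stateSeq Ws ((σ / 4) ^ 2) bs t).1 (bs t))) ≤ σ / 8)
    {t : ℕ} (ht : t < T) :
    specNorm (Ws - estimate (U (t + 1)) (V (t + 1))) ≤
      2 * (2 * frob (dilation (noise Ws (stateSeq Ws ((σ / 4) ^ 2) bs t).1 (bs t)) *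
          (stateSeq Ws ((σ / 4) ^ 2) bs t).2) +
        frob (dilation (noise Ws (stateSeq Ws ((σ / 4) ^ 2) bs t).1 (bs t)) * Q)) := by
  have hT : 0 < T := by omega
  have hS := tracks_of_isRun h htr hk hWs hT hrun hgood t ht.le
  have hstep := hrun.step_U t ht
  have hstepV := hrun.step_V t ht
  rw [hS.estimate_eq] at hstep hstepV
  rw [(tracks_of_isRun h htr hk hWs hT hrun hgood (t + 1) ht).estimate_eq]
  exact (tracks_step h htr hWs hS (hgood t ht) hstep hstepV).2

end State

/-! ### Measurability -/

section Measurability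

instance {m n : Type*} : MeasurableSpace (Matrix m n ℝ) :=
  inferInstanceAs (MeasurableSpace (m → n → ℝ))

instance {m n : Type*} [Countable m] [Countable n] : BorelSpace (Matrix m n ℝ) :=
  inferInstanceAs (BorelSpace (m → n → ℝ))

variable {Ω : Type*} [MeasurableSpace Ω]

theorem measurable_matrix_iff {m n : Type*} {A : Ω → Matrix m n ℝ} :
    Measurable A ↔ ∀ i j, Measurable fun ω => A ω i j := by
  constructor
  · intro h i j
    exact (measurable_pi_apply j).comp ((measurable_pi_apply i).comp h)
  · intro h
    exact measurable_pi_lambda _ fun i => measurable_pi_lambda _ fun j => h i j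

section

variable {l m n : Type*} [Fintype l] [Fintype m] [Fintype n]

theorem measurable_matrix_mul {A : Ω → Matrix l m ℝ} {B : Ω → Matrix m n ℝ} (hA : Measurable A)
    (hB : Measurable B) : Measurable fun ω => A ω * B ω := by
  refine measurable_matrix_iff.2 fun i j => ?_
  simp only [Matrix.mul_apply]
  exact Finset.measurable_sum _ fun q _ =>
    (measurable_matrix_iff.1 hA i q).mul (measurable_matrix_iff.1 hB q j)

theorem measurable_matrix_add {A B : Ω → Matrix m n ℝ} (hA : Measurable A) (hB : Measurable B) :
    Measurable fun ω => A ω + B ω :=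
  measurable_matrix_iff.2 fun i j =>
    (measurable_matrix_iff.1 hA i j).add (measurable_matrix_iff.1 hB i j)

theorem measurable_matrix_sub {A B : Ω → Matrix m n ℝ} (hA : Measurable A) (hB : Measurable B) :
    Measurable fun ω => A ω - B ω :=
  measurable_matrix_iff.2 fun i j =>
    (measurable_matrix_iff.1 hA i j).sub (measurable_matrix_iff.1 hB i j)

theorem measurable_matrix_pow [DecidableEq n] {A : Ω → Matrix n n ℝ} (hA : Measurable A) (p : ℕ) :
    Measurable fun ω => A ω ^ p := by
  induction p with
  | zero => simp only [pow_zero]; exact measurable_const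
  | succ p ih => simp only [pow_succ]; exact measurable_matrix_mul ih hA

theorem measurable_matrix_inv [DecidableEq n] {A : Ω → Matrix n n ℝ} (hA : Measurable A) :
    Measurable fun ω => (A ω)⁻¹ := by
  have hdet : Measurable fun A : Matrix n n ℝ => A.det := continuous_id.matrix_det.measurable
  have hadj : Measurable fun A : Matrix n n ℝ => A.adjugate :=
    continuous_id.matrix_adjugate.measurable
  refine measurable_matrix_iff.2 fun i j => ?_
  simp only [Matrix.inv_def, Ring.inverse_eq_inv', Matrix.smul_apply, smul_eq_mul]
  exact (hdet.comp hA).inv.mul (measurable_matrix_iff.1 (hadj.comp hA) i j)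

theorem measurable_frob {A : Ω → Matrix m n ℝ} (hA : Measurable A) :
    Measurable fun ω => frob (A ω) :=
  (Finset.measurable_sum _ fun i _ => Finset.measurable_sum _ fun j _ =>
    (measurable_matrix_iff.1 hA i j).pow_const 2).sqrt

end

variable {m d₁ d₂ : ℕ}

theorem measurable_dilation {A : Ω → Matrix (Fin d₁) (Fin d₂) ℝ} (hA : Measurable A) :
    Measurable fun ω => dilation (A ω) := by
  refine measurable_matrix_iff.2 fun i j => ?_
  rcases i with i | i <;> rcases j with j | j
  · simp [dilation]
  · exact measurable_matrix_iff.1 hA i j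
  · exact measurable_matrix_iff.1 hA j i
  · simp [dilation]

theorem measurable_specNorm {A : Ω → Matrix (Fin d₁) (Fin d₂) ℝ} (hA : Measurable A) :
    Measurable fun ω => specNorm (A ω) := by
  have h : Continuous fun M : Matrix (Fin d₁) (Fin d₂) ℝ => specNorm M :=
    continuous_norm.comp (LinearMap.continuous_of_finiteDimensional
      ((LinearMap.toContinuousLinearMap (𝕜 := ℝ) (E := EuclideanSpace ℝ (Fin d₂))
        (F' := EuclideanSpace ℝ (Fin d₁))).toLinearMap.comp
        (Matrix.toEuclideanLin (𝕜 := ℝ) (m := Fin d₁) (n := Fin d₂)).toLinearMap))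
  exact h.measurable.comp hA

theorem measurable_labels {b : Ω → Batch m d₁ d₂} (hb : Measurable b)
    {W : Ω → Matrix (Fin d₁) (Fin d₂) ℝ} (hW : Measurable W) (i : Fin m) :
    Measurable fun ω => labels (b ω) (W ω) i := by
  refine measurable_sgn.comp ?_
  have hbi : Measurable fun ω => b ω i := (measurable_pi_apply i).comp hb
  simp only [sensing, dotProduct, Matrix.mulVec]
  refine Finset.measurable_sum _ fun l _ => Measurable.mul ?_ ?_
  · exact (measurable_pi_apply l).comp hbi.fst
  · refine Finset.measurable_sum _ fun j _ => (measurable_matrix_iff.1 hW l j).mul ?_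
    exact (Measurable.of_discrete (f := fun q : Fin d₂ => oneHot q j)).comp hbi.snd

theorem measurable_correction {b : Ω → Batch m d₁ d₂} (hb : Measurable b)
    {W Ws : Ω → Matrix (Fin d₁) (Fin d₂) ℝ} (hWs : Measurable Ws) (hW : Measurable W) :
    Measurable fun ω => correction (b ω) (labels (b ω) (Ws ω)) (W ω) := by
  refine measurable_matrix_iff.2 fun l j => ?_
  simp only [correction, sensingAdj, Matrix.smul_apply, Matrix.sum_apply, smul_eq_mul,
    Matrix.vecMulVec_apply, Pi.sub_apply]
  refine (Finset.measurable_sum _ fun i _ => ?_).const_mul _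
  have hbi : Measurable fun ω => b ω i := (measurable_pi_apply i).comp hb
  refine ((measurable_labels hb hWs i).sub (measurable_labels hb hW i)).mul (Measurable.mul ?_ ?_)
  · exact (measurable_pi_apply l).comp hbi.fst
  · exact (Measurable.of_discrete (f := fun q : Fin d₂ => oneHot q j)).comp hbi.snd

theorem measurable_noise (Ws : Matrix (Fin d₁) (Fin d₂) ℝ) {b : Ω → Batch m d₁ d₂}
    (hb : Measurable b) {W : Ω → Matrix (Fin d₁) (Fin d₂) ℝ} (hW : Measurable W) :
    Measurable fun ω => noise Ws (W ω) (b ω) :=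
  measurable_matrix_sub (measurable_correction hb measurable_const hW)
    (measurable_matrix_sub measurable_const hW)

theorem measurable_colNormalize {A : Ω → Matrix (Fin d₁) (Fin d₂) ℝ} (hA : Measurable A) :
    Measurable fun ω => colNormalize (A ω) := by
  refine measurable_matrix_iff.2 fun i j => ?_
  simp only [colNormalize, Matrix.of_apply]
  exact (measurable_matrix_iff.1 hA i j).div (Finset.measurable_sum _ fun l _ =>
    (measurable_matrix_iff.1 hA l j).pow_const 2).sqrt

theorem measurable_nextState (Ws : Matrix (Fin d₁) (Fin d₂) ℝ) {S : Ω → State d₁ d₂}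
    (hS : Measurable S) {b : Ω → Batch m d₁ d₂} (hb : Measurable b) :
    Measurable fun ω => nextState Ws (S ω) (b ω) := by
  have hM : Measurable fun ω => iterMatrix Ws (S ω).1 (b ω) :=
    measurable_matrix_add (measurable_dilation (measurable_correction hb measurable_const hS.fst))
      (measurable_dilation hS.fst)
  have hP : Measurable fun ω => nextProj (iterMatrix Ws (S ω).1 (b ω)) (S ω).2 := by
    unfold nextProj
    refine measurable_matrix_mul (measurable_matrix_mul (measurable_matrix_mul
      (measurable_matrix_mul hM hS.snd) (measurable_matrix_inv ?_)) hS.snd) hM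
    exact measurable_matrix_add (measurable_matrix_mul (measurable_matrix_mul
      (measurable_matrix_mul hS.snd hM) hM) hS.snd) (measurable_matrix_sub measurable_const hS.snd)
  refine Measurable.prodMk (measurable_colNormalize ?_) hP
  exact measurable_matrix_iff.2 fun i j => measurable_matrix_iff.1 (measurable_matrix_mul hP hM) _ _

theorem measurable_initProj (τ : ℝ) {n : Type} [Fintype n] [DecidableEq n] {A : Ω → Matrix n n ℝ}
    (hA : Measurable A) : Measurable fun ω => initProj τ (A ω) := by
  refine measurable_matrix_iff.2 fun i j => ?_
  simp only [initProj, Matrix.of_apply]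
  refine Measurable.limsup fun p => ?_
  have hp := measurable_matrix_pow (measurable_matrix_mul hA hA) p
  exact measurable_matrix_iff.1 (measurable_matrix_mul hp (measurable_matrix_inv
    (measurable_matrix_add measurable_const hp))) i j

/-- The condition t ≥ 1 is needed because the initial projection already uses batch 0. -/
theorem measurable_stateSeq (Ws : Matrix (Fin d₁) (Fin d₂) ℝ) (τ : ℝ) {bs : Ω → ℕ → Batch m d₁ d₂}
    {t : ℕ} (ht : 1 ≤ t) (hb : ∀ s < t, Measurable fun ω => bs ω s) :
    Measurable fun ω => stateSeq Ws τ (bs ω) t := by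
  have h0 : Measurable fun ω => stateSeq Ws τ (bs ω) 0 :=
    measurable_const.prodMk (measurable_initProj τ (measurable_dilation
      (measurable_correction (hb 0 (by omega)) measurable_const measurable_const)))
  have : ∀ s ≤ t, Measurable fun ω => stateSeq Ws τ (bs ω) s := by
    intro s
    induction s with
    | zero => exact fun _ => h0
    | succ s ih => exact fun hs => measurable_nextState Ws (ih (by omega)) (hb s (by omega))
  exact this t le_rfl

end Measurability

/-! ### Error recursions -/

section Recursion

theorem twoPhase_of_recursion {T : ℕ} {δ nrm : ℝ} {err : ℕ → ℝ} (hδ : 0 < δ)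
    (herr : ∀ t, 0 ≤ err t) (h1 : 0 < T → err 1 ≤ nrm)
    (hstep : ∀ t, 1 ≤ t → t < T → err (t + 1) ≤ δ * Real.sqrt (err t)) :
    TwoPhase T δ nrm err := by
  classical
  -- The value T + 1 qualifies vacuously, which encodes a threshold never reached within T
  -- iterations.
  have hex : ∃ s, 0 < s ∧ (s ≤ T → err s ≤ 1) := ⟨T + 1, by omega, fun h => by omega⟩
  obtain ⟨hpos, hle⟩ := Nat.find_spec hex
  have hmin : ∀ s, 0 < s → s < Nat.find hex → s ≤ T → 1 < err s := by
    intro s hs hlt _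
    have := Nat.find_min hex hlt
    push Not at this
    exact (this hs).2
  generalize Nat.find hex = t₀ at *
  refine ⟨t₀, hpos, hmin, hle, ?_, ?_⟩
  · intro t
    induction t with
    | zero => intro hT _; simpa using h1 hT
    | succ t ih =>
      intro hT ht
      have hgt := hmin (t + 1) (by omega) ht hT.le
      -- Before the threshold the error exceeds 1, so the recursion is at least linear contraction
      -- by δ.
      have hsq : Real.sqrt (err (t + 1)) ≤ err (t + 1) := by
        rw [Real.sqrt_le_left (by linarith)]
        nlinarith
      calc err (t + 1 + 1) ≤ δ * Real.sqrt (err (t + 1)) := hstep _ (by omega) hT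
        _ ≤ δ * (δ ^ t * nrm) :=
          mul_le_mul_of_nonneg_left (hsq.trans (ih (by omega) (by omega))) hδ.le
        _ = δ ^ (t + 1) * nrm := by ring
  · intro t hT ht
    induction t, ht using Nat.le_induction with
    | base =>
      refine (hstep t₀ hpos hT).trans_eq ?_
      rw [sub_self, Real.rpow_zero, show (t₀ : ℝ) - 1 - t₀ = -1 by ring, Real.rpow_neg_one,
        Real.sqrt_eq_rpow, show (2 : ℝ) - 1 = 1 by norm_num, Real.rpow_one]
      norm_num
    | succ t ht ih =>
      refine (hstep _ (by omega) hT).trans ?_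
      have hx := herr t₀
      refine (mul_le_mul_of_nonneg_left (Real.sqrt_le_sqrt (ih (by omega))) hδ.le).trans_eq ?_
      rw [Real.sqrt_mul (by positivity), Real.sqrt_eq_rpow, Real.sqrt_eq_rpow, ← Real.rpow_mul hδ.le,
        ← Real.rpow_mul hx, ← mul_assoc]
      nth_rewrite 1 [← Real.rpow_one δ]
      rw [← Real.rpow_add hδ]
      have hhalf : ∀ a : ℝ, (2 : ℝ) ^ (a - 1) = 2 ^ a * (1 / 2) := by
        intro a
        rw [Real.rpow_sub_one (by norm_num)]
        ring
      rw [show (t₀ : ℝ) - ((t + 1 : ℕ) : ℝ) = t₀ - t - 1 by push_cast; ring,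
        show (t₀ : ℝ) - 1 - ((t + 1 : ℕ) : ℝ) = t₀ - 1 - t - 1 by push_cast; ring, hhalf, hhalf]
      congr 2
      ring

theorem final_error_le {T d : ℕ} {ε nrm : ℝ} {err : ℕ → ℝ} (hε : 0 < ε) (hε1 : ε ≤ 1)
    (hd : 1 ≤ d) (hnrm : nrm ≤ d) (hnrm0 : 0 ≤ nrm)
    (hT : Real.logb 2 d + Real.logb 2 (1 + Real.logb 2 (1 / ε)) + 3 ≤ T) (h1 : err 1 ≤ nrm)
    (hstep : ∀ t, 1 ≤ t → t < T → err (t + 1) ≤ Real.sqrt ε / 2 * Real.sqrt (err t)) :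
    err T ≤ ε := by
  have hd' : (1 : ℝ) ≤ d := by exact_mod_cast hd
  set L := Real.logb 2 (1 / ε) with hL
  have hL0 : 0 ≤ L := Real.logb_nonneg (by norm_num) (by rw [le_div_iff₀ hε]; linarith)
  have hlog : 0 ≤ Real.logb 2 d := Real.logb_nonneg (by norm_num) hd'
  have hlog2 : 0 ≤ Real.logb 2 (1 + L) := Real.logb_nonneg (by norm_num) (by linarith)
  have hT1 : 1 ≤ T := by
    have : (1 : ℝ) ≤ T := by linarith
    exact_mod_cast this
  -- The summand 3 in the bound on T supplies the factor 8.
  have hpow : 8 * d * (1 + L) ≤ (2 : ℝ) ^ T := by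
    have h := Real.rpow_le_rpow_of_exponent_le (x := 2) (by norm_num) hT
    rw [Real.rpow_add (by norm_num), Real.rpow_add (by norm_num),
      Real.rpow_logb (by norm_num) (by norm_num) (by linarith),
      Real.rpow_logb (by norm_num) (by norm_num) (by linarith), Real.rpow_natCast] at h
    norm_num at h
    linarith
  -- The initial error in units of the fixed point ε/4 of x ↦ (√ε/2)√x; in these units each step is
  -- a plain square root.
  set R : ℝ := nrm / (ε / 4) with hR
  have hR0 : 0 ≤ R := by positivity
  have key : ∀ t, t < T → err (t + 1) ≤ ε / 4 * R ^ ((1 / 2 : ℝ) ^ t) := by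
    intro t
    induction t with
    | zero =>
      intro _
      rw [pow_zero, Real.rpow_one, hR, mul_div_cancel₀ _ (by positivity)]
      exact h1
    | succ t ih =>
      intro ht
      refine (hstep (t + 1) (by omega) ht).trans ?_
      refine (mul_le_mul_of_nonneg_left (Real.sqrt_le_sqrt (ih (by omega))) (by positivity)).trans_eq ?_
      have h4 : Real.sqrt (ε / 4) = Real.sqrt ε / 2 := by
        rw [Real.sqrt_div hε.le, show (4 : ℝ) = 2 ^ 2 by norm_num, Real.sqrt_sq (by norm_num)]
      rw [Real.sqrt_mul (by positivity), h4, Real.sqrt_eq_rpow (R ^ _), ← Real.rpow_mul hR0,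
        pow_succ, ← mul_assoc]
      congr 1
      nlinarith [Real.sq_sqrt hε.le]
  have hfin := key (T - 1) (by omega)
  rw [Nat.sub_add_cancel hT1] at hfin
  refine hfin.trans ?_
  have hR2 : R ≤ 2 ^ ((2 : ℝ) ^ T) := by
    have hdp : (d : ℝ) ≤ 2 ^ (d : ℝ) := by
      rw [Real.rpow_natCast]
      exact_mod_cast (Nat.lt_two_pow_self (n := d)).le
    have hLp : (2 : ℝ) ^ L = 1 / ε :=
      Real.rpow_logb (by norm_num) (by norm_num) (by positivity)
    calc R = nrm * (4 * (1 / ε)) := by rw [hR]; field_simp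
      _ ≤ 2 ^ (d : ℝ) * (4 * (1 / ε)) :=
        mul_le_mul_of_nonneg_right (hnrm.trans hdp) (by positivity)
      _ = 2 ^ ((d : ℝ) + (2 + L)) := by
        rw [Real.rpow_add (by norm_num), Real.rpow_add (by norm_num) 2 L, hLp]
        norm_num
      _ ≤ 2 ^ ((2 : ℝ) ^ T) := by
        refine Real.rpow_le_rpow_of_exponent_le (by norm_num) (le_trans ?_ hpow)
        nlinarith [mul_nonneg (by linarith : (0 : ℝ) ≤ d) hL0, mul_nonneg (by linarith : (0 : ℝ) ≤ d - 1) hL0]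
  -- Only T - 1 square roots are taken after the first step, so the exponent 2^T is reduced to 2.
  have hR4 : R ^ ((1 / 2 : ℝ) ^ (T - 1)) ≤ 4 := by
    refine (Real.rpow_le_rpow hR0 hR2 (by positivity)).trans_eq ?_
    rw [← Real.rpow_mul (by norm_num)]
    obtain ⟨q, rfl⟩ : ∃ q, T = q + 1 := ⟨T - 1, by omega⟩
    have : (2 : ℝ) ^ (q + 1) * (1 / 2) ^ (q + 1 - 1) = 2 := by
      rw [Nat.add_sub_cancel, pow_succ, mul_right_comm, ← mul_pow]
      norm_num
    rw [this]
    norm_num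
  nlinarith

end Recursion

/-! ### Tail bounds and independence -/

section Tail

variable {Ω : Type*} [MeasurableSpace Ω] {P : Measure Ω} [IsProbabilityMeasure P]

/-- Fubini: a bound valid for every frozen state extends to a random state independent of the batch.
-/
theorem measure_mem_le_of_indepFun {S B : Type*} [MeasurableSpace S] [MeasurableSpace B]
    {X : Ω → S} {Y : Ω → B} (hX : Measurable X) (hY : Measurable Y) (h : IndepFun X Y P)
    {bad : Set (S × B)} (hbad : MeasurableSet bad) {θ : ENNReal}
    (hθ : ∀ ω, P {ω' | (X ω, Y ω') ∈ bad} ≤ θ) : P {ω | (X ω, Y ω) ∈ bad} ≤ θ := by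
  have := Measure.isProbabilityMeasure_map (μ := P) hY.aemeasurable
  have h1 : P {ω | (X ω, Y ω) ∈ bad} = P.map (fun ω => (X ω, Y ω)) bad := by
    rw [Measure.map_apply (hX.prodMk hY) hbad]
    rfl
  rw [h1, (indepFun_iff_map_prod_eq_prod_map_map hX.aemeasurable hY.aemeasurable).1 h,
    Measure.prod_apply hbad, lintegral_map (measurable_measure_prodMk_left hbad) hX]
  calc _ ≤ ∫⁻ _, θ ∂P := by
        refine lintegral_mono fun ω => ?_
        rw [Measure.map_apply hY (measurable_prodMk_left hbad)]
        exact hθ ω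
    _ = θ := by simp

theorem measure_lt_le_of_integral_le {X : Ω → ℝ} (hX : Integrable X P) (h0 : ∀ ω, 0 ≤ X ω)
    {a θ : ℝ} (ha : 0 ≤ a) (h : ∫ ω, X ω ∂P ≤ θ * a) :
    P {ω | a < X ω} ≤ ENNReal.ofReal θ := by
  -- A zero threshold occurs when the current error vanishes. Then X is almost surely 0 and the
  -- strict inequality fails almost surely.
  rcases ha.eq_or_lt with rfl | ha
  · have hz : ∫ ω, X ω ∂P = 0 := le_antisymm (by simpa using h) (integral_nonneg h0)
    have hae := (integral_eq_zero_iff_of_nonneg h0 hX).1 hz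
    have : P {ω | 0 < X ω} = 0 := by
      refine measure_mono_null (fun ω hω => ?_) (ae_iff.1 hae)
      exact (show 0 < X ω from hω).ne'
    simp [this]
  · have hm := mul_meas_ge_le_integral_of_nonneg (Filter.Eventually.of_forall h0) hX a
    have hr : P.real {ω | a < X ω} ≤ θ := by
      have hsub : P.real {ω | a < X ω} ≤ P.real {ω | a ≤ X ω} :=
        measureReal_mono (fun ω hω => le_of_lt (show a < X ω from hω))
      refine hsub.trans (le_of_mul_le_mul_left (hm.trans (h.trans_eq (mul_comm _ _))) ha)
    rw [← ENNReal.ofReal_toReal (measure_ne_top P {ω | a < X ω})]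
    exact ENNReal.ofReal_le_ofReal hr

variable {m d₁ d₂ : ℕ} {Z : ℕ × Fin m → Ω → (Fin d₁ → ℝ) × Fin d₂}

theorem measurable_stream (hZ : ∀ q, Measurable (Z q)) (t : ℕ) :
    Measurable fun ω => stream Z ω t :=
  measurable_pi_lambda _ fun i => hZ (t, i)

/-- State t is measurable for the σ-algebra of batches before t, whose index set is disjoint from
that of batch t. -/
theorem indepFun_stateSeq_stream (hZ : ∀ q, Measurable (Z q)) (hind : iIndepFun Z P)
    (Ws : Matrix (Fin d₁) (Fin d₂) ℝ) (τ : ℝ) {t : ℕ} (ht : 1 ≤ t) :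
    IndepFun (fun ω => stateSeq Ws τ (stream Z ω) t) (fun ω => stream Z ω t) P := by
  have hdisj : Disjoint {q : ℕ × Fin m | q.1 < t} {q | q.1 = t} :=
    Set.disjoint_left.2 fun q h1 h2 => by simp only [Set.mem_ofPred_eq] at h1 h2; omega
  have h := indep_iSup_of_disjoint (fun q => (hZ q).comap_le) hind hdisj
  rw [IndepFun_iff_Indep]
  refine indep_of_indep_of_le_left (indep_of_indep_of_le_right h ?_) ?_
  · rw [← measurable_iff_comap_le]
    refine @measurable_pi_lambda _ _ _ (_) (_) _ fun i => ?_
    exact (comap_measurable (Z (t, i))).mono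
      (le_iSup₂_of_le (f := fun q (_ : q ∈ {q : ℕ × Fin m | q.1 = t}) =>
        MeasurableSpace.comap (Z q) inferInstance) (t, i) rfl le_rfl) le_rfl
  · rw [← measurable_iff_comap_le]
    refine @measurable_stateSeq Ω (_) _ _ _ Ws τ _ t ht fun s hs => ?_
    refine @measurable_pi_lambda _ _ _ (_) (_) _ fun i => ?_
    exact (comap_measurable (Z (s, i))).mono
      (le_iSup₂_of_le (f := fun q (_ : q ∈ {q : ℕ × Fin m | q.1 < t}) =>
        MeasurableSpace.comap (Z q) inferInstance) (s, i) hs le_rfl) le_rfl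

end Tail

/-! ### The good event -/

section GoodEvent

variable {m d₁ d₂ : ℕ}

/-- The pairs of a state and a batch for which the noise violates one of the bounds needed for
one step of the iteration. -/
def badSet (Ws : Matrix (Fin d₁) (Fin d₂) ℝ) (Q : Matrix (Fin d₁ ⊕ Fin d₂) (Fin d₁ ⊕ Fin d₂) ℝ)
    (k : ℕ) (σ δ : ℝ) : Set (State d₁ d₂ × Batch m d₁ d₂) :=
  {p | σ ^ 2 / 128 < frob (noise Ws p.1.1 p.2) ^ 2} ∪
    ({p | δ ^ 2 / 36 / (2 * k) * specNorm (Ws - p.1.1) * frob p.1.2 ^ 2 <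
        frob (dilation (noise Ws p.1.1 p.2) * p.1.2) ^ 2} ∪
      {p | δ ^ 2 / 36 * specNorm (Ws - p.1.1) < frob (dilation (noise Ws p.1.1 p.2) * Q) ^ 2})

theorem measurableSet_badSet (Ws : Matrix (Fin d₁) (Fin d₂) ℝ)
    (Q : Matrix (Fin d₁ ⊕ Fin d₂) (Fin d₁ ⊕ Fin d₂) ℝ) (k : ℕ) (σ δ : ℝ) :
    MeasurableSet (badSet Ws Q k σ δ : Set (State d₁ d₂ × Batch m d₁ d₂)) := by
  have hN : Measurable fun p : State d₁ d₂ × Batch m d₁ d₂ => noise Ws p.1.1 p.2 :=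
    measurable_noise Ws measurable_snd measurable_fst.fst
  have hP : Measurable fun p : State d₁ d₂ × Batch m d₁ d₂ => p.1.2 := measurable_fst.snd
  have he : Measurable fun p : State d₁ d₂ × Batch m d₁ d₂ => specNorm (Ws - p.1.1) :=
    measurable_specNorm (measurable_matrix_sub measurable_const measurable_fst.fst)
  refine (measurableSet_lt measurable_const ((measurable_frob hN).pow_const 2)).union
    ((measurableSet_lt ((he.const_mul _).mul ((measurable_frob hP).pow_const 2)) ?_).union
      (measurableSet_lt (he.const_mul _) ?_))
  · exact (measurable_frob (measurable_matrix_mul (measurable_dilation hN) hP)).pow_const 2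
  · exact (measurable_frob (measurable_matrix_mul (measurable_dilation hN)
      measurable_const)).pow_const 2

theorem bounds_of_notMem_badSet {Ws : Matrix (Fin d₁) (Fin d₂) ℝ}
    {Q : Matrix (Fin d₁ ⊕ Fin d₂) (Fin d₁ ⊕ Fin d₂) ℝ} {k : ℕ} {σ δ : ℝ} (hσ : 0 < σ) (hδ : 0 < δ)
    (hk : 1 ≤ k) {S : State d₁ d₂} {b : Batch m d₁ d₂} (h : (S, b) ∉ badSet Ws Q k σ δ) :
    frob (dilation (noise Ws S.1 b)) ≤ σ / 8 ∧
      (frob S.2 ^ 2 = (2 * k : ℕ) → frob (dilation (noise Ws S.1 b) * S.2) ≤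
        δ / 6 * Real.sqrt (specNorm (Ws - S.1))) ∧
      frob (dilation (noise Ws S.1 b) * Q) ≤ δ / 6 * Real.sqrt (specNorm (Ws - S.1)) := by
  simp only [badSet, Set.mem_union, Set.mem_ofPred_eq, not_or, not_lt] at h
  obtain ⟨h1, h2, h3⟩ := h
  have hk' : (0 : ℝ) < 2 * k := by
    have : (0 : ℝ) < k := by exact_mod_cast hk
    linarith
  have hsq : (δ / 6 * Real.sqrt (specNorm (Ws - S.1))) ^ 2 = δ ^ 2 / 36 * specNorm (Ws - S.1) := by
    rw [mul_pow, Real.sq_sqrt (specNorm_nonneg _)]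
    ring
  refine ⟨?_, fun hS => ?_, ?_⟩
  · refine abs_le_of_sq_le_sq' ?_ (by positivity) |>.2
    -- The dilation doubles the squared norm: 2 · σ²/128 = (σ/8)².
    rw [frob_dilation_sq]
    linarith
  · refine abs_le_of_sq_le_sq' ?_ (by positivity) |>.2
    rw [hsq]
    refine h2.trans_eq ?_
    rw [hS]
    push_cast
    field_simp
  · refine abs_le_of_sq_le_sq' ?_ (by positivity) |>.2
    rw [hsq]
    exact h3

variable {Ω : Type*} [MeasurableSpace Ω] {P : Measure Ω} [IsProbabilityMeasure P]
  {Z : ℕ × Fin m → Ω → (Fin d₁ → ℝ) × Fin d₂} {Ws : Matrix (Fin d₁) (Fin d₂) ℝ}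
  {Q : Matrix (Fin d₁ ⊕ Fin d₂) (Fin d₁ ⊕ Fin d₂) ℝ} {k : ℕ} {σ δ θ : ℝ}

theorem sqrt_dotProduct_col_sub_le_specNorm (Ws W : Matrix (Fin d₁) (Fin d₂) ℝ) (j : Fin d₂) :
    Real.sqrt ((W.col j - Ws.col j) ⬝ᵥ (W.col j - Ws.col j)) ≤ specNorm (Ws - W) := by
  refine le_trans (le_of_eq ?_) (sqrt_col_le_specNorm (Ws - W) j)
  congr 1
  refine Finset.sum_congr rfl fun i _ => ?_
  simp only [Pi.sub_apply, Matrix.col_apply, Matrix.sub_apply]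
  ring

theorem sqrt_dotProduct_sub_le_two {ι : Type*} [Fintype ι] {u v : ι → ℝ} (hv : v ⬝ᵥ v = 1)
    (hu : u ⬝ᵥ u = 1 ∨ u = 0) : Real.sqrt ((u - v) ⬝ᵥ (u - v)) ≤ 2 := by
  have hu' : u ⬝ᵥ u ≤ 1 := by
    rcases hu with h | h
    · exact h.le
    · simp [h]
  have hs : 0 ≤ (u + v) ⬝ᵥ (u + v) := Finset.sum_nonneg fun i _ => mul_self_nonneg _
  have hpar : (u - v) ⬝ᵥ (u - v) = 2 * (u ⬝ᵥ u) + 2 * (v ⬝ᵥ v) - (u + v) ⬝ᵥ (u + v) := by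
    simp only [sub_dotProduct, dotProduct_sub, add_dotProduct, dotProduct_add]
    ring
  rw [Real.sqrt_le_left (by norm_num)]
  linarith

/-- Markov's inequality for the three conditions. The second threshold scales with the norm of the
second component of S, so that S need not carry a projection of rank 2k. -/
theorem measure_badSet_le (hd : 0 < d₂) (hd' : d₂ ≤ d₁) (hm : 0 < m) (hk : 1 ≤ k)
    (hZ : ∀ q, Measurable (Z q)) (hind : iIndepFun Z P)
    (hlaw : ∀ q, P.map (Z q) = instanceLaw d₁ d₂) (hWs : ∀ j, ∑ i, Ws i j ^ 2 = 1)
    (hθ : 0 ≤ θ) (hQ : frob Q ^ 2 = (2 * k : ℕ))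
    (hσm : noiseConst * (d₁ * d₂ / m) * 2 * d₂ ≤ θ * (σ ^ 2 / 128))
    (hδm : noiseConst * (d₁ * d₂ / m) * (2 * k) ≤ θ * (δ ^ 2 / 36)) {S : State d₁ d₂}
    (hS : ∀ j, S.1.col j ⬝ᵥ S.1.col j = 1 ∨ S.1.col j = 0) (t : ℕ) :
    P {ω | (S, stream Z ω t) ∈ badSet Ws Q k σ δ} ≤ ENNReal.ofReal (3 * θ) := by
  have hk' : (0 : ℝ) < 2 * k := by
    have : (0 : ℝ) < k := by exact_mod_cast hk
    linarith
  have hunit : ∀ j, Ws.col j ⬝ᵥ Ws.col j = 1 := by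
    intro j
    rw [← hWs j]
    exact Finset.sum_congr rfl fun i _ => (sq _).symm
  have hindt : iIndepFun (fun i => Z (t, i)) P :=
    hind.precomp (g := fun i : Fin m => (t, i)) fun i j hij => (Prod.mk.inj hij).2
  have hset : ∀ {e : ℝ}, (∀ j, Real.sqrt ((S.1.col j - Ws.col j) ⬝ᵥ (S.1.col j - Ws.col j)) ≤ e) →
      NoiseSetup P (fun i => Z (t, i)) Ws S.1 e := fun he =>
    ⟨hd, hm, fun i => hZ _, hindt, fun i => hlaw _, hunit, hS, he⟩
  -- For the crude bound on the whole noise, the trivial column distance 2 replaces the current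
  -- error.
  have hN2 := (hset fun j => sqrt_dotProduct_sub_le_two (hunit j) (hS j)).frob_noise
  have hNe := hset (sqrt_dotProduct_col_sub_le_specNorm Ws S.1)
  have he := specNorm_nonneg (Ws - S.1)
  have h1 : P {ω | σ ^ 2 / 128 < frob (noise Ws S.1 (stream Z ω t)) ^ 2} ≤ ENNReal.ofReal θ :=
    measure_lt_le_of_integral_le hN2.1 (fun ω => sq_nonneg _) (by positivity) (hN2.2.trans hσm)
  have h2 : P {ω | δ ^ 2 / 36 / (2 * k) * specNorm (Ws - S.1) * frob S.2 ^ 2 <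
      frob (dilation (noise Ws S.1 (stream Z ω t)) * S.2) ^ 2} ≤ ENNReal.ofReal θ := by
    obtain ⟨hi, hb⟩ := hNe.frob_dilation_mul hd' S.2
    refine measure_lt_le_of_integral_le hi (fun ω => sq_nonneg _) (by positivity) (hb.trans ?_)
    rw [← le_div_iff₀ hk'] at hδm
    calc _ = noiseConst * (d₁ * d₂ / m) * (specNorm (Ws - S.1) * frob S.2 ^ 2) := by ring
      _ ≤ θ * (δ ^ 2 / 36) / (2 * k) * (specNorm (Ws - S.1) * frob S.2 ^ 2) :=
        mul_le_mul_of_nonneg_right hδm (by positivity)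
      _ = _ := by ring
  have h3 : P {ω | δ ^ 2 / 36 * specNorm (Ws - S.1) <
      frob (dilation (noise Ws S.1 (stream Z ω t)) * Q) ^ 2} ≤ ENNReal.ofReal θ := by
    obtain ⟨hi, hb⟩ := hNe.frob_dilation_mul hd' Q
    refine measure_lt_le_of_integral_le hi (fun ω => sq_nonneg _) (by positivity) (hb.trans ?_)
    rw [hQ]
    push_cast
    calc _ = noiseConst * (d₁ * d₂ / m) * (2 * k) * specNorm (Ws - S.1) := by ring
      _ ≤ θ * (δ ^ 2 / 36) * specNorm (Ws - S.1) := mul_le_mul_of_nonneg_right hδm he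
      _ = _ := by ring
  calc _ ≤ _ := measure_union_le _ _
    _ ≤ ENNReal.ofReal θ + (ENNReal.ofReal θ + ENNReal.ofReal θ) :=
      add_le_add h1 ((measure_union_le _ _).trans (add_le_add h2 h3))
    _ = ENNReal.ofReal (3 * θ) := by
      rw [← ENNReal.ofReal_add hθ hθ, ← ENNReal.ofReal_add hθ (by positivity)]
      congr 1
      ring

/-- The state that is paired with batch `t`: at time `0` only the zero estimate matters, since the
initial projection is computed from the same batch. -/
noncomputable def pairedState (Ws : Matrix (Fin d₁) (Fin d₂) ℝ) (τ : ℝ) (bs : ℕ → Batch m d₁ d₂)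
    (t : ℕ) : State d₁ d₂ :=
  if t = 0 then (0, 0) else stateSeq Ws τ bs t

theorem pairedState_fst (Ws : Matrix (Fin d₁) (Fin d₂) ℝ) (τ : ℝ) (bs : ℕ → Batch m d₁ d₂)
    (t : ℕ) : (pairedState Ws τ bs t).1 = (stateSeq Ws τ bs t).1 := by
  by_cases h : t = 0
  · simp [pairedState, h, stateSeq]
  · simp [pairedState, h]

theorem measure_pairedState_badSet_le (hd : 0 < d₂) (hd' : d₂ ≤ d₁) (hm : 0 < m) (hk : 1 ≤ k)
    (hZ : ∀ q, Measurable (Z q)) (hind : iIndepFun Z P)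
    (hlaw : ∀ q, P.map (Z q) = instanceLaw d₁ d₂) (hWs : ∀ j, ∑ i, Ws i j ^ 2 = 1)
    (hθ : 0 ≤ θ) (hQ : frob Q ^ 2 = (2 * k : ℕ))
    (hσm : noiseConst * (d₁ * d₂ / m) * 2 * d₂ ≤ θ * (σ ^ 2 / 128))
    (hδm : noiseConst * (d₁ * d₂ / m) * (2 * k) ≤ θ * (δ ^ 2 / 36)) (τ : ℝ) (t : ℕ) :
    P {ω | (pairedState Ws τ (stream Z ω) t, stream Z ω t) ∈ badSet Ws Q k σ δ} ≤
      ENNReal.ofReal (3 * θ) := by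
  by_cases ht : t = 0
  · simp only [pairedState, ht, if_true]
    refine measure_badSet_le hd hd' hm hk hZ hind hlaw hWs hθ hQ hσm hδm (fun j => Or.inr ?_) 0
    ext i
    simp
  · simp only [pairedState, ht, if_false]
    have ht' : 1 ≤ t := Nat.one_le_iff_ne_zero.2 ht
    exact measure_mem_le_of_indepFun
      (measurable_stateSeq Ws τ ht' fun s _ => measurable_stream hZ s) (measurable_stream hZ t)
      (indepFun_stateSeq_stream hZ hind Ws τ ht') (measurableSet_badSet Ws Q k σ δ) fun ω =>
        measure_badSet_le hd hd' hm hk hZ hind hlaw hWs hθ hQ hσm hδm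
          (stateSeq_unit_or_zero Ws τ (stream Z ω) t) t

/-- On the good event, the errors of every run satisfy the quadratic recursion. -/
theorem error_recursion {T : ℕ} {Dp : Matrix (Fin d₁ ⊕ Fin d₂) (Fin d₁ ⊕ Fin d₂) ℝ}
    (h : IsRangeData (dilation Ws) Q Dp σ) (htr : Q.trace = (2 * k : ℕ)) (hk : 1 ≤ k)
    (hWs : ∀ j, ∑ i, Ws i j ^ 2 = 1) (hσ : σ ≤ specNorm Ws) (hδ : 0 < δ)
    {bs : ℕ → Batch m d₁ d₂} {U V : ℕ → Matrix (Fin d₁ ⊕ Fin d₂) (Fin (2 * k)) ℝ}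
    (hrun : IsRun k T bs (fun t => labels (bs t) Ws) U V)
    (hgood : ∀ t < T, (pairedState Ws ((σ / 4) ^ 2) bs t, bs t) ∉ badSet Ws Q k σ δ) :
    (0 < T → specNorm (Ws - estimate (U 1) (V 1)) ≤ specNorm Ws) ∧
      ∀ t, 1 ≤ t → t < T → specNorm (Ws - estimate (U (t + 1)) (V (t + 1))) ≤
        δ * Real.sqrt (specNorm (Ws - estimate (U t) (V t))) := by
  have hsmall : ∀ t < T,
      frob (dilation (noise Ws (stateSeq Ws ((σ / 4) ^ 2) bs t).1 (bs t))) ≤ σ / 8 := by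
    intro t ht
    have := (bounds_of_notMem_badSet h.pos hδ hk (hgood t ht)).1
    rwa [pairedState_fst] at this
  constructor
  · intro hT
    have hS := tracks_of_isRun h htr hk hWs hT hrun hsmall 0 hT.le
    have hP : IsProj (stateSeq Ws ((σ / 4) ^ 2) bs 0).2 :=
      hS.proj_eq ▸ isProj_mul_transpose hS.orthonormal
    -- Both norms are at most σ/8, so the error is at most 2(2 + 1)σ/8 ≤ σ ≤ ‖Ws‖. No independence
    -- is used at this step.
    refine (specNorm_sub_estimate_le h htr hk hWs hrun hsmall hT).trans ?_
    have h0 := hsmall 0 hT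
    have h1 := hP.frob_mul_le' (dilation (noise Ws (stateSeq Ws ((σ / 4) ^ 2) bs 0).1 (bs 0)))
    have h2 := h.proj.frob_mul_le' (dilation (noise Ws (stateSeq Ws ((σ / 4) ^ 2) bs 0).1 (bs 0)))
    have := h.pos
    linarith
  · intro t ht1 ht
    have hS := tracks_of_isRun h htr hk hWs (by omega) hrun hsmall t ht.le
    have hP : IsProj (stateSeq Ws ((σ / 4) ^ 2) bs t).2 :=
      hS.proj_eq ▸ isProj_mul_transpose hS.orthonormal
    have hfr : frob (stateSeq Ws ((σ / 4) ^ 2) bs t).2 ^ 2 = (2 * k : ℕ) := by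
      rw [hP.frob_sq, ← hS.proj_eq, Matrix.trace_mul_comm, hS.orthonormal, Matrix.trace_one]
      simp
    have hg := hgood t ht
    rw [pairedState, if_neg (by omega)] at hg
    obtain ⟨-, h2, h3⟩ := bounds_of_notMem_badSet h.pos hδ hk hg
    have h2 := h2 hfr
    -- The constants match: 2(2 + 1)δ/6 = δ.
    refine (specNorm_sub_estimate_le h htr hk hWs hrun hsmall ht).trans ?_
    rw [hS.estimate_eq]
    linarith

end GoodEvent

/-! ### Batch size and noise level -/

section SampleSize

variable {m d₁ d₂ k T : ℕ} {W : Matrix (Fin d₁) (Fin d₂) ℝ} {η δ : ℝ}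

/-- Here 720 = 144 · 5; of the power k^{3/2} only one factor k is needed. -/
theorem le_sampleScale (hk : 1 ≤ k) (hW : W.rank = k) :
    720 * (singVal W 1 / singVal W k) ^ 2 * (d₁ * d₂) * k ≤ sampleScale k W := by
  have hσ : 0 < singVal W k := singVal_pos hW hk le_rfl
  have hσ1 : 0 < singVal W 1 := singVal_pos hW le_rfl hk
  have hk' : (1 : ℝ) ≤ k := by exact_mod_cast hk
  have hkp : (k : ℝ) ≤ (k : ℝ) ^ (3 / 2 : ℝ) := by
    simpa using Real.rpow_le_rpow_of_exponent_le hk' (by norm_num : (1 : ℝ) ≤ 3 / 2)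
  have hsq : 720 * (singVal W 1 / singVal W k) ^ 2 ≤
      (12 * Real.sqrt 5 * (singVal W 1 / singVal W k) + 4) ^ 2 := by
    have h5 : Real.sqrt 5 ^ 2 = 5 := Real.sq_sqrt (by norm_num)
    have : 0 ≤ Real.sqrt 5 * (singVal W 1 / singVal W k) := by positivity
    calc _ = 144 * Real.sqrt 5 ^ 2 * (singVal W 1 / singVal W k) ^ 2 := by rw [h5]; ring
      _ ≤ _ := by nlinarith
  rw [sampleScale, mul_assoc _ (d₁ : ℝ) (d₂ : ℝ)]
  exact mul_le_mul (mul_le_mul_of_nonneg_right hsq (by positivity)) hkp (by positivity)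
    (by positivity)

theorem frob_sq_of_unit_col (hWs : ∀ j, ∑ i, W i j ^ 2 = 1) : frob W ^ 2 = d₂ := by
  rw [frob_sq, Finset.sum_comm]
  simp [hWs]

theorem dim_pos_of_rank (hk : 1 ≤ k) (hW : W.rank = k) : 0 < d₂ := by
  have := W.rank_le_width
  omega

/-- The lower bound on the batch size makes the variance of the noise small. -/
theorem noise_level_le (hη : 0 < η) (hk : 1 ≤ k) (hW : W.rank = k) (hd : d₂ < d₁)
    (hWs : ∀ j, ∑ i, W i j ^ 2 = 1) (hT : 0 < T) (hδ : 0 < δ)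
    (hm : 2 * noiseConst / η * T * sampleScale k W / δ ^ 2 ≤ m) (hδ1 : δ ≤ 1) :
    0 < m ∧
    noiseConst * (d₁ * d₂ / m) * 2 * d₂ ≤ η / (3 * T) * (singVal W k ^ 2 / 128) ∧
    noiseConst * (d₁ * d₂ / m) * (2 * k) ≤ η / (3 * T) * (δ ^ 2 / 36) := by
  have hσ : 0 < singVal W k := singVal_pos hW hk le_rfl
  have hσ1 : singVal W k ≤ singVal W 1 := singVal_anti W hk
  have hk' : (1 : ℝ) ≤ k := by exact_mod_cast hk
  have hT' : (0 : ℝ) < T := by exact_mod_cast hT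
  have hd2 : (0 : ℝ) < d₂ := by exact_mod_cast dim_pos_of_rank hk hW
  have hd1 : (0 : ℝ) < d₁ := by exact_mod_cast (Nat.zero_le _).trans_lt hd
  have hc := noiseConst_pos
  set κ := singVal W 1 / singVal W k with hκ
  have hκ1 : 1 ≤ κ := (one_le_div hσ).2 hσ1
  -- Unit columns give ‖W‖² = d₂ in Frobenius norm, which is at most kσ₁². This removes the extra d₂
  -- in the bound on the whole noise.
  have hdim : (d₂ : ℝ) ≤ k * (κ ^ 2 * singVal W k ^ 2) := by
    have h := frob_sq_le_rank_mul W hW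
    rw [frob_sq_of_unit_col hWs] at h
    rwa [hκ, div_pow, div_mul_cancel₀ _ (by positivity)]
  have hm' : 2 * noiseConst * T * (720 * κ ^ 2 * (d₁ * d₂) * k) ≤ m * (η * δ ^ 2) := by
    have h1 : 2 * noiseConst * T * (720 * κ ^ 2 * (d₁ * d₂) * k) ≤
        2 * noiseConst * T * sampleScale k W :=
      mul_le_mul_of_nonneg_left (le_sampleScale hk hW) (by positivity)
    have h2 : 2 * noiseConst / η * T * sampleScale k W / δ ^ 2 =
        2 * noiseConst * T * sampleScale k W / (η * δ ^ 2) := by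
      field_simp
    rw [h2, div_le_iff₀ (by positivity)] at hm
    exact h1.trans hm
  have hmpos : (0 : ℝ) < m := by
    by_contra! hle
    have h1 : (0 : ℝ) < 2 * noiseConst * T * (720 * κ ^ 2 * (d₁ * d₂) * k) := by positivity
    have h2 : m * (η * δ ^ 2) ≤ 0 := mul_nonpos_of_nonpos_of_nonneg hle (by positivity)
    linarith
  set x : ℝ := noiseConst * (d₁ * d₂ / m) with hx
  have hx0 : 0 < x := by positivity
  have hxm : 1440 * T * κ ^ 2 * k * x ≤ η * δ ^ 2 := by
    rw [hx]
    have : 1440 * T * κ ^ 2 * k * (noiseConst * (d₁ * d₂ / m)) =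
        2 * noiseConst * T * (720 * κ ^ 2 * (d₁ * d₂) * k) / m := by
      field_simp
      ring
    rw [this, div_le_iff₀ hmpos]
    linarith
  refine ⟨by exact_mod_cast hmpos, ?_, ?_⟩
  · rw [div_mul_div_comm, le_div_iff₀ (by positivity)]
    have h1 : x * 2 * d₂ * (3 * T * 128) ≤
        x * 2 * (k * (κ ^ 2 * singVal W k ^ 2)) * (3 * T * 128) := by gcongr
    have h2 : 1440 * T * κ ^ 2 * k * x * singVal W k ^ 2 ≤ η * δ ^ 2 * singVal W k ^ 2 := by gcongr
    have h3 : η * δ ^ 2 * singVal W k ^ 2 ≤ η * 1 * singVal W k ^ 2 := by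
      gcongr
      exact pow_le_one₀ hδ.le hδ1
    have h4 : 0 ≤ T * κ ^ 2 * k * x * singVal W k ^ 2 := by positivity
    linarith
  · rw [div_mul_div_comm, le_div_iff₀ (by positivity)]
    have h1 : T * k * x * 1 ≤ T * k * x * κ ^ 2 := by
      gcongr
      exact one_le_pow₀ hκ1
    have h4 : 0 ≤ T * k * x := by positivity
    linarith

end SampleSize

/-! ### Union bound over the iterations -/

section Main

variable {m d₁ d₂ k T : ℕ} {W : Matrix (Fin d₁) (Fin d₂) ℝ} {η δ : ℝ} {Ω : Type*}
  [MeasurableSpace Ω] {P : Measure Ω} [IsProbabilityMeasure P]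
  {Z : ℕ × Fin m → Ω → (Fin d₁ → ℝ) × Fin d₂}

/-- With probability at least `1 - η`, the errors of every run satisfy the quadratic recursion. -/
theorem measure_error_recursion (hη : 0 < η) (hk : 1 ≤ k) (hd : d₂ < d₁) (hW : W.rank = k)
    (hWs : ∀ j, ∑ i, W i j ^ 2 = 1) (hZ : ∀ q, Measurable (Z q)) (hind : iIndepFun Z P)
    (hlaw : ∀ q, P.map (Z q) = instanceLaw d₁ d₂) (hδ : 0 < δ) (hδ1 : δ ≤ 1) (hT : 0 < T)
    (hm : 2 * noiseConst / η * T * sampleScale k W / δ ^ 2 ≤ m) :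
    P {ω | ¬ ∀ U V : ℕ → Matrix (Fin d₁ ⊕ Fin d₂) (Fin (2 * k)) ℝ,
      IsRun k T (stream Z ω) (fun t => labels (stream Z ω t) W) U V →
      (0 < T → specNorm (W - estimate (U 1) (V 1)) ≤ specNorm W) ∧
        ∀ t, 1 ≤ t → t < T → specNorm (W - estimate (U (t + 1)) (V (t + 1))) ≤
          δ * Real.sqrt (specNorm (W - estimate (U t) (V t)))} ≤ ENNReal.ofReal η := by
  obtain ⟨hmpos, h1, h2⟩ := noise_level_le hη hk hW hd hWs hT hδ hm hδ1
  obtain ⟨Q, Dp, hQ, htr⟩ := exists_isRangeData W hk hW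
  have hT' : (0 : ℝ) < T := by exact_mod_cast hT
  have hfrQ : frob Q ^ 2 = (2 * k : ℕ) := by rw [hQ.proj.frob_sq, htr]
  set τ := (singVal W k / 4) ^ 2 with hτ
  calc _ ≤ P (⋃ t ∈ Finset.range T, {ω | (pairedState W τ (stream Z ω) t, stream Z ω t) ∈
        badSet W Q k (singVal W k) δ}) := by
        refine measure_mono fun ω hω => ?_
        by_contra hc
        simp only [Set.mem_iUnion, Finset.mem_range, Set.mem_ofPred_eq, not_exists] at hc
        exact hω fun U V hrun => error_recursion hQ htr hk hWs (singVal_le_specNorm W hk hW) hδ hrun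
          fun t ht => hc t ht
    _ ≤ ∑ t ∈ Finset.range T, P {ω | (pairedState W τ (stream Z ω) t, stream Z ω t) ∈
        badSet W Q k (singVal W k) δ} := measure_biUnion_finset_le _ _
    _ ≤ ∑ _t ∈ Finset.range T, ENNReal.ofReal (3 * (η / (3 * T))) :=
        Finset.sum_le_sum fun t _ => measure_pairedState_badSet_le (dim_pos_of_rank hk hW) hd.le
          hmpos hk hZ hind hlaw hWs (by positivity) hfrQ h1 h2 τ t
    _ = ENNReal.ofReal η := by
        rw [Finset.sum_const, Finset.card_range, ← ENNReal.ofReal_nsmul]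
        congr 1
        rw [nsmul_eq_mul]
        field_simp

end Main

end OneBit

theorem theorem1 :
    ∃ p : ℕ, ∀ η : ℝ, 0 < η → η < 1 → ∃ C : ℝ, 0 < C ∧
      ∀ (d₁ d₂ k T m : ℕ), 1 ≤ k → d₂ < d₁ →
      ∀ W : Matrix (Fin d₁) (Fin d₂) ℝ, W.rank = k → (∀ j, ∑ i, W i j ^ 2 = 1) →
      ∀ (Ω : Type*) [MeasurableSpace Ω] (P : Measure Ω) [IsProbabilityMeasure P]
        (Z : ℕ × Fin m → Ω → (Fin d₁ → ℝ) × Fin d₂),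
        (∀ q, Measurable (Z q)) → iIndepFun Z P →
        (∀ q, P.map (Z q) = OneBit.instanceLaw d₁ d₂) →
        (∀ δ : ℝ, 0 < δ → δ ≤ 1 →
          C * (T : ℝ) ^ p * OneBit.sampleScale k W / δ ^ 2 ≤ m →
          P {ω | ¬ ∀ U V : ℕ → Matrix (Fin d₁ ⊕ Fin d₂) (Fin (2 * k)) ℝ,
              OneBit.IsRun k T (OneBit.stream Z ω)
                (fun t => OneBit.labels (OneBit.stream Z ω t) W) U V →
              OneBit.TwoPhase T δ (OneBit.specNorm W)
                (fun t => OneBit.specNorm (W - OneBit.estimate (U t) (V t)))}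
            ≤ ENNReal.ofReal η) ∧
        (∀ ε : ℝ, 0 < ε → ε ≤ 1 →
          C * (T : ℝ) ^ p * OneBit.sampleScale k W / ε ≤ m →
          Real.logb 2 d₂ + Real.logb 2 (1 + Real.logb 2 (1 / ε)) + 3 ≤ T →
          P {ω | ¬ ∀ U V : ℕ → Matrix (Fin d₁ ⊕ Fin d₂) (Fin (2 * k)) ℝ,
              OneBit.IsRun k T (OneBit.stream Z ω)
                (fun t => OneBit.labels (OneBit.stream Z ω t) W) U V →
              OneBit.specNorm (W - OneBit.estimate (U T) (V T)) ≤ ε}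
            ≤ ENNReal.ofReal η) := by
  -- The power T¹ pays for the union bound. The first part needs only the constant 2; the second
  -- uses δ² = ε/4, and 2 · 4 = 8.
  refine ⟨1, fun η hη _ => ⟨8 * OneBit.noiseConst / η,
    div_pos (mul_pos (by norm_num) OneBit.noiseConst_pos) hη, ?_⟩⟩
  intro d₁ d₂ k T m hk hd W hW hWs Ω _ P _ Z hZ hind hlaw
  have hscale : 0 ≤ OneBit.sampleScale k W := by
    unfold OneBit.sampleScale
    positivity
  have hc := OneBit.noiseConst_pos
  have hd2 := OneBit.dim_pos_of_rank hk hW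
  refine ⟨fun δ hδ hδ1 hm => ?_, fun ε hε hε1 hm hT => ?_⟩
  -- For T = 0 the sample condition says nothing about m, but the two-phase bound is vacuous.
  · rcases Nat.eq_zero_or_pos T with rfl | hT
    · refine (measure_mono_null (t := ∅) ?_ measure_empty).trans_le zero_le
      intro ω hω
      refine hω fun U V _ => ?_
      exact OneBit.twoPhase_of_recursion hδ (fun _ => OneBit.specNorm_nonneg _)
        (fun h => absurd h (lt_irrefl 0)) fun t _ h => absurd h (Nat.not_lt_zero t)
    · refine (measure_mono ?_).trans (OneBit.measure_error_recursion hη hk hd hW hWs hZ hind hlaw hδ hδ1 hT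
        (le_trans ?_ hm))
      · intro ω hω h
        refine hω fun U V hrun => ?_
        obtain ⟨h1, h2⟩ := h U V hrun
        exact OneBit.twoPhase_of_recursion hδ (fun _ => OneBit.specNorm_nonneg _) h1 h2
      · rw [pow_one]
        gcongr
        norm_num
  · have hd2' : (1 : ℝ) ≤ d₂ := by exact_mod_cast hd2
    have hL : 0 ≤ Real.logb 2 (1 / ε) :=
      Real.logb_nonneg (by norm_num) (by rw [le_div_iff₀ hε]; linarith)
    have hTpos : 0 < T := by
      have h1 : 0 ≤ Real.logb 2 d₂ := Real.logb_nonneg (by norm_num) hd2'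
      have h2 : 0 ≤ Real.logb 2 (1 + Real.logb 2 (1 / ε)) :=
        Real.logb_nonneg (by norm_num) (by linarith)
      have : (0 : ℝ) < T := by linarith
      exact_mod_cast this
    have hsq : Real.sqrt ε ≤ 1 := Real.sqrt_le_one.2 hε1
    have hsq0 : 0 < Real.sqrt ε := Real.sqrt_pos.2 hε
    have hnrm : OneBit.specNorm W ≤ d₂ := by
      refine (OneBit.specNorm_le_frob W).trans (abs_le_of_sq_le_sq' ?_ (by positivity)).2
      rw [OneBit.frob_sq_of_unit_col hWs]
      nlinarith
    refine (measure_mono ?_).trans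
      (OneBit.measure_error_recursion (δ := Real.sqrt ε / 2) hη hk hd hW hWs hZ hind hlaw
        (by positivity) (by linarith) hTpos (le_trans (le_of_eq ?_) hm))
    · intro ω hω h
      refine hω fun U V hrun => ?_
      obtain ⟨h1, h2⟩ := h U V hrun
      exact OneBit.final_error_le
        (err := fun t => OneBit.specNorm (W - OneBit.estimate (U t) (V t))) hε hε1 hd2 hnrm
        (OneBit.specNorm_nonneg W) hT (h1 hTpos) h2
    · rw [pow_one, div_pow, Real.sq_sqrt hε.le]
      field_simp
      ring
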